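/- **Problem data.** Let $\mathcal C=\mathbb R^n$ ($n\ge1$) with the Euclidean norm, $M\in\mathbb R^{n\times n}$ symmetric positive definite, $\|v\|_M^2=v^TMv$, $g\in\mathcal C$, $p:\mathcal C\to\mathbb R$ a potential, $f=-\nabla p$, $\mathcal X\subset\mathbb R^m$ the control set, $b(\theta,u)$ a control energy, $\theta_0,\theta_{-1}\in\mathcal C$ fixed, $\delta>0$, $N\in\mathbb N$. The constraints on configurations are $h^i_j(\theta)\ge0$ (finitely many), $h^e_j(\theta)=0$ (finitely many), and, for finitely many $3\times3$ matrices $R$ each stored in nine coordinates of $\theta$, $R\in\mathcal{SO}(3)$, i.e. $\|R^TR-I\|_F=0$ (this counts as one of the $h^e_j$) and $\det R=1$ (not penalized). A grid $\mathcal D$ is a finite set of time indices in $(0,N]\cap\mathbb Q$, initially $\{1,\dots,N\}$. For $i\in\mathcal D\cup\{0\}$ let $\gamma(i)$ be the largest element of $\mathcal D\cup\{0,-1\}$ below $i$, $\delta_i=\delta(i-\gamma(i))$, $\iota(i)=\lceil i\rceil$, $\dot\theta_i=(\theta_i-\theta_{\gamma(i)})/\delta_i$, $\ddot\theta_i=(\dot\theta_i-\dot\theta_{\gamma(i)})/\delta_i$.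 Decision variables are $\theta=(\theta_i)_{i\in\mathcal D}$ and $u=(u_1,\dots,u_N)$; there is a cost $O(\theta,u)=O_{\mathcal D}(\theta,u)$ for every grid. The TO problem is to minimize $O$ over $\theta$ and $u_i\in\mathcal X$ subject to the constrained equations of motion $M\ddot\theta_i=f(\theta_i)+g-\partial_\theta b(\theta_i,u_{\iota(i)})$ (plus constraint forces), $h^e(\theta_i)=0$, $\det R=1$, $h^i(\theta_i)\ge0$, $i\in\mathcal D$. A relaxation consists of functions $\bar p(\theta,L_2)$, $\bar h^e_j(x,L_2)$, $\bar h^i_j(x,L_2)$, $L_2>0$. Put $\bar P^g(\theta)=\bar p(\theta,L_2)+\sum_j\bar h^e_j(h^e_j(\theta),L_2)+\sum_j\bar h^i_j(h^i_j(\theta),L_2)$, $\bar E_i=\frac1{2\delta_i^2}\big\|\theta_i-(1+\tfrac{\delta_i}{\delta_{\gamma(i)}})\theta_{\gamma(i)}+\tfrac{\delta_i}{\delta_{\gamma(i)}}\theta_{\gamma^2(i)}\big\|_M^2+\bar P^g(\theta_i)-g^T\theta_i+b(\theta_i,u_{\iota(i)})$, $c(\theta,u)=(\partial\bar E_i/\partial\theta_i)_{i\in\mathcal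 D}$, $A=\partial c/\partial\theta$ with diagonal blocks $A_{ii}$, $B=\partial c/\partial u$, $\Lambda=\frac12\|c\|^2$, $\psi_\rho=O+\rho\|c\|_1$, $H_i^g=\frac12\|\dot\theta_i\|_M^2+\bar P^g(\theta_i)$. $\sigma_{\min}$ is the smallest singular value. A function $F$ is $L$-curvature bounded if $F+\frac L2\|\cdot\|^2$ is convex and $\nabla F$ is $L$-Lipschitz. **Assumptions.** (A1) For every grid, $O$ is $C^1$ in $(\theta,u)$ with locally Lipschitz $\partial_\theta O,\partial_uO$, and for all $\theta$ and $u\in\mathcal X^N$: $O\ge0$, $\|\partial_\theta O\|+\|\partial_uO\|\le L_1$ for some constant $L_1$. $\mathcal X$ is compact, convex, non-empty. (A2) For all $L_2>0$: $\bar p(\cdot,L_2)$, $\bar h^e_j(h^e_j(\cdot),L_2)$, $\bar h^i_j(h^i_j(\cdot),L_2)$ are curvature bounded with a bound that is a polynomial in $L_2$, and twice differentiable with locally Lipschitz second derivatives; $p\ge0$, and $\bar p=p$ wherever $\bar p\le L_2$ or $p\le L_2$; $\bar h^e_j(x,L_2)$ is non-decreasing in $|x|$ with minimum $0$ and equals $L_2$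 for $|x|=1/L_2$; $\bar h^i_j(x,L_2)$ is non-decreasing in $\max(1/L_2-x,0)$ with minimum $0$ and equals $L_2$ at $x=0$. The $h^e_j,h^i_j$ are locally Lipschitz (possibly non-differentiable), the penalties are $C^1$ in $x$. (A3) $b(\cdot,u)$ is curvature bounded uniformly in $u\in\mathcal X$ and differentiable, $\partial_\theta b$ is differentiable in $(\theta,u)$ with locally Lipschitz derivative, and $\|\partial^2b/\partial\theta\partial u\|$ is bounded on $\mathcal C\times\mathcal X$. (A4) $h^e_j(\theta_0)=0$, $\det R(\theta_0)=1$, $h^i_j(\theta_0)>0$ for all constraints. **Control constant.** $b$ is a finite sum of energies of the following types, and $\kappa$ is the sum of the corresponding constants: force control $-\theta^TJu$, with $\kappa=\|J\|L_{15}$ where $\|u\|\le L_{15}$ on $\mathcal X$; cable control $u_c\sqrt{\|(X^a\theta+t^a)-(X^b\theta+t^b)\|^2+\epsilon_r}$, with $\kappa=\|X^a-X^b\|L_{15}$ where $0\le u_c\le L_{15}$ on $\mathcal X$; PD-control $-\mathrm{tr}((R^a)^TR^bR_x(u_c)^T)\big/\big(\sqrt{\|R^a\|_F^2+\epsilon_r}\sqrt{\|R^b\|_F^2+\epsilon_r}\big)$,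 with $\kappa=4/\sqrt{\epsilon_r}$, where $R^a,R^b$ are nine-coordinate submatrices of $\theta$ and $R_x(t)$ is the rotation about the X-axis; here $u_c$ is a component of $u$ and $\epsilon_r>0$. **Solver.** Inputs: $\theta\in\mathcal C^N$, $u\in\mathcal X^N$, $L_3,L_4,L_{10}>0$, $L_5\ge1$, $\eta,\alpha\in(0,1)$, $\epsilon>0$ ($\epsilon<1$ if rotations are present). Let $K=(\|g\|+\kappa)^2+\epsilon^2$, $L_{14}^N=e^{6N\delta/\sigma_{\min}(M)}\big(\frac12\|(\theta_0-\theta_{-1})/\delta\|_M^2+p(\theta_0)+KN\delta\big)$, choose any $L_2$ larger than $L_{14}^N$, $1/\epsilon$, $p(\theta_0)$ and all $1/h^i_j(\theta_0)$, and let $\epsilon'=2^{2/3}\epsilon/9$ if rotations are present and $\epsilon'=\epsilon$ otherwise. Subdividing at $i\in\mathcal D$ means adding the index $(i+\gamma(i))/2$ to $\mathcal D$ with value $(\theta_i+\theta_{\gamma(i)})/2$. Start with $\rho=0$. *SQP.* Repeat: if $\|c\|_1\ge L_4$ run Constraint-Solve, otherwise SQP-Inner. Each of these first tests, in every iteration,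 whether $\sigma_{\min}(A_{ii})<L_3$ for some $i\in\mathcal D$; if so it stops and $\mathcal D$ is subdivided at the first such $i$. Constraint-Solve stops if $\|c\|_1<L_4$, and else replaces $\theta$ by $\theta+\eta^jd$, where $Ad=-c$ and $j\ge1$ is the smallest integer with $\Lambda(\theta+\eta^jd,u)<(1-2\alpha\eta^j)\Lambda(\theta,u)$. SQP-Inner chooses any symmetric $H_\theta,H_u$ with spectrum in $[1/L_5,L_5]$ and takes the minimizer $d=(d_\theta,d_u)$ of $d_\theta^T\partial_\theta O+d_u^T\partial_uO+\frac12d_\theta^TH_\theta d_\theta+\frac12d_u^TH_ud_u$ subject to $c+Ad_\theta+Bd_u=0$, $u_i+d_{u_i}\in\mathcal X$, with a multiplier $\mu$ of the equality constraint. If $\|d\|<\epsilon'/L_5$ and $\|c\|_1<\epsilon'$, SQP returns. Otherwise $\rho\gets\max(\rho,\max_i\|\mu_i\|+L_{10})$ and $(\theta,u)\gets(\theta,u)+\eta^jd$, with $j\ge1$ the smallest integer for which $\psi_\rho$ becomes smaller than $\psi_\rho(\theta,u)+\alpha\eta^j\big(-\frac1{L_5}\|d\|^2-L_{10}\|c\|_1\big)$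 and, in case $\|c\|_1>L_4$, $\|c\|_1$ does not increase. *TO solver.* Repeat: run SQP from the current $\mathcal D,\theta,u,\rho$. If for some $i\in\mathcal D$ either $H_i^g>e^{6\delta_i/\sigma_{\min}(M)}(H_{\gamma(i)}^g+K\delta_i)$ or, for some rotation, $\mathrm{sgn}\det R(\theta_i)\ne\mathrm{sgn}\det R(\theta_{\gamma(i)})$, subdivide at the first such $i$ and continue; otherwise return $\mathcal D,\theta,u$. **Theorem.** Under (A1)–(A4), for all admissible choices, the TO solver is well defined (every step can be carried out) and stops after finitely many steps, and the returned $\mathcal D,\theta,u$ satisfy $\text{KKT-TO}^\epsilon$, with the state-dependent constraint multipliers $\mu^e_j(\theta_i)=\frac{\partial\bar h^e_j}{\partial x}(h^e_j(\theta_i),L_2)$ and $\mu^i_j(\theta_i)=\frac{\partial\bar h^i_j}{\partial x}(h^i_j(\theta_i),L_2)$. That is, with $$r_i(\theta,u)=M\ddot\theta_i-f(\theta_i)-g+\partial_\theta b(\theta_i,u_{\iota(i)})+\sum_j\mu^e_j(\theta_i)\nabla h^e_j(\theta_i)+\sum_j\mu^i_j(\theta_i)\nabla h^i_j(\theta_i)$$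 (terms with zero multiplier are zero; $h_j$ is differentiable where its multiplier is non-zero, and $p$ is differentiable at $\theta_i$), there are $\mu_\theta=(\mu_{\theta_i})_{i\in\mathcal D}$, $\mu_u=(\mu_{u_i})_{i=1}^N$ and $u'\in\mathcal X^N$ such that $\mathcal L(\theta,u)=O(\theta,u)+\sum_{i\in\mathcal D}\mu_{\theta_i}^Tr_i(\theta,u)+\sum_i\mu_{u_i}^Tu_i$ (with $\mu_\theta,\mu_u$ fixed) is differentiable in $\theta$ and in $u$ at the returned point with $$\|\partial_\theta\mathcal L\|\le\epsilon,\quad\|\partial_u\mathcal L\|\le\epsilon,\quad u_i\in\mathcal X,\ \|u_i-u_i'\|\le\epsilon,\ \mu_{u_i}\in\partial\mathcal X(u_i')\ (\text{normal cone}),$$ and for every $i\in\mathcal D$ the condition $\text{KKT-EOM}_i^\epsilon$ holds: $\|r_i\|\le\epsilon$, $|h^e_j(\theta_i)|\le\epsilon$, $h^i_j(\theta_i)\ge0$, $\mu^i_j(\theta_i)\le0$, $\mu^i_j(\theta_i)\max(h^i_j(\theta_i)-\epsilon,0)=0$, and $|\det R(\theta_i)-1|<\epsilon$ for all rotations. 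-/

import Mathlib

noncomputable section

namespace TrajOpt

/-- Maximal-coordinate configurations. -/
abbrev Config (n : ℕ) := EuclideanSpace ℝ (Fin n)

/-- Control signals at one (integer) time instance. -/
abbrev Control (m : ℕ) := EuclideanSpace ℝ (Fin m)

/-- A set `D` of (possibly fractional) time indices; `Traj n D` is the concatenation of the
decision variables `θ_i`, `i ∈ D`, with the Euclidean norm. -/
abbrev Traj (n : ℕ) (D : Finset ℚ) := PiLp 2 (fun _ : D => Config n)

/-- The concatenated control signals; the entry `k : Fin N` is `u_{k+1}`. -/
abbrev Controls (m N : ℕ) := PiLp 2 (fun _ : Fin N => Control m)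

/-! ### Generic notions -/

/-- Smallest singular value: the minimum of `‖A v‖` over unit vectors. -/
def sigmaMin {n : ℕ} (A : Config n →L[ℝ] Config n) : ℝ :=
  sInf ((fun v => ‖A v‖) '' Metric.sphere (0 : Config n) 1)

/-- `L`-curvature bounded: `L`-weakly convex with `L`-Lipschitz gradient. -/
def CurvatureBounded {n : ℕ} (L : ℝ) (F : Config n → ℝ) : Prop :=
  ConvexOn ℝ Set.univ (fun θ => F θ + L / 2 * ‖θ‖ ^ 2) ∧
    ∀ θ θ', ‖gradient F θ - gradient F θ'‖ ≤ L * ‖θ - θ'‖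

/-- Twice differentiable with locally Lipschitz second derivative. -/
def TwiceDiffLip {n : ℕ} (F : Config n → ℝ) : Prop :=
  Differentiable ℝ F ∧ Differentiable ℝ (gradient F) ∧
    LocallyLipschitz (fderiv ℝ (gradient F))

/-- The normal cone of `X` at `v`, i.e. the subdifferential of the indicator function of `X`. -/
def normalCone {m : ℕ} (X : Set (Control m)) (v : Control m) : Set (Control m) :=
  {w | ∀ x ∈ X, inner ℝ w (x - v) ≤ 0}

/-- The entrywise `1`-norm of a concatenated vector. -/
def l1norm {n : ℕ} {D : Finset ℚ} (x : Traj n D) : ℝ := ∑ i : D, ∑ a : Fin n, |x i a|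

/-- The `3 × 3` matrix stored in nine coordinates of a configuration. -/
def subMatrix {n : ℕ} (e : Fin 3 × Fin 3 ↪ Fin n) (θ : Config n) : Matrix (Fin 3) (Fin 3) ℝ :=
  Matrix.of fun a b => θ (e (a, b))

/-- Frobenius norm. -/
def frob (A : Matrix (Fin 3) (Fin 3) ℝ) : ℝ := Real.sqrt (∑ a, ∑ b, A a b ^ 2)

/-- The symmetric positive-definite approximate Hessians, with spectrum in `[1 / L₅, L₅]`. -/
def HessianBound {E : Type*} [NormedAddCommGroup E] [InnerProductSpace ℝ E] (L5 : ℝ)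
    (H : E →L[ℝ] E) : Prop :=
  (H : E →ₗ[ℝ] E).IsSymmetric ∧
    ∀ v, 1 / L5 * ‖v‖ ^ 2 ≤ inner ℝ v (H v) ∧ inner ℝ v (H v) ≤ L5 * ‖v‖ ^ 2

/-! ### Time indices -/

/-- `γ(i)`: the time index preceding `i`, among `-1`, `0` and the indices in `D`. -/
def pred (D : Finset ℚ) (i : ℚ) : ℚ :=
  ((insert (-1) (insert 0 D)).filter (· < i)).max.unbotD (i - 1)

/-- The control signal `u_{ι(i)}`, `ι(i) = ⌈i⌉`, used at the time index `i ∈ (0, N]`. -/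
def ctrl {m N : ℕ} (u : Controls m N) (i : ℚ) : Control m :=
  if h : ⌈i⌉₊ - 1 < N then u ⟨⌈i⌉₊ - 1, h⟩ else 0

/-! ### Control energies -/

/-- Rotation about the X-axis. -/
def rotX (t : ℝ) : Matrix (Fin 3) (Fin 3) ℝ :=
  !![1, 0, 0; 0, Real.cos t, -Real.sin t; 0, Real.sin t, Real.cos t]

/-- `ControlConstant X b k`: the control energy `b` is of one of the supported types (force
control, cable-driven control, PD-control of joint angles, or a sum of such energies), and `k` is
the constant `‖J‖ L₁₅` that the solver computes for it. In the PD case the bilinear form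
`(R^a, R^b) ↦ tr((R^a)ᵀ R^b R_x(u)ᵀ)` has norm one, so that `L₁₅ = 1` and `‖J‖ = 4 / √ε_r`. -/
inductive ControlConstant {n m : ℕ} (X : Set (Control m)) :
    (Config n → Control m → ℝ) → ℝ → Prop
  | force (J : Control m →L[ℝ] Config n) (L15 : ℝ) (hL : ∀ u ∈ X, ‖u‖ ≤ L15) :
      ControlConstant X (fun θ u => -inner ℝ θ (J u)) (‖J‖ * L15)
  | cable (Xa Xb : Config n →L[ℝ] EuclideanSpace ℝ (Fin 3)) (ta tb : EuclideanSpace ℝ (Fin 3))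
      (er : ℝ) (her : 0 < er) (c : Fin m) (hc : ∀ u ∈ X, 0 ≤ u c)
      (L15 : ℝ) (hL : ∀ u ∈ X, |u c| ≤ L15) :
      ControlConstant X
        (fun θ u => u c * Real.sqrt (‖(Xa θ + ta) - (Xb θ + tb)‖ ^ 2 + er)) (‖Xa - Xb‖ * L15)
  | pd (ea eb : Fin 3 × Fin 3 ↪ Fin n) (er : ℝ) (her : 0 < er) (c : Fin m) :
      ControlConstant X
        (fun θ u =>
          -(((subMatrix ea θ).transpose * subMatrix eb θ * (rotX (u c)).transpose).trace /
            (Real.sqrt (frob (subMatrix ea θ) ^ 2 + er) *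
              Real.sqrt (frob (subMatrix eb θ) ^ 2 + er))))
        (4 / Real.sqrt er)
  | add (b₁ b₂ : Config n → Control m → ℝ) (k₁ k₂ : ℝ) (h₁ : ControlConstant X b₁ k₁)
      (h₂ : ControlConstant X b₂ k₂) :
      ControlConstant X (fun θ u => b₁ θ u + b₂ θ u) (k₁ + k₂)

/-! ### The trajectory optimization problem -/

/-- The data of a trajectory optimization problem together with the relaxed potential and the
penalty functions. `nE` is the number of equality constraints other than rotation constraints,
`nI` the number of inequality constraints and `nR` the number of rotation matrices. -/
structure TOProblem (n m nE nI nR : ℕ) where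
  /-- mass matrix -/
  M : Matrix (Fin n) (Fin n) ℝ
  /-- potential energy -/
  p : Config n → ℝ
  /-- relaxed potential energy, as a function of `θ` and `L₂` -/
  pbar : Config n → ℝ → ℝ
  /-- constant external force -/
  g : Config n
  /-- control energy -/
  b : Config n → Control m → ℝ
  /-- equality constraints `h = 0` other than those for rotations -/
  he : Fin nE → Config n → ℝ
  /-- inequality constraints `h ≥ 0` -/
  hi : Fin nI → Config n → ℝ
  /-- the coordinates of the rotation matrices -/
  rot : Fin nR → (Fin 3 × Fin 3 ↪ Fin n)
  /-- penalty functions `x, L₂ ↦ h̄(x, L₂)` of the equality constraints, including the rotation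
  constraints `‖RᵀR - I‖_F = 0` -/
  hebar : Fin nE ⊕ Fin nR → ℝ → ℝ → ℝ
  /-- penalty functions of the inequality constraints -/
  hibar : Fin nI → ℝ → ℝ → ℝ
  /-- feasible control signals -/
  X : Set (Control m)
  /-- number of frames -/
  N : ℕ
  /-- standard timestep size -/
  δ : ℝ
  /-- initial configuration `θ_0` -/
  θ0 : Config n
  /-- configuration `θ_{-1}` -/
  θm1 : Config n
  /-- cost function, for every set of time indices that subdivision can produce -/
  O : (D : Finset ℚ) → Traj n D → Controls m N → ℝ

/-- Parameters of the solver; `k` is the constant `‖J‖ L₁₅`. -/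
structure SolverParams where
  L2 : ℝ
  L3 : ℝ
  L4 : ℝ
  L5 : ℝ
  L10 : ℝ
  ε : ℝ
  η : ℝ
  α : ℝ
  k : ℝ

namespace TOProblem

variable {n m nE nI nR : ℕ} (S : TOProblem n m nE nI nR)

/-- The rotation matrix of index `r`. -/
def R (r : Fin nR) (θ : Config n) : Matrix (Fin 3) (Fin 3) ℝ := subMatrix (S.rot r) θ

/-- All penalized equality constraints: the given ones and `‖RᵀR - I‖_F = 0`. The remaining
constraints `det R = 1` are not penalized. -/
def eqc : Fin nE ⊕ Fin nR → Config n → ℝ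
  | Sum.inl j => S.he j
  | Sum.inr r => fun θ => frob ((S.R r θ).transpose * S.R r θ - 1)

/-- The linear map of the mass matrix. -/
def mass : Config n →L[ℝ] Config n := Matrix.toEuclideanCLM (𝕜 := ℝ) S.M

/-- `‖v‖²_M`. -/
def normMSq (v : Config n) : ℝ := inner ℝ v (S.mass v)

/-! ### Assumptions -/

/-- Assumption on the cost function and on the control set. -/
def CostAssumption : Prop :=
  (∀ D : Finset ℚ,
    (∀ θ u, (∀ i, u i ∈ S.X) → 0 ≤ S.O D θ u) ∧
    ContDiff ℝ 1 (fun z : Traj n D × Controls m S.N => S.O D z.1 z.2) ∧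
    LocallyLipschitz (fun z : Traj n D × Controls m S.N =>
      gradient (fun θ => S.O D θ z.2) z.1) ∧
    LocallyLipschitz (fun z : Traj n D × Controls m S.N =>
      gradient (fun u => S.O D z.1 u) z.2) ∧
    ∃ L1 : ℝ, ∀ θ u, (∀ i, u i ∈ S.X) →
      ‖gradient (fun θ' => S.O D θ' u) θ‖ + ‖gradient (fun u' => S.O D θ u') u‖ ≤ L1) ∧
  IsCompact S.X ∧ Convex ℝ S.X ∧ S.X.Nonempty

/-- Assumption on the relaxed potential. -/
def PotentialRelaxation : Prop :=
  (∃ q : Polynomial ℝ, ∀ L2 > 0, CurvatureBounded (q.eval L2) (fun θ => S.pbar θ L2)) ∧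
  (∀ L2 > 0, TwiceDiffLip (fun θ => S.pbar θ L2)) ∧
  (∀ θ, 0 ≤ S.p θ) ∧
  ∀ L2 > 0, ∀ θ, (S.pbar θ L2 ≤ L2 ∨ S.p θ ≤ L2) → S.pbar θ L2 = S.p θ

/-- Assumption on the penalties of the equality constraints. The constraints are locally Lipschitz
but possibly non-differentiable; the penalties are continuously differentiable functions of the
constraint value. -/
def EqualityRelaxation : Prop :=
  (∀ j, LocallyLipschitz (S.he j)) ∧
  ∀ j : Fin nE ⊕ Fin nR,
    (∃ q : Polynomial ℝ, ∀ L2 > 0,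
      CurvatureBounded (q.eval L2) (fun θ => S.hebar j (S.eqc j θ) L2)) ∧
    ∀ L2 > 0,
      TwiceDiffLip (fun θ => S.hebar j (S.eqc j θ) L2) ∧
      ContDiff ℝ 1 (fun x => S.hebar j x L2) ∧
      (∀ x y : ℝ, |x| ≤ |y| → S.hebar j x L2 ≤ S.hebar j y L2) ∧
      IsLeast (Set.range fun x => S.hebar j x L2) 0 ∧
      ∀ x : ℝ, |x| = 1 / L2 → S.hebar j x L2 = L2

/-- Assumption on the penalties of the inequality constraints. -/
def InequalityRelaxation : Prop :=
  (∀ j, LocallyLipschitz (S.hi j)) ∧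
  ∀ j : Fin nI,
    (∃ q : Polynomial ℝ, ∀ L2 > 0,
      CurvatureBounded (q.eval L2) (fun θ => S.hibar j (S.hi j θ) L2)) ∧
    ∀ L2 > 0,
      TwiceDiffLip (fun θ => S.hibar j (S.hi j θ) L2) ∧
      ContDiff ℝ 1 (fun x => S.hibar j x L2) ∧
      (∀ x y : ℝ, max (1 / L2 - x) 0 ≤ max (1 / L2 - y) 0 → S.hibar j x L2 ≤ S.hibar j y L2) ∧
      IsLeast (Set.range fun x => S.hibar j x L2) 0 ∧
      S.hibar j 0 L2 = L2

/-- Curvature-bounded relaxation assumption. -/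
def RelaxationAssumption : Prop :=
  S.PotentialRelaxation ∧ S.EqualityRelaxation ∧ S.InequalityRelaxation

/-- The control force (up to sign) `∂b/∂θ`, as a function of `(θ, u)`. -/
def bgrad (z : Config n × Control m) : Config n := gradient (fun θ => S.b θ z.2) z.1

/-- Control-bound assumption: `b` is curvature bounded in `θ`, has locally Lipschitz second
derivatives `∂²b/∂θ²`, `∂²b/∂θ∂u`, and the latter is uniformly bounded. -/
def ControlBoundAssumption : Prop :=
  (∃ L : ℝ, ∀ u ∈ S.X, CurvatureBounded L (fun θ => S.b θ u)) ∧
  (∀ u, Differentiable ℝ (fun θ => S.b θ u)) ∧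
  Differentiable ℝ S.bgrad ∧
  LocallyLipschitz (fderiv ℝ S.bgrad) ∧
  ∃ B : ℝ, ∀ θ, ∀ u ∈ S.X, ‖fderiv ℝ (fun v => S.bgrad (θ, v)) u‖ ≤ B

/-- Slater's condition at the initial configuration. -/
def SlaterAssumption : Prop :=
  (∀ j, S.eqc j S.θ0 = 0) ∧ (∀ r, (S.R r S.θ0).det = 1) ∧ ∀ j, 0 < S.hi j S.θ0

/-! ### Discrete dynamics -/

/-- The configuration at a time index: a decision variable for `i ∈ D`, else `θ_0` or `θ_{-1}`. -/
def frame {D : Finset ℚ} (θ : Traj n D) (i : ℚ) : Config n :=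
  if h : i ∈ D then θ ⟨i, h⟩ else if i = 0 then S.θ0 else S.θm1

/-- The timestep size `δ_i`. -/
def dt (D : Finset ℚ) (i : ℚ) : ℝ := S.δ * ((i - pred D i : ℚ) : ℝ)

/-- The velocity at index `i`. -/
def vel {D : Finset ℚ} (θ : Traj n D) (i : ℚ) : Config n :=
  (S.dt D i)⁻¹ • (S.frame θ i - S.frame θ (pred D i))

/-- The acceleration at index `i`. -/
def acc {D : Finset ℚ} (θ : Traj n D) (i : ℚ) : Config n :=
  (S.dt D i)⁻¹ • (S.vel θ i - S.vel θ (pred D i))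

/-- Relaxed potential and penalties, without the external force and the control. -/
def Pg (L2 : ℝ) (θ : Config n) : ℝ :=
  S.pbar θ L2 + ∑ j, S.hebar j (S.eqc j θ) L2 + ∑ j, S.hibar j (S.hi j θ) L2

/-- The total relaxed potential. -/
def Pbar (L2 : ℝ) (θ : Config n) (u : Control m) : ℝ :=
  S.Pg L2 θ - inner ℝ S.g θ + S.b θ u

/-- The relaxed incremental potential `Ē_i(θ_i, θ_{γ(i)}, θ_{γ²(i)}, u)` for the step sizes
`d = δ_i` and `d' = δ_{γ(i)}`. -/
def Ebar (L2 d d' : ℝ) (t t' t'' : Config n) (u : Control m) : ℝ :=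
  1 / (2 * d ^ 2) * S.normMSq (t - (1 + d / d') • t' + (d / d') • t'') + S.Pbar L2 t u

/-- `Ē_i` as a function of its first argument along a trajectory. -/
def EbarAt (L2 : ℝ) {D : Finset ℚ} (θ : Traj n D) (u : Controls m S.N) (i : ℚ) :
    Config n → ℝ := fun t =>
  S.Ebar L2 (S.dt D i) (S.dt D (pred D i)) t (S.frame θ (pred D i))
    (S.frame θ (pred D (pred D i))) (ctrl u i)

/-- The stacked gradients `∂Ē_i/∂θ_i`. -/
def gradL (L2 : ℝ) {D : Finset ℚ} (θ : Traj n D) (u : Controls m S.N) : Traj n D :=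
  WithLp.toLp 2 fun i : D => gradient (S.EbarAt L2 θ u i) (θ i)

/-- The diagonal block `∂²Ē_i/∂θ_i²`. -/
def diagBlock (L2 : ℝ) {D : Finset ℚ} (θ : Traj n D) (u : Controls m S.N) (i : D) :
    Config n →L[ℝ] Config n :=
  fderiv ℝ (gradient (S.EbarAt L2 θ u i)) (θ i)

/-- The Jacobian of `gradL` in `θ`. -/
def jacθ (L2 : ℝ) {D : Finset ℚ} (θ : Traj n D) (u : Controls m S.N) :
    Traj n D →L[ℝ] Traj n D :=
  fderiv ℝ (fun θ' => S.gradL L2 θ' u) θ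

/-- The Jacobian of `gradL` in `u`. -/
def jacu (L2 : ℝ) {D : Finset ℚ} (θ : Traj n D) (u : Controls m S.N) :
    Controls m S.N →L[ℝ] Traj n D :=
  fderiv ℝ (fun u' => S.gradL L2 θ u') u

/-- The accumulated squared residual `Λ = ∑ᵢ ‖∂Ē_i/∂θ_i‖² / 2`. -/
def Lam (L2 : ℝ) {D : Finset ℚ} (θ : Traj n D) (u : Controls m S.N) : ℝ :=
  ∑ i : D, ‖S.gradL L2 θ u i‖ ^ 2 / 2

/-- The merit function. -/
def merit (L2 ρ : ℝ) {D : Finset ℚ} (θ : Traj n D) (u : Controls m S.N) : ℝ :=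
  S.O D θ u + ρ * l1norm (S.gradL L2 θ u)

/-- The energy `H_i^g`: kinetic energy, relaxed potential and penalties. -/
def Hg (L2 : ℝ) {D : Finset ℚ} (θ : Traj n D) (i : ℚ) : ℝ :=
  1 / 2 * S.normMSq (S.vel θ i) + S.Pg L2 (S.frame θ i)

/-! ### The solver -/

/-- Midpoint subdivision of the step ending at `i`. -/
def subdivide {D : Finset ℚ} (θ : Traj n D) (i : ℚ) : Traj n (insert ((i + pred D i) / 2) D) :=
  WithLp.toLp 2 fun j =>
    if h : (j : ℚ) ∈ D then θ ⟨j, h⟩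
    else (1 / 2 : ℝ) • (S.frame θ i + S.frame θ (pred D i))

/-- The singularity check fails at `i`. -/
def SingularAt (P : SolverParams) {D : Finset ℚ} (θ : Traj n D) (u : Controls m S.N) (i : ℚ) :
    Prop :=
  ∃ h : i ∈ D, sigmaMin (S.diagBlock P.L2 θ u ⟨i, h⟩) < P.L3

/-- Sufficient decrease in the constraint solver, for the step size `t`. -/
def WolfeC (P : SolverParams) {D : Finset ℚ} (θ : Traj n D) (u : Controls m S.N) (d : Traj n D)
    (t : ℝ) : Prop :=
  S.Lam P.L2 (θ + t • d) u < (1 - 2 * P.α * t) * S.Lam P.L2 θ u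

/-- Feasible points of the quadratic program. -/
def QPFeasible (L2 : ℝ) {D : Finset ℚ} (θ : Traj n D) (u : Controls m S.N) (dθ : Traj n D)
    (du : Controls m S.N) : Prop :=
  (∀ i, u i + du i ∈ S.X) ∧
    S.gradL L2 θ u + S.jacθ L2 θ u dθ + S.jacu L2 θ u du = 0

/-- Objective of the quadratic program. -/
def qpObj {D : Finset ℚ} (θ : Traj n D) (u : Controls m S.N)
    (Hθ : Traj n D →L[ℝ] Traj n D) (Hu : Controls m S.N →L[ℝ] Controls m S.N)
    (dθ : Traj n D) (du : Controls m S.N) : ℝ :=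
  inner ℝ dθ (gradient (fun θ' => S.O D θ' u) θ) + inner ℝ du (gradient (fun u' => S.O D θ u') u) +
    1 / 2 * inner ℝ dθ (Hθ dθ) + 1 / 2 * inner ℝ du (Hu du)

/-- `(dθ, du)` solves the quadratic program and `μ` is a Lagrange multiplier of its equality
constraint. -/
def QPSolution (L2 : ℝ) {D : Finset ℚ} (θ : Traj n D) (u : Controls m S.N)
    (Hθ : Traj n D →L[ℝ] Traj n D) (Hu : Controls m S.N →L[ℝ] Controls m S.N)
    (dθ : Traj n D) (du : Controls m S.N) (μ : Traj n D) : Prop :=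
  S.QPFeasible L2 θ u dθ du ∧
  (∀ eθ eu, S.QPFeasible L2 θ u eθ eu → S.qpObj θ u Hθ Hu dθ du ≤ S.qpObj θ u Hθ Hu eθ eu) ∧
  ∃ μu : Controls m S.N,
    gradient (fun θ' => S.O D θ' u) θ + Hθ dθ +
      ContinuousLinearMap.adjoint (S.jacθ L2 θ u) μ = 0 ∧
    gradient (fun u' => S.O D θ u') u + Hu du +
      ContinuousLinearMap.adjoint (S.jacu L2 θ u) μ + μu = 0 ∧
    ∀ i, μu i ∈ normalCone S.X (u i + du i)

/-- The norm of the concatenation of `dθ` and `du`. -/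
def stepNorm {D : Finset ℚ} {N : ℕ} (dθ : Traj n D) (du : Controls m N) : ℝ :=
  Real.sqrt (‖dθ‖ ^ 2 + ‖du‖ ^ 2)

/-- Line-search condition of the inner SQP solver, for the step size `t`. -/
def LineSearch (P : SolverParams) (ρ : ℝ) {D : Finset ℚ} (θ : Traj n D) (u : Controls m S.N)
    (dθ : Traj n D) (du : Controls m S.N) (t : ℝ) : Prop :=
  S.merit P.L2 ρ (θ + t • dθ) (u + t • du) <
      S.merit P.L2 ρ θ u +
        P.α * t * (-(1 / P.L5) * stepNorm dθ du ^ 2 - P.L10 * l1norm (S.gradL P.L2 θ u)) ∧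
    (P.L4 < l1norm (S.gradL P.L2 θ u) →
      l1norm (S.gradL P.L2 (θ + t • dθ) (u + t • du)) ≤ l1norm (S.gradL P.L2 θ u))

/-- Termination test of the inner SQP solver, with tolerance `ε`. -/
def Converged (P : SolverParams) (ε : ℝ) {D : Finset ℚ} (θ : Traj n D) (u : Controls m S.N)
    (dθ : Traj n D) (du : Controls m S.N) : Prop :=
  stepNorm dθ du < ε / P.L5 ∧ l1norm (S.gradL P.L2 θ u) < ε

/-- The tolerance `ε'` handed to the SQP solver. -/
def tol (_S : TOProblem n m nE nI nR) (P : SolverParams) : ℝ :=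
  if 0 < nR then (2 : ℝ) ^ (2 / 3 : ℝ) * P.ε / 9 else P.ε

/-- The energy test or the determinant test of the TO solver fails at `i`. -/
def CheckFails (P : SolverParams) {D : Finset ℚ} (θ : Traj n D) (i : ℚ) : Prop :=
  i ∈ D ∧
    (Real.exp (6 * S.dt D i / sigmaMin S.mass) *
        (S.Hg P.L2 θ (pred D i) + ((‖S.g‖ + P.k) ^ 2 + P.ε ^ 2) * S.dt D i) < S.Hg P.L2 θ i ∨
      ∃ r, SignType.sign (S.R r (S.frame θ i)).det ≠
        SignType.sign (S.R r (S.frame θ (pred D i))).det)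

/-- The a-priori energy bound `L₁₄^N`. -/
def L14 (P : SolverParams) : ℝ :=
  Real.exp (6 * (S.N * S.δ) / sigmaMin S.mass) *
    (1 / 2 * S.normMSq (S.δ⁻¹ • (S.θ0 - S.θm1)) + S.p S.θ0 +
      ((‖S.g‖ + P.k) ^ 2 + P.ε ^ 2) * (S.N * S.δ))

/-- Admissible inputs of the solver, and the requirement
`L₂ > max(L₁₃, 1 / ε, L₁₄^N)`, `L₁₃ = max(1 / min_j h_j(θ_0), p(θ_0))`. -/
def ValidParams (P : SolverParams) : Prop :=
  0 < P.L3 ∧ 0 < P.L4 ∧ 1 ≤ P.L5 ∧ 0 < P.L10 ∧ 0 < P.ε ∧ (0 < nR → P.ε < 1) ∧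
  P.η ∈ Set.Ioo 0 1 ∧ P.α ∈ Set.Ioo 0 1 ∧
  ControlConstant S.X S.b P.k ∧
  (∀ j, 1 / S.hi j S.θ0 < P.L2) ∧ S.p S.θ0 < P.L2 ∧ 1 / P.ε < P.L2 ∧ S.L14 P < P.L2

/-- Program points: the loop heads of `SQP`, `Constraint-Solve`, `SQP-Inner`, the tests that the TO
solver performs after `SQP` has returned, and the end of the computation. -/
inductive Loc
  | sqp
  | constraint
  | inner
  | check
  | done

/-- A state of the computation. -/
structure State where
  loc : Loc
  D : Finset ℚ
  θ : Traj n D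
  u : Controls m S.N
  ρ : ℝ

/-- One step of the white-box TO solver. The relation is nondeterministic where the algorithm
leaves a choice: the approximate Hessians. -/
inductive Step (P : SolverParams) : S.State → S.State → Prop
  /-- `SQP` calls `Constraint-Solve` -/
  | callConstraint (D : Finset ℚ) (θ : Traj n D) (u : Controls m S.N) (ρ : ℝ)
      (h : P.L4 ≤ l1norm (S.gradL P.L2 θ u)) :
      Step P ⟨Loc.sqp, D, θ, u, ρ⟩ ⟨Loc.constraint, D, θ, u, ρ⟩
  /-- `SQP` calls `SQP-Inner` -/
  | callInner (D : Finset ℚ) (θ : Traj n D) (u : Controls m S.N) (ρ : ℝ)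
      (h : l1norm (S.gradL P.L2 θ u) < P.L4) :
      Step P ⟨Loc.sqp, D, θ, u, ρ⟩ ⟨Loc.inner, D, θ, u, ρ⟩
  /-- `Constraint-Solve` fails at `i`, and `SQP` subdivides -/
  | constraintSubdivide (D : Finset ℚ) (θ : Traj n D) (u : Controls m S.N) (ρ : ℝ) (i : ℚ)
      (h : IsLeast {j | S.SingularAt P θ u j} i) :
      Step P ⟨Loc.constraint, D, θ, u, ρ⟩
        ⟨Loc.sqp, insert ((i + pred D i) / 2) D, S.subdivide θ i, u, ρ⟩
  /-- `Constraint-Solve` returns normally -/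
  | constraintReturn (D : Finset ℚ) (θ : Traj n D) (u : Controls m S.N) (ρ : ℝ)
      (h : ∀ i, ¬ S.SingularAt P θ u i) (h' : l1norm (S.gradL P.L2 θ u) < P.L4) :
      Step P ⟨Loc.constraint, D, θ, u, ρ⟩ ⟨Loc.sqp, D, θ, u, ρ⟩
  /-- Newton step with line search -/
  | constraintNewton (D : Finset ℚ) (θ : Traj n D) (u : Controls m S.N) (ρ : ℝ) (d : Traj n D)
      (j : ℕ) (h : ∀ i, ¬ S.SingularAt P θ u i) (h' : P.L4 ≤ l1norm (S.gradL P.L2 θ u))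
      (hd : S.jacθ P.L2 θ u d = -S.gradL P.L2 θ u)
      (hj : IsLeast {l : ℕ | 1 ≤ l ∧ S.WolfeC P θ u d (P.η ^ l)} j) :
      Step P ⟨Loc.constraint, D, θ, u, ρ⟩ ⟨Loc.constraint, D, θ + P.η ^ j • d, u, ρ⟩
  /-- `SQP-Inner` fails at `i`, and `SQP` subdivides -/
  | innerSubdivide (D : Finset ℚ) (θ : Traj n D) (u : Controls m S.N) (ρ : ℝ) (i : ℚ)
      (h : IsLeast {j | S.SingularAt P θ u j} i) :
      Step P ⟨Loc.inner, D, θ, u, ρ⟩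
        ⟨Loc.sqp, insert ((i + pred D i) / 2) D, S.subdivide θ i, u, ρ⟩
  /-- `SQP-Inner`, and hence `SQP`, returns normally -/
  | innerReturn (D : Finset ℚ) (θ : Traj n D) (u : Controls m S.N) (ρ : ℝ)
      (Hθ : Traj n D →L[ℝ] Traj n D) (Hu : Controls m S.N →L[ℝ] Controls m S.N)
      (dθ : Traj n D) (du : Controls m S.N) (μ : Traj n D)
      (h : ∀ i, ¬ S.SingularAt P θ u i)
      (hHθ : HessianBound P.L5 Hθ) (hHu : HessianBound P.L5 Hu)
      (hQP : S.QPSolution P.L2 θ u Hθ Hu dθ du μ)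
      (hc : S.Converged P (S.tol P) θ u dθ du) :
      Step P ⟨Loc.inner, D, θ, u, ρ⟩ ⟨Loc.check, D, θ, u, ρ⟩
  /-- SQP step with update of the penalty coefficient and line search -/
  | innerStep (D : Finset ℚ) (θ : Traj n D) (u : Controls m S.N) (ρ ρ' : ℝ)
      (Hθ : Traj n D →L[ℝ] Traj n D) (Hu : Controls m S.N →L[ℝ] Controls m S.N)
      (dθ : Traj n D) (du : Controls m S.N) (μ : Traj n D) (j : ℕ)
      (h : ∀ i, ¬ S.SingularAt P θ u i)
      (hHθ : HessianBound P.L5 Hθ) (hHu : HessianBound P.L5 Hu)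
      (hQP : S.QPSolution P.L2 θ u Hθ Hu dθ du μ)
      (hc : ¬ S.Converged P (S.tol P) θ u dθ du)
      (hρ : ρ' = max ρ ((⨆ i : D, ‖μ i‖) + P.L10))
      (hj : IsLeast {l : ℕ | 1 ≤ l ∧ S.LineSearch P ρ' θ u dθ du (P.η ^ l)} j) :
      Step P ⟨Loc.inner, D, θ, u, ρ⟩
        ⟨Loc.inner, D, θ + P.η ^ j • dθ, u + P.η ^ j • du, ρ'⟩
  /-- a test of the TO solver fails at `i`: it subdivides and calls `SQP` again -/
  | checkSubdivide (D : Finset ℚ) (θ : Traj n D) (u : Controls m S.N) (ρ : ℝ) (i : ℚ)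
      (h : IsLeast {j | S.CheckFails P θ j} i) :
      Step P ⟨Loc.check, D, θ, u, ρ⟩
        ⟨Loc.sqp, insert ((i + pred D i) / 2) D, S.subdivide θ i, u, ρ⟩
  /-- all tests are passed: the TO solver returns `D, θ, u` -/
  | checkReturn (D : Finset ℚ) (θ : Traj n D) (u : Controls m S.N) (ρ : ℝ)
      (h : ∀ i, ¬ S.CheckFails P θ i) :
      Step P ⟨Loc.check, D, θ, u, ρ⟩ ⟨Loc.done, D, θ, u, ρ⟩

/-- The initial time indices `1, …, N`. -/
def grid0 : Finset ℚ := (Finset.Icc 1 S.N).image (fun k : ℕ => (k : ℚ))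

/-- The initial state, for initial guesses `θ, u`. -/
def start (θ : Traj n S.grid0) (u : Controls m S.N) : S.State := ⟨Loc.sqp, S.grid0, θ, u, 0⟩

/-! ### Perturbed KKT conditions of the original problem -/

/-- The residual of the constrained equation of motion at index `i`,
`M θ̈_i - f - g + ∂b/∂θ_i + ∑ μ^e ∂h^e/∂θ_i + ∑ μ^i ∂h^i/∂θ_i` with `f = -∂p/∂θ_i`, where the
multipliers are functions of the configuration. The multipliers of the constraints `det R = 1`
are zero. -/
def eom (μe : Fin nE ⊕ Fin nR → Config n → ℝ) (μi : Fin nI → Config n → ℝ)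
    {D : Finset ℚ} (θ : Traj n D) (u : Controls m S.N) (i : ℚ) : Config n :=
  S.mass (S.acc θ i) + gradient S.p (S.frame θ i) - S.g +
    gradient (fun t => S.b t (ctrl u i)) (S.frame θ i) +
    ∑ j, μe j (S.frame θ i) • gradient (S.eqc j) (S.frame θ i) +
    ∑ j, μi j (S.frame θ i) • gradient (S.hi j) (S.frame θ i)

/-- The `ε`-perturbed KKT condition of the equation of motion at index `i`. All functions whose
gradients enter with a non-zero coefficient have to be differentiable. -/
def KKTEOM (ε : ℝ) (μe : Fin nE ⊕ Fin nR → Config n → ℝ) (μi : Fin nI → Config n → ℝ)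
    {D : Finset ℚ} (θ : Traj n D) (u : Controls m S.N) (i : ℚ) : Prop :=
  DifferentiableAt ℝ S.p (S.frame θ i) ∧
  (∀ j, μe j (S.frame θ i) ≠ 0 → DifferentiableAt ℝ (S.eqc j) (S.frame θ i)) ∧
  (∀ j, μi j (S.frame θ i) ≠ 0 → DifferentiableAt ℝ (S.hi j) (S.frame θ i)) ∧
  ‖S.eom μe μi θ u i‖ ≤ ε ∧
  (∀ j, |S.eqc j (S.frame θ i)| ≤ ε) ∧
  (∀ r, |(S.R r (S.frame θ i)).det - 1| < ε) ∧
  (∀ j, 0 ≤ S.hi j (S.frame θ i)) ∧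
  (∀ j, μi j (S.frame θ i) ≤ 0) ∧
  ∀ j, μi j (S.frame θ i) * max (S.hi j (S.frame θ i) - ε) 0 = 0

/-- The Lagrangian of the TO problem. -/
def lagrangian (μe : Fin nE ⊕ Fin nR → Config n → ℝ) (μi : Fin nI → Config n → ℝ)
    {D : Finset ℚ} (μθ : Traj n D) (μu : Controls m S.N) (θ : Traj n D) (u : Controls m S.N) : ℝ :=
  S.O D θ u + ∑ i : D, inner ℝ (μθ i) (S.eom μe μi θ u i) + ∑ i, inner ℝ (μu i) (u i)

/-- The `ε`-perturbed KKT condition of the TO problem at `θ, u`, with the constraint multipliers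
given by `μe`, `μi`. -/
def KKTTO (ε : ℝ) (μe : Fin nE ⊕ Fin nR → Config n → ℝ) (μi : Fin nI → Config n → ℝ)
    {D : Finset ℚ} (θ : Traj n D) (u : Controls m S.N) : Prop :=
  (∃ (μθ : Traj n D) (μu u' : Controls m S.N),
    (∃ G, HasGradientAt (fun θ' => S.lagrangian μe μi μθ μu θ' u) G θ ∧ ‖G‖ ≤ ε) ∧
    (∃ G, HasGradientAt (fun u' => S.lagrangian μe μi μθ μu θ u') G u ∧ ‖G‖ ≤ ε) ∧
    ∀ i, u i ∈ S.X ∧ u' i ∈ S.X ∧ ‖u i - u' i‖ ≤ ε ∧ μu i ∈ normalCone S.X (u' i)) ∧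
  ∀ i ∈ D, S.KKTEOM ε μe μi θ u i

/-- The multipliers of the equality constraints: the penalty derivatives `∂h̄_j/∂x (h_j(θ), L₂)`. -/
def multE (L2 : ℝ) (j : Fin nE ⊕ Fin nR) (θ : Config n) : ℝ :=
  deriv (fun x => S.hebar j x L2) (S.eqc j θ)

/-- The multipliers of the inequality constraints. -/
def multI (L2 : ℝ) (j : Fin nI) (θ : Config n) : ℝ :=
  deriv (fun x => S.hibar j x L2) (S.hi j θ)

end TOProblem

end TrajOpt

end

noncomputable section

namespace TrajOpt

open Filter Topology

/-! ### Gradients and curvature -/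

/-! Fixed grid. The residual `c = gradL` at `i` depends on the earlier frames only linearly, through
inertia, so `A = jacθ` is block lower triangular in time. Diagonal blocks with `sigmaMin ≥ L3` make
`A` invertible with a bound on the inverse that does not depend on the iterate
(`exists_jacθ_bound`). Newton directions, steps of the quadratic program and multipliers are then
bounded, and so is the penalty coefficient. Every accepted step of length `t` lowers a potential
that is bounded below by at least `m t` and moves the iterate by at most `C t`. In an infinite loop
the iterates would therefore converge and `t` would tend to `0` (`tendsto_of_descent`). But near a
limit point first-order expansions are uniform, so the rejected trial `t / η` would have passed the
line search (`newtonRel_acc`, `innerRel_acc`). No compactness of level sets enters.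

Grids. A step shorter than some threshold independent of the grid is never subdivided: its diagonal
block is dominated by `M / δ_i²` (`exists_singular_step`), an implicit Euler energy estimate gives
the energy test (`exists_energy_step`), and bounded velocities keep the sign of the determinant of a
nearly orthogonal matrix (`exists_check_step`). Time indices thus stay separated by some `q > 0`,
their number is bounded, and subdivision happens finitely often (`step_acc`).

Correctness. Chaining the energy tests from the initial frame gives energy below `L14 < L2`
everywhere (`energy_lt`). All terms of the relaxed potential are nonnegative, so each is below `L2`.
There `pbar` equals `p`, and the penalties, which attain `L2` at the border of the tolerance, force
approximate equality and strict inequality constraints. By the chain rule the penalty derivatives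
are multipliers, so the residual is the residual of the original equations of motion. The KKT system
of the last quadratic program, whose step is short, gives the perturbed stationarity of the
Lagrangian (`kktto_of_converged`). Determinants are positive because their sign propagates from the
initial frame, and near-orthogonality brings them close to `1`. -/

theorem norm_fderiv_le_of_lipschitz_bound {E F : Type*} [NormedAddCommGroup E] [NormedSpace ℝ E]
    [NormedAddCommGroup F] [NormedSpace ℝ F]
    {f : E → F} {C : ℝ} (hC : 0 ≤ C)
    (h : ∀ x y, ‖f x - f y‖ ≤ C * ‖x - y‖) (x : E) : ‖fderiv ℝ f x‖ ≤ C := by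
  have : LipschitzWith C.toNNReal f := LipschitzWith.of_dist_le_mul fun x y => by
    rw [dist_eq_norm, dist_eq_norm, Real.coe_toNNReal C hC]; exact h x y
  simpa [hC] using norm_fderiv_le_of_lipschitz ℝ (x₀ := x) this

section Gradient

variable {E : Type*} [NormedAddCommGroup E] [InnerProductSpace ℝ E] [CompleteSpace E]

theorem inner_gradient_eq_fderiv (f : E → ℝ) (x v : E) :
    inner ℝ (gradient f x) v = fderiv ℝ f x v := by
  simp [gradient]

theorem norm_gradient (f : E → ℝ) (x : E) : ‖gradient f x‖ = ‖fderiv ℝ f x‖ := by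
  simp [gradient]

theorem gradient_add' {f g : E → ℝ} {x : E} (hf : DifferentiableAt ℝ f x)
    (hg : DifferentiableAt ℝ g x) :
    gradient (fun y => f y + g y) x = gradient f x + gradient g x := by
  have := fderiv_fun_add hf hg
  simp [gradient, this]

theorem gradient_fun_sum {ι : Type*} (s : Finset ι) {f : ι → E → ℝ} {x : E}
    (hf : ∀ j ∈ s, DifferentiableAt ℝ (f j) x) :
    gradient (fun y => ∑ j ∈ s, f j y) x = ∑ j ∈ s, gradient (f j) x := by
  have := fderiv_fun_sum hf
  simp [gradient, this]

theorem norm_gradient_le_of_lipschitz {f : E → ℝ} {C : ℝ} (hC : 0 ≤ C)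
    (h : ∀ x y, |f x - f y| ≤ C * ‖x - y‖) (x : E) : ‖gradient f x‖ ≤ C := by
  rw [norm_gradient]
  have : LipschitzWith C.toNNReal f := LipschitzWith.of_dist_le_mul fun x y => by
    rw [Real.dist_eq, dist_eq_norm, Real.coe_toNNReal C hC]; exact h x y
  simpa [hC] using norm_fderiv_le_of_lipschitz ℝ (x₀ := x) this

/-- A differentiable function with `C¹` and globally Lipschitz gradient. -/
def SmoothLip (F : E → ℝ) : Prop :=
  Differentiable ℝ F ∧ ContDiff ℝ 1 (gradient F) ∧
    ∃ L : ℝ, 0 ≤ L ∧ ∀ x y, ‖gradient F x - gradient F y‖ ≤ L * ‖x - y‖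

theorem SmoothLip.add {F G : E → ℝ} (hF : SmoothLip F) (hG : SmoothLip G) :
    SmoothLip (fun x => F x + G x) := by
  obtain ⟨hF1, hF2, L, hL, hF3⟩ := hF
  obtain ⟨hG1, hG2, L', hL', hG3⟩ := hG
  have e : gradient (fun x => F x + G x) = fun x => gradient F x + gradient G x := by
    funext x; exact gradient_add' (hF1 x) (hG1 x)
  refine ⟨hF1.fun_add hG1, ?_, L + L', by positivity, fun x y => ?_⟩
  · rw [e]; exact hF2.add hG2
  · rw [e]
    calc ‖gradient F x + gradient G x - (gradient F y + gradient G y)‖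
        = ‖(gradient F x - gradient F y) + (gradient G x - gradient G y)‖ := by congr 1; abel
      _ ≤ _ := norm_add_le _ _
      _ ≤ L * ‖x - y‖ + L' * ‖x - y‖ := add_le_add (hF3 x y) (hG3 x y)
      _ = _ := by ring

theorem SmoothLip.sum {ι : Type*} (s : Finset ι) {F : ι → E → ℝ} (hF : ∀ j, SmoothLip (F j)) :
    SmoothLip (fun x => ∑ j ∈ s, F j x) := by
  classical
  induction s using Finset.induction_on with
  | empty =>
    have e : gradient (fun _ : E => (0 : ℝ)) = fun _ => 0 := by
      funext x; simp [gradient]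
    simp only [Finset.sum_empty]
    refine ⟨differentiable_const _, ?_, 0, le_rfl, fun x y => ?_⟩
    · rw [e]; exact contDiff_const
    · simp [e]
  | insert a s ha ih =>
    simp only [Finset.sum_insert ha]
    exact (hF a).add ih

/-- Quadratic lower bound from a Lipschitz gradient. -/
theorem sub_le_of_gradient_lipschitz {F : E → ℝ} {L : ℝ} (hL : 0 ≤ L) (hF : Differentiable ℝ F)
    (h : ∀ x y, ‖gradient F x - gradient F y‖ ≤ L * ‖x - y‖) (x y : E) :
    F x - F y ≤ inner ℝ (gradient F x) (x - y) + L * ‖x - y‖ ^ 2 := by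
  -- Mean value inequality for `F` minus its linearization on the ball around `x` through `y`; the
  -- constant `L` instead of `L / 2` suffices.
  have key : ‖F y - F x - (fderiv ℝ F x) (y - x)‖ ≤ (L * ‖x - y‖) * ‖y - x‖ := by
    refine (convex_closedBall x ‖x - y‖).norm_image_sub_le_of_norm_fderiv_le' (𝕜 := ℝ)
      (fun z _ => hF z) (fun z hz => ?_) (by simp) (by simp [dist_eq_norm, norm_sub_rev])
    have e : fderiv ℝ F z - fderiv ℝ F x =
        InnerProductSpace.toDual ℝ E (gradient F z - gradient F x) := by
      simp [gradient]
    rw [e, LinearIsometryEquiv.norm_map]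
    refine (h z x).trans (mul_le_mul_of_nonneg_left ?_ hL)
    rw [← dist_eq_norm]; exact hz
  rw [← inner_gradient_eq_fderiv, norm_sub_rev y x] at key
  have h1 := neg_le_of_abs_le key
  have h2 : inner ℝ (gradient F x) (y - x) = - inner ℝ (gradient F x) (x - y) := by
    rw [← inner_neg_right, neg_sub]
  rw [h2] at h1
  nlinarith

end Gradient

theorem TwiceDiffLip.smoothLip {n : ℕ} {F : Config n → ℝ} {L : ℝ} (h : TwiceDiffLip F)
    (hc : CurvatureBounded L F) : SmoothLip F := by
  refine ⟨h.1, ?_, max L 0, le_max_right _ _, fun x y => (hc.2 x y).trans ?_⟩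
  · exact contDiff_one_iff_fderiv.2 ⟨h.2.1, h.2.2.continuous⟩
  · exact mul_le_mul_of_nonneg_right (le_max_left _ _) (norm_nonneg _)

/-! ### Chain rule for penalties of locally Lipschitz constraints -/

/-- Near `x`, `h` is the local inverse of `φ` applied to `φ ∘ h`; continuity of `h` keeps its values
where the inverse is valid. -/
theorem differentiableAt_of_comp_of_deriv_ne_zero {E : Type*}
    [NormedAddCommGroup E] [NormedSpace ℝ E] {φ : ℝ → ℝ} {h : E → ℝ} {x : E}
    (hφ : ContDiff ℝ 1 φ) (hh : ContinuousAt h x)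
    (hc : DifferentiableAt ℝ (fun y => φ (h y)) x) (hne : deriv φ (h x) ≠ 0) :
    DifferentiableAt ℝ h x := by
  have hs : HasStrictDerivAt φ (deriv φ (h x)) (h x) :=
    hφ.contDiffAt.hasStrictDerivAt one_ne_zero
  have hinv := hs.eventually_left_inverse hne
  have hd := (hs.to_localInverse hne).hasDerivAt.differentiableAt
  have := DifferentiableAt.comp x (f := fun y => φ (h y)) hd hc
  refine this.congr_of_eventuallyEq ?_
  filter_upwards [hh.eventually hinv] with y hy
  exact hy.symm

section Penalty

variable {E : Type*} [NormedAddCommGroup E] [InnerProductSpace ℝ E] [CompleteSpace E]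

/-- The chain rule survives where `h` is not differentiable. If `φ'` vanishes at `h x`, the
Lipschitz bound turns `o(|h y - h x|)` into `o(‖y - x‖)`, so the left side is zero, and the default
value of `gradient h x` is multiplied by zero. Otherwise `h` is differentiable by the preceding
lemma. -/
theorem gradient_penalty {φ : ℝ → ℝ} {h : E → ℝ} {x : E}
    (hφ : ContDiff ℝ 1 φ) (hh : LocallyLipschitz h)
    (hc : DifferentiableAt ℝ (fun y => φ (h y)) x) :
    gradient (fun y => φ (h y)) x = deriv φ (h x) • gradient h x := by
  have hφd : HasDerivAt φ (deriv φ (h x)) (h x) :=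
    (hφ.differentiable one_ne_zero _).hasDerivAt
  by_cases hne : deriv φ (h x) = 0
  · rw [hne, zero_smul]
    have hO : (fun y => h y - h x) =O[𝓝 x] fun y => y - x := by
      obtain ⟨K, t, ht, hK⟩ := hh x
      refine Asymptotics.IsBigO.of_bound K ?_
      filter_upwards [ht] with y hy
      have := hK.dist_le_mul y hy x (mem_of_mem_nhds ht)
      rwa [dist_eq_norm, dist_eq_norm] at this
    have ho : (fun z => φ z - φ (h x)) =o[𝓝 (h x)] fun z => z - h x := by
      have := hasDerivAt_iff_isLittleO.1 hφd
      simpa [hne] using this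
    have h1 := (ho.comp_tendsto hh.continuous.continuousAt).trans_isBigO hO
    have h2 : HasFDerivAt (fun y => φ (h y)) (0 : E →L[ℝ] ℝ) x := by
      rw [hasFDerivAt_iff_isLittleO]
      simpa [Function.comp_def] using h1
    simp [gradient, h2.fderiv]
  · have hd := differentiableAt_of_comp_of_deriv_ne_zero hφ hh.continuous.continuousAt hc hne
    have := (hφd.comp_hasFDerivAt x hd.hasFDerivAt).fderiv
    simp only [Function.comp_def] at this
    simp [gradient, this]

end Penalty

/-! ### Smallest singular value -/

/-- Positive dimension matters: in dimension zero the sphere is empty and `sInf` returns `0`. -/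
theorem le_sigmaMin {n : ℕ} (hn : 0 < n) {A : Config n →L[ℝ] Config n} {c : ℝ}
    (h : ∀ v, c * ‖v‖ ^ 2 ≤ inner ℝ v (A v)) : c ≤ sigmaMin A := by
  have : Nonempty (Fin n) := ⟨⟨0, hn⟩⟩
  refine le_csInf ?_ ?_
  · exact (NormedSpace.sphere_nonempty.2 zero_le_one).image _
  · rintro _ ⟨v, hv, rfl⟩
    have hv1 : ‖v‖ = 1 := by simpa using hv
    have h1 := h v
    have h2 := real_inner_le_norm v (A v)
    simp only [hv1] at h1 h2
    simp only
    linarith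

theorem sigmaMin_mul_norm_le {n : ℕ} (A : Config n →L[ℝ] Config n) (v : Config n) :
    sigmaMin A * ‖v‖ ≤ ‖A v‖ := by
  by_cases hv : v = 0
  · simp [hv]
  have hpos : 0 < ‖v‖ := norm_pos_iff.2 hv
  have : sigmaMin A ≤ ‖A ((‖v‖)⁻¹ • v)‖ := by
    refine csInf_le ⟨0, ?_⟩ ⟨(‖v‖)⁻¹ • v, ?_, rfl⟩
    · rintro _ ⟨w, _, rfl⟩; exact norm_nonneg _
    · simp [norm_smul, hpos.ne']
  rw [map_smul, norm_smul, norm_inv, norm_norm] at this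
  calc sigmaMin A * ‖v‖ ≤ (‖v‖⁻¹ * ‖A v‖) * ‖v‖ := by gcongr
    _ = ‖A v‖ := by field_simp

/-- The infimum of the Rayleigh quotient is an eigenvalue `lam ≥ 0`. Its eigenvector is stretched
exactly by `lam`, so `sigmaMin A ≤ lam`. -/
theorem sigmaMin_mul_sq_le_inner {n : ℕ} (hn : 0 < n) {A : Config n →L[ℝ] Config n}
    (hA : (A : Config n →ₗ[ℝ] Config n).IsSymmetric) (hpos : ∀ v, 0 ≤ inner ℝ v (A v))
    (v : Config n) : sigmaMin A * ‖v‖ ^ 2 ≤ inner ℝ v (A v) := by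
  have : Nonempty (Fin n) := ⟨⟨0, hn⟩⟩
  by_cases hv : v = 0
  · simp [hv]
  have hvpos : 0 < ‖v‖ := norm_pos_iff.2 hv
  have he := hA.hasEigenvalue_iInf_of_finiteDimensional
  set lam : ℝ := ⨅ x : {x : Config n // x ≠ 0},
    RCLike.re (inner ℝ ((A : Config n →ₗ[ℝ] Config n) ↑x) ↑x) / ‖(x : Config n)‖ ^ 2 with hlam
  have hbd : BddBelow (Set.range fun x : {x : Config n // x ≠ 0} =>
      RCLike.re (inner ℝ ((A : Config n →ₗ[ℝ] Config n) ↑x) ↑x) / ‖(x : Config n)‖ ^ 2) := by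
    refine ⟨0, ?_⟩
    rintro _ ⟨x, rfl⟩
    have := hpos x
    rw [real_inner_comm] at this
    simp only [ContinuousLinearMap.coe_coe, RCLike.re_to_real]
    positivity
  have hle : lam ≤ inner ℝ (A v) v / ‖v‖ ^ 2 := ciInf_le hbd ⟨v, hv⟩
  obtain ⟨w, hw⟩ := he.exists_hasEigenvector
  have hw0 : w ≠ 0 := hw.2
  have hwpos : 0 < ‖w‖ := norm_pos_iff.2 hw0
  have hAw : A w = lam • w := hw.apply_eq_smul
  have hlam0 : 0 ≤ lam := Real.iInf_nonneg fun x => by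
    have := hpos x
    rw [real_inner_comm] at this
    simp only [ContinuousLinearMap.coe_coe, RCLike.re_to_real]
    positivity
  have hs : sigmaMin A ≤ lam := by
    have := sigmaMin_mul_norm_le A w
    rw [hAw, norm_smul, Real.norm_of_nonneg hlam0] at this
    exact le_of_mul_le_mul_right this hwpos
  rw [real_inner_comm]
  have := hs.trans hle
  rwa [le_div_iff₀ (by positivity)] at this

/-! ### Bounded approximate Hessians -/

/-- Expanding the nonnegative form at `v - L⁻¹ H v` and bounding the forms at `v` and `H v` from
above gives `L⁻¹ ‖H v‖² ≤ L ‖v‖²`, without spectral theory. -/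
theorem HessianBound.norm_apply_le {E : Type*} [NormedAddCommGroup E] [InnerProductSpace ℝ E]
    {L : ℝ} {H : E →L[ℝ] E} (hL : 0 < L) (h : HessianBound L H) (v : E) : ‖H v‖ ≤ L * ‖v‖ := by
  have hsym : ∀ x y, inner ℝ (H x) y = inner ℝ x (H y) := h.1
  have h1 := (h.2 (v - L⁻¹ • H v)).1
  have h2 := (h.2 v).2
  have h3 := (h.2 (H v)).2
  have h0 : 0 ≤ 1 / L * ‖v - L⁻¹ • H v‖ ^ 2 := by positivity
  have e : inner ℝ (v - L⁻¹ • H v) (H (v - L⁻¹ • H v)) =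
      inner ℝ v (H v) - 2 * L⁻¹ * ‖H v‖ ^ 2 + L⁻¹ ^ 2 * inner ℝ (H v) (H (H v)) := by
    simp only [map_sub, map_smul, inner_sub_left, inner_sub_right, real_inner_smul_left,
      real_inner_smul_right]
    rw [← hsym v (H v), real_inner_self_eq_norm_sq]
    ring
  rw [e] at h1
  have hLi : L⁻¹ * L = 1 := inv_mul_cancel₀ hL.ne'
  have h4 : L⁻¹ ^ 2 * inner ℝ (H v) (H (H v)) ≤ L⁻¹ * ‖H v‖ ^ 2 := by
    calc L⁻¹ ^ 2 * inner ℝ (H v) (H (H v)) ≤ L⁻¹ ^ 2 * (L * ‖H v‖ ^ 2) := by gcongr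
      _ = (L⁻¹ * L) * (L⁻¹ * ‖H v‖ ^ 2) := by ring
      _ = _ := by rw [hLi, one_mul]
  have h5 : L⁻¹ * ‖H v‖ ^ 2 ≤ L * ‖v‖ ^ 2 := by linarith
  have h6 : ‖H v‖ ^ 2 ≤ (L * ‖v‖) ^ 2 := by
    calc ‖H v‖ ^ 2 = L * (L⁻¹ * ‖H v‖ ^ 2) := by field_simp
      _ ≤ L * (L * ‖v‖ ^ 2) := by gcongr
      _ = _ := by ring
  exact le_of_sq_le_sq h6 (by positivity)

/-- An admissible Hessian exists, so the solver is never stuck at that choice; this is where `L5 ≥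
1` is needed. -/
theorem hessianBound_id {E : Type*} [NormedAddCommGroup E] [InnerProductSpace ℝ E]
    {L : ℝ} (hL : 1 ≤ L) : HessianBound L (ContinuousLinearMap.id ℝ E) := by
  refine ⟨fun x y => rfl, fun v => ?_⟩
  simp only [ContinuousLinearMap.id_apply, real_inner_self_eq_norm_sq]
  constructor
  · have : 1 / L ≤ 1 := by rw [div_le_one (by linarith)]; exact hL
    nlinarith [sq_nonneg ‖v‖]
  · nlinarith [sq_nonneg ‖v‖]

/-! ### Descent sequences and line searches -/

/-- The decrease makes `t` summable, and the increments are dominated by `C t`, so the iterates form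
a Cauchy sequence. -/
theorem tendsto_of_descent {E : Type*} [NormedAddCommGroup E] [CompleteSpace E] {x : ℕ → E}
    {V t : ℕ → ℝ} {m C v₀ : ℝ} (hm : 0 < m) (ht : ∀ k, 0 ≤ t k) (hV : ∀ k, v₀ ≤ V k)
    (hdec : ∀ k, V (k + 1) ≤ V k - m * t k) (hx : ∀ k, ‖x (k + 1) - x k‖ ≤ C * t k) :
    Tendsto t atTop (𝓝 0) ∧ ∃ x', Tendsto x atTop (𝓝 x') := by
  have hsum : Summable t := by
    refine summable_of_sum_range_le (c := (V 0 - v₀) / m) ht fun k => ?_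
    rw [le_div_iff₀ hm]
    have : ∀ k, (∑ i ∈ Finset.range k, t i) * m ≤ V 0 - V k := by
      intro k
      induction k with
      | zero => simp
      | succ k ih =>
        rw [Finset.sum_range_succ]
        have := hdec k
        linarith
    linarith [this k, hV k]
  refine ⟨hsum.tendsto_atTop_zero, ?_⟩
  refine cauchySeq_tendsto_of_complete (cauchySeq_of_summable_dist ?_)
  refine Summable.of_nonneg_of_le (fun k => dist_nonneg) (fun k => ?_) (hsum.mul_left C)
  rw [dist_comm, dist_eq_norm]
  exact hx k

/-- First-order expansion along bounded directions, uniform near a limit point. -/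
theorem eventually_norm_expansion_le {E F : Type*} [NormedAddCommGroup E] [NormedSpace ℝ E]
    [NormedAddCommGroup F] [NormedSpace ℝ F] {f : E → F} (hf : ContDiff ℝ 1 f)
    {x d : ℕ → E} {s : ℕ → ℝ} {x' : E} {C : ℝ} (hx : Tendsto x atTop (𝓝 x'))
    (hd : ∀ k, ‖d k‖ ≤ C) (hs : Tendsto s atTop (𝓝 0)) (hs0 : ∀ k, 0 ≤ s k) {e : ℝ} (he : 0 < e) :
    ∀ᶠ k in atTop, ‖f (x k + s k • d k) - f (x k) - s k • fderiv ℝ f (x k) (d k)‖ ≤ e * s k := by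
  have hC : 0 ≤ C := (norm_nonneg _).trans (hd 0)
  -- Strict differentiability at the limit allows both end points of the increment to vary with `k`.
  have hstrict : HasStrictFDerivAt f (fderiv ℝ f x') x' :=
    hf.contDiffAt.hasStrictFDerivAt one_ne_zero
  have hy : Tendsto (fun k => x k + s k • d k) atTop (𝓝 x') := by
    have : Tendsto (fun k => s k • d k) atTop (𝓝 0) := by
      refine squeeze_zero_norm (a := fun k => s k * C) (fun k => ?_) (by simpa using hs.mul_const C)
      rw [norm_smul, Real.norm_of_nonneg (hs0 k)]
      exact mul_le_mul_of_nonneg_left (hd k) (hs0 k)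
    simpa using hx.add this
  -- Half of the error is spent on the strict derivative at `x'`, half on replacing it by the
  -- derivative at `x k`; `C + 1` guards against `C = 0`.
  have he' : 0 < e / (2 * (C + 1)) := by positivity
  have h1 := hstrict.isLittleO.bound he'
  have h2 := (hy.prodMk_nhds hx).eventually h1
  have hcont : Tendsto (fun k => fderiv ℝ f (x k)) atTop (𝓝 (fderiv ℝ f x')) :=
    ((hf.continuous_fderiv one_ne_zero).tendsto x').comp hx
  have h3 := hcont.eventually (Metric.ball_mem_nhds _ he')
  filter_upwards [h2, h3] with k hk2 hk3
  rw [dist_comm, dist_eq_norm] at hk3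
  simp only [add_sub_cancel_left, map_smul] at hk2
  have hkd : ‖s k • d k‖ ≤ s k * C := by
    rw [norm_smul, Real.norm_of_nonneg (hs0 k)]
    exact mul_le_mul_of_nonneg_left (hd k) (hs0 k)
  have e1 : f (x k + s k • d k) - f (x k) - s k • fderiv ℝ f (x k) (d k) =
      (f (x k + s k • d k) - f (x k) - s k • fderiv ℝ f x' (d k)) +
        (fderiv ℝ f x' - fderiv ℝ f (x k)) (s k • d k) := by
    simp only [sub_apply, map_smul, smul_sub]; abel
  rw [e1]
  calc _ ≤ _ := norm_add_le _ _
    _ ≤ e / (2 * (C + 1)) * (s k * C) + e / (2 * (C + 1)) * (s k * C) := by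
        refine add_le_add (hk2.trans (by gcongr)) ?_
        exact (ContinuousLinearMap.le_opNorm _ _).trans (by gcongr)
    _ = e * s k * (C / (C + 1)) := by field_simp; ring
    _ ≤ e * s k * 1 := by
        have := hs0 k
        have : C / (C + 1) ≤ 1 := by rw [div_le_one (by linarith)]; linarith
        gcongr
    _ = e * s k := by ring

/-! ### Infinite runs and accessibility -/

/-- Termination is treated as accessibility for the reversed relation, which supports nested
induction; this lemma and the next translate from and to runs. -/
theorem not_exists_run_of_acc {α : Type*} {r : α → α → Prop} {a : α}
    (h : Acc (fun x y => r y x) a) :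
    ¬ ∃ run : ℕ → α, run 0 = a ∧ ∀ k, r (run k) (run (k + 1)) := by
  intro hr
  exact not_acc_iff_exists_descending_chain.2 hr h

theorem acc_of_not_exists_run {α : Type*} {r : α → α → Prop} {a : α}
    (h : ¬ ∃ run : ℕ → α, run 0 = a ∧ ∀ k, r (run k) (run (k + 1))) :
    Acc (fun x y => r y x) a := by
  by_contra hc
  exact h (not_acc_iff_exists_descending_chain.1 hc)

/-! ### Time grids -/

/-- All time indices lie in `(0, N]`. -/
def IsGrid (N : ℕ) (D : Finset ℚ) : Prop := ∀ i ∈ D, 0 < i ∧ i ≤ N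

theorem pred_spec (D : Finset ℚ) {i : ℚ} (hi : -1 < i) :
    pred D i ∈ insert (-1) (insert 0 D) ∧ pred D i < i ∧
      ∀ j ∈ insert (-1) (insert 0 D), j < i → j ≤ pred D i := by
  set s := (insert (-1) (insert 0 D)).filter (· < i) with hs
  -- The index `-1` makes the filtered set nonempty, so the default `i - 1` in `pred` is never used.
  have hmem : (-1 : ℚ) ∈ s := by simp [hs, hi]
  obtain ⟨a, ha⟩ := Finset.max_of_mem hmem
  have hp : pred D i = a := by
    unfold pred; rw [← hs, ha]; rfl
  have has := Finset.mem_of_max ha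
  rw [hp]
  refine ⟨(Finset.mem_filter.1 has).1, (Finset.mem_filter.1 has).2, fun j hj hji => ?_⟩
  exact Finset.le_max_of_eq (Finset.mem_filter.2 ⟨hj, hji⟩) ha

theorem pred_lt (D : Finset ℚ) {i : ℚ} (hi : -1 < i) : pred D i < i := (pred_spec D hi).2.1

theorem le_pred {D : Finset ℚ} {i j : ℚ} (hi : -1 < i) (hj : j ∈ insert 0 D) (hji : j < i) :
    j ≤ pred D i :=
  (pred_spec D hi).2.2 j (Finset.mem_insert_of_mem hj) hji

theorem pred_mem {D : Finset ℚ} {i : ℚ} (hi : 0 < i) : pred D i ∈ insert 0 D := by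
  obtain ⟨h1, _, h3⟩ := pred_spec D (by linarith : -1 < i)
  rcases Finset.mem_insert.1 h1 with h | h
  · have := h3 0 (by simp) hi
    rw [h] at this; norm_num at this
  · exact h

theorem pred_nonneg {D : Finset ℚ} {i : ℚ} (hi : 0 < i) : 0 ≤ pred D i :=
  le_pred (by linarith) (Finset.mem_insert_self _ _) hi

theorem IsGrid.pred_zero {N : ℕ} {D : Finset ℚ} (hD : IsGrid N D) : pred D 0 = -1 := by
  obtain ⟨h1, h2, _⟩ := pred_spec D (by norm_num : (-1 : ℚ) < 0)
  rcases Finset.mem_insert.1 h1 with h | h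
  · exact h
  · rcases Finset.mem_insert.1 h with h | h
    · rw [h] at h2; exact absurd h2 (lt_irrefl _)
    · exact absurd (hD _ h).1 (by linarith)

/-- Induction forward in time: `<` is well founded on a finite set of rationals. -/
theorem grid_induction {D : Finset ℚ} {p : ℚ → Prop} (h0 : p 0)
    (hs : ∀ i ∈ D, (∀ j ∈ insert 0 D, j < i → p j) → p i) : ∀ i ∈ insert 0 D, p i := by
  have key : ∀ i : (insert 0 D : Finset ℚ), p i := by
    intro i
    induction i using WellFoundedLT.induction with
    | ind i ih =>
      rcases Finset.mem_insert.1 i.2 with h | h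
      · rw [h]; exact h0
      · exact hs _ h fun j hj hji => ih ⟨j, hj⟩ hji
  exact fun i hi => key ⟨i, hi⟩

/-- The selection of the configuration at `i`, zero if `i` is not a decision variable. -/
def frameL (n : ℕ) (D : Finset ℚ) (i : ℚ) : Traj n D →L[ℝ] Config n :=
  if h : i ∈ D then PiLp.proj 2 (fun _ : D => Config n) ⟨i, h⟩ else 0

theorem frameL_of_mem {n : ℕ} {D : Finset ℚ} {i : ℚ} (h : i ∈ D) (v : Traj n D) :
    frameL n D i v = v ⟨i, h⟩ := by
  simp [frameL, h]

theorem frameL_coe {n : ℕ} {D : Finset ℚ} (i : D) (v : Traj n D) : frameL n D i v = v i :=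
  frameL_of_mem i.2 v

theorem frameL_of_notMem {n : ℕ} {D : Finset ℚ} {i : ℚ} (h : i ∉ D) (v : Traj n D) :
    frameL n D i v = 0 := by
  simp [frameL, h]

/-- The selection of the control signal used at `i`. -/
def ctrlL (m N : ℕ) (i : ℚ) : Controls m N →L[ℝ] Control m :=
  if h : ⌈i⌉₊ - 1 < N then PiLp.proj 2 (fun _ : Fin N => Control m) ⟨⌈i⌉₊ - 1, h⟩ else 0

theorem ctrl_eq_ctrlL {m N : ℕ} (u : Controls m N) (i : ℚ) : ctrl u i = ctrlL m N i u := by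
  unfold ctrl ctrlL; split_ifs <;> simp

theorem norm_ctrlL_le {m N : ℕ} (u : Controls m N) (i : ℚ) : ‖ctrlL m N i u‖ ≤ ‖u‖ := by
  rw [← ctrl_eq_ctrlL]
  unfold ctrl
  split_ifs
  · exact PiLp.norm_apply_le u _
  · simp

theorem IsGrid.ctrl_mem {m N : ℕ} {D : Finset ℚ} (hD : IsGrid N D) {X : Set (Control m)}
    {u : Controls m N} (hu : ∀ i, u i ∈ X) {i : ℚ} (hi : i ∈ D) : ctrl u i ∈ X := by
  obtain ⟨h0, hN⟩ := hD i hi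
  have h1 : 0 < ⌈i⌉₊ := Nat.ceil_pos.2 h0
  have h2 : ⌈i⌉₊ ≤ N := Nat.ceil_le.2 hN
  have : ⌈i⌉₊ - 1 < N := by omega
  simp only [ctrl, this, dite_true]
  exact hu _

theorem l1norm_nonneg {n : ℕ} {D : Finset ℚ} (x : Traj n D) : 0 ≤ l1norm x := by
  unfold l1norm; positivity

theorem l1norm_add_le {n : ℕ} {D : Finset ℚ} (x y : Traj n D) :
    l1norm (x + y) ≤ l1norm x + l1norm y := by
  unfold l1norm
  simp_rw [← Finset.sum_add_distrib]
  gcongr with i _ a _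
  exact abs_add_le _ _

theorem l1norm_smul {n : ℕ} {D : Finset ℚ} (r : ℝ) (x : Traj n D) :
    l1norm (r • x) = |r| * l1norm x := by
  unfold l1norm
  simp [Finset.mul_sum, abs_mul]

theorem l1norm_le_mul_norm {n : ℕ} {D : Finset ℚ} (x : Traj n D) :
    l1norm x ≤ (D.card * n : ℕ) * ‖x‖ := by
  unfold l1norm
  calc ∑ i : D, ∑ a : Fin n, |x i a| ≤ ∑ i : D, ∑ a : Fin n, ‖x‖ := by
        gcongr with i _ a _
        exact (PiLp.norm_apply_le (x i) a).trans (PiLp.norm_apply_le x i)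
    _ = _ := by simp [mul_assoc]

theorem norm_le_sum_norm {ι : Type*} [Fintype ι] {E : ι → Type*} [∀ i, NormedAddCommGroup (E i)]
    (x : PiLp 2 E) : ‖x‖ ≤ ∑ i, ‖x i‖ := by
  rw [PiLp.norm_eq_of_L2]
  refine Real.sqrt_le_iff.2 ⟨by positivity, ?_⟩
  exact Finset.sum_sq_le_sq_sum_of_nonneg (s := Finset.univ) (f := fun a => ‖x a‖) (by simp)

theorem norm_le_card_mul {ι : Type*} [Fintype ι] {E : ι → Type*} [∀ i, NormedAddCommGroup (E i)]
    (x : PiLp 2 E) {r : ℝ} (h : ∀ i, ‖x i‖ ≤ r) : ‖x‖ ≤ Fintype.card ι * r := by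
  refine (norm_le_sum_norm x).trans ((Finset.sum_le_sum fun i _ => h i).trans ?_)
  simp

theorem sum_norm_le_l1norm {n : ℕ} {D : Finset ℚ} (x : Traj n D) : ∑ i, ‖x i‖ ≤ l1norm x :=
  Finset.sum_le_sum fun i _ => norm_le_sum_norm (x i)

theorem norm_le_l1norm {n : ℕ} {D : Finset ℚ} (x : Traj n D) : ‖x‖ ≤ l1norm x :=
  (norm_le_sum_norm x).trans (sum_norm_le_l1norm x)

theorem norm_apply_le_l1norm {n : ℕ} {D : Finset ℚ} (x : Traj n D) (i : D) : ‖x i‖ ≤ l1norm x :=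
  (PiLp.norm_apply_le x i).trans (norm_le_l1norm x)

/-! ### Derivatives of structured maps -/

section Structured

variable {E F G : Type*} [NormedAddCommGroup E] [NormedSpace ℝ E] [NormedAddCommGroup F]
  [NormedSpace ℝ F] [NormedAddCommGroup G] [NormedSpace ℝ G]

theorem hasFDerivAt_partial_left {f : E → F → G} {x : E} {y : F}
    (hf : DifferentiableAt ℝ (fun z : E × F => f z.1 z.2) (x, y)) :
    HasFDerivAt (fun x' => f x' y)
      ((fderiv ℝ (fun z : E × F => f z.1 z.2) (x, y)) ∘L ContinuousLinearMap.inl ℝ E F) x :=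
  HasFDerivAt.comp (f := fun e : E => (e, y)) x hf.hasFDerivAt
    (hasFDerivAt_prodMk_left (𝕜 := ℝ) x y)

theorem hasFDerivAt_partial_right {f : E → F → G} {x : E} {y : F}
    (hf : DifferentiableAt ℝ (fun z : E × F => f z.1 z.2) (x, y)) :
    HasFDerivAt (fun y' => f x y')
      ((fderiv ℝ (fun z : E × F => f z.1 z.2) (x, y)) ∘L ContinuousLinearMap.inr ℝ E F) y :=
  HasFDerivAt.comp (f := fun e : F => (x, e)) y hf.hasFDerivAt
    (hasFDerivAt_prodMk_right (𝕜 := ℝ) x y)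

theorem fderiv_eq_partial_add {f : E → F → G} {x : E} {y : F}
    (hf : DifferentiableAt ℝ (fun z : E × F => f z.1 z.2) (x, y)) (v : E) (w : F) :
    fderiv ℝ (fun z : E × F => f z.1 z.2) (x, y) (v, w) =
      fderiv ℝ (fun x' => f x' y) x v + fderiv ℝ (fun y' => f x y') y w := by
  rw [(hasFDerivAt_partial_left hf).fderiv, (hasFDerivAt_partial_right hf).fderiv]
  simp only [ContinuousLinearMap.coe_comp, Function.comp_apply, ContinuousLinearMap.inl_apply,
    ContinuousLinearMap.inr_apply, ← map_add]
  simp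

theorem contDiff_partial_left {f : E → F → G} (hf : ContDiff ℝ 1 fun z : E × F => f z.1 z.2)
    (y : F) : ContDiff ℝ 1 fun x => f x y :=
  hf.comp (contDiff_id.prodMk contDiff_const)

/-- Reads off one block row of a Jacobian when that row is affine plus a nonlinear function of a
single block, by uniqueness of the derivative. -/
theorem apply_fderiv_of_affine_add_comp {c : E → G} {x : E} (hc : DifferentiableAt ℝ c x)
    (Q : G →L[ℝ] F) (I : E →L[ℝ] F) (k : F) {H : Type*} [NormedAddCommGroup H] [NormedSpace ℝ H]
    (P : E →L[ℝ] H) {Φ : H → F} (hΦ : DifferentiableAt ℝ Φ (P x))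
    (h : ∀ x', Q (c x') = I x' + k + Φ (P x')) (v : E) :
    Q (fderiv ℝ c x v) = I v + fderiv ℝ Φ (P x) (P v) := by
  have h1 : HasFDerivAt (fun x' => Q (c x')) (Q ∘L fderiv ℝ c x) x :=
    HasFDerivAt.comp (g := Q) x Q.hasFDerivAt hc.hasFDerivAt
  have h2 : HasFDerivAt (fun x' => I x' + k + Φ (P x')) (I + fderiv ℝ Φ (P x) ∘L P) x :=
    (I.hasFDerivAt.add_const k).fun_add (HasFDerivAt.comp x hΦ.hasFDerivAt P.hasFDerivAt)
  simp only [h] at h1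
  exact congrArg (fun f => f v) (h1.unique h2)

end Structured

/-! ### The residual and its Jacobians. -/

namespace TOProblem

variable {n m nE nI nR : ℕ} {S : TOProblem n m nE nI nR}

/-- The standing hypotheses, for a fixed relaxation parameter. -/
structure Standing (S : TOProblem n m nE nI nR) (L2 : ℝ) : Prop where
  dim : 0 < n
  posDef : S.M.PosDef
  step : 0 < S.δ
  cost : S.CostAssumption
  relax : S.RelaxationAssumption
  control : S.ControlBoundAssumption
  pos : 0 < L2

namespace Standing

variable {L2 : ℝ} (hS : Standing S L2)

include hS

theorem mass_symm (v w : Config n) : inner ℝ (S.mass v) w = inner ℝ v (S.mass w) := by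
  have h : IsSelfAdjoint S.mass := by
    have : IsSelfAdjoint S.M := hS.posDef.1
    exact this.map (Matrix.toEuclideanCLM (𝕜 := ℝ) (n := Fin n))
  exact (ContinuousLinearMap.isSelfAdjoint_iff_isSymmetric.1 h) v w

theorem normMSq_pos {v : Config n} (hv : v ≠ 0) : 0 < S.normMSq v := by
  unfold normMSq mass
  rw [Matrix.inner_toEuclideanCLM]
  have : v.ofLp ≠ 0 := fun h => hv (by ext i; simp [h])
  simpa using hS.posDef.dotProduct_mulVec_pos this

theorem normMSq_nonneg (v : Config n) : 0 ≤ S.normMSq v := by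
  by_cases hv : v = 0
  · simp [normMSq, hv]
  · exact (hS.normMSq_pos hv).le

theorem sigma_mul_sq_le (v : Config n) : sigmaMin S.mass * ‖v‖ ^ 2 ≤ S.normMSq v :=
  sigmaMin_mul_sq_le_inner hS.dim (fun v w => hS.mass_symm v w) hS.normMSq_nonneg v

theorem sigma_pos : 0 < sigmaMin S.mass := by
  have : Nonempty (Fin n) := ⟨⟨0, hS.dim⟩⟩
  have hne : (Metric.sphere (0 : Config n) 1).Nonempty :=
    NormedSpace.sphere_nonempty.2 zero_le_one
  obtain ⟨v, hv, hmin⟩ := (isCompact_sphere (0 : Config n) 1).exists_isMinOn hne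
    (f := fun v => ‖S.mass v‖) (by fun_prop)
  have hv1 : ‖v‖ = 1 := by simpa using hv
  have hv0 : v ≠ 0 := by rintro rfl; simp at hv1
  have h1 : 0 < ‖S.mass v‖ := by
    have h := hS.normMSq_pos hv0
    have := real_inner_le_norm v (S.mass v)
    rw [hv1, one_mul] at this
    exact h.trans_le this
  refine h1.trans_le (le_csInf (hne.image _) ?_)
  rintro _ ⟨w, hw, rfl⟩
  exact hmin hw

theorem smoothLip_Pg : SmoothLip (S.Pg L2) := by
  obtain ⟨⟨⟨q, hq⟩, ht, -, -⟩, ⟨-, he⟩, ⟨-, hi⟩⟩ := hS.relax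
  unfold Pg
  refine SmoothLip.add (SmoothLip.add ((ht L2 hS.pos).smoothLip (hq L2 hS.pos)) ?_) ?_
  · refine SmoothLip.sum _ fun j => ?_
    obtain ⟨⟨q, hq⟩, h⟩ := he j
    exact (h L2 hS.pos).1.smoothLip (hq L2 hS.pos)
  · refine SmoothLip.sum _ fun j => ?_
    obtain ⟨⟨q, hq⟩, h⟩ := hi j
    exact (h L2 hS.pos).1.smoothLip (hq L2 hS.pos)

theorem contDiff_bgrad : ContDiff ℝ 1 S.bgrad :=
  contDiff_one_iff_fderiv.2 ⟨hS.control.2.2.1, hS.control.2.2.2.1.continuous⟩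

theorem hasGradientAt_normMSq (v : Config n) :
    HasGradientAt S.normMSq ((2 : ℝ) • S.mass v) v := by
  rw [hasGradientAt_iff_hasFDerivAt]
  have h := (hasFDerivAt_id v).inner ℝ S.mass.hasFDerivAt
  refine h.congr_fderiv ?_
  ext w
  simp only [id_eq, ContinuousLinearMap.coe_comp, Function.comp_apply,
    ContinuousLinearMap.prod_apply, ContinuousLinearMap.id_apply, fderivInnerCLM_apply,
    InnerProductSpace.toDual_apply_apply, inner_smul_left]
  rw [← hS.mass_symm v w, real_inner_comm (S.mass v) w]
  simp; ring

theorem gradient_Ebar (d d' : ℝ) (t t' t'' : Config n) (w : Control m) :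
    gradient (fun t => S.Ebar L2 d d' t t' t'' w) t =
      (1 / d ^ 2) • S.mass (t - (1 + d / d') • t' + (d / d') • t'') +
        gradient (S.Pg L2) t - S.g + S.bgrad (t, w) := by
  have h1 : HasFDerivAt (fun t : Config n => t - (1 + d / d') • t' + (d / d') • t'')
      (ContinuousLinearMap.id ℝ (Config n)) t :=
    ((hasFDerivAt_id t).sub_const _).add_const _
  have h2 := (hasGradientAt_iff_hasFDerivAt.1
    (hS.hasGradientAt_normMSq (t - (1 + d / d') • t' + (d / d') • t''))).comp t h1
  have h3 := h2.const_mul (1 / (2 * d ^ 2))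
  have h4 := hasGradientAt_iff_hasFDerivAt.1 (hS.smoothLip_Pg.1 t).hasGradientAt
  have h5 : HasFDerivAt (fun t => inner ℝ S.g t) (InnerProductSpace.toDual ℝ _ S.g) t :=
    (InnerProductSpace.toDual ℝ (Config n) S.g).hasFDerivAt
  have h6 := hasGradientAt_iff_hasFDerivAt.1 (hS.control.2.1 w t).hasGradientAt
  have h7 := h3.add ((h4.sub h5).add h6)
  refine HasGradientAt.gradient ?_
  rw [hasGradientAt_iff_hasFDerivAt]
  refine HasFDerivAt.congr_fderiv (f' := _) h7 ?_
  ext v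
  simp only [bgrad, map_add, map_sub, map_smul, add_apply, sub_apply, smul_apply,
    ContinuousLinearMap.coe_comp, Function.comp_apply, ContinuousLinearMap.id_apply, smul_eq_mul]
  ring

theorem gradL_apply {D : Finset ℚ} (θ : Traj n D) (u : Controls m S.N) (i : D) :
    S.gradL L2 θ u i =
      (1 / S.dt D i ^ 2) • S.mass (θ i - (1 + S.dt D i / S.dt D (pred D i)) • S.frame θ (pred D i) +
        (S.dt D i / S.dt D (pred D i)) • S.frame θ (pred D (pred D i))) +
      gradient (S.Pg L2) (θ i) - S.g + S.bgrad (θ i, ctrl u i) :=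
  hS.gradient_Ebar _ _ _ _ _ _

end Standing

theorem frame_eq {D : Finset ℚ} (θ : Traj n D) (i : ℚ) :
    S.frame θ i = frameL n D i θ + S.frame (0 : Traj n D) i := by
  unfold frame
  by_cases h : i ∈ D
  · simp [h, frameL_of_mem h]
  · simp [h, frameL_of_notMem h]

theorem frame_of_mem {D : Finset ℚ} (θ : Traj n D) (i : D) : S.frame θ i = θ i := by
  simp [frame]

/-- The linear part of the inertial term at `i`. -/
def inertiaL (S : TOProblem n m nE nI nR) (D : Finset ℚ) (i : ℚ) : Traj n D →L[ℝ] Config n :=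
  (1 / S.dt D i ^ 2) • S.mass ∘L
    (-((1 + S.dt D i / S.dt D (pred D i)) • frameL n D (pred D i)) +
        (S.dt D i / S.dt D (pred D i)) • frameL n D (pred D (pred D i)))

/-- The configuration-dependent part of `gradL` without inertia. -/
def force (S : TOProblem n m nE nI nR) (L2 : ℝ) (w : Control m) (t : Config n) : Config n :=
  gradient (S.Pg L2) t - S.g + S.bgrad (t, w)

namespace Standing

variable {L2 : ℝ} (hS : Standing S L2)

include hS

/-- Separates the own inertia, the linear dependence on earlier decision variables, a constant from
the two fixed frames, and a nonlinear force that sees only `θ i` and its control. Smoothness, the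
Jacobians and the Lipschitz bound are all read off from this form. -/
theorem gradL_apply' {D : Finset ℚ} (θ : Traj n D) (u : Controls m S.N) (i : D) :
    S.gradL L2 θ u i =
      (1 / S.dt D i ^ 2) • S.mass (θ i) + S.inertiaL D i θ +
      (1 / S.dt D i ^ 2) • S.mass (
        -((1 + S.dt D i / S.dt D (pred D i)) • S.frame (0 : Traj n D) (pred D i)) +
        (S.dt D i / S.dt D (pred D i)) • S.frame (0 : Traj n D) (pred D (pred D i))) +
      S.force L2 (ctrlL m S.N i u) (θ i) := by
  rw [hS.gradL_apply, frame_eq θ (pred D i), frame_eq θ (pred D (pred D i)), ctrl_eq_ctrlL]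
  simp only [inertiaL, force, map_add, map_sub, map_neg, map_smul, smul_add, smul_sub, smul_neg,
    smul_apply, add_apply, ContinuousLinearMap.coe_comp, Function.comp_apply, neg_apply]
  module

theorem contDiff_gradL (D : Finset ℚ) :
    ContDiff ℝ 1 (fun z : Traj n D × Controls m S.N => S.gradL L2 z.1 z.2) := by
  rw [contDiff_piLp]
  intro i
  simp only [hS.gradL_apply']
  simp only [← frameL_coe]
  have hp : ContDiff ℝ 1 fun z : Traj n D × Controls m S.N => frameL n D i z.1 := by fun_prop
  have hc : ContDiff ℝ 1 fun z : Traj n D × Controls m S.N => ctrlL m S.N i z.2 := by fun_prop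
  have h3 : ContDiff ℝ 1 fun z : Traj n D × Controls m S.N =>
    gradient (S.Pg L2) (frameL n D i z.1) := hS.smoothLip_Pg.2.1.comp hp
  have h4 : ContDiff ℝ 1 fun z : Traj n D × Controls m S.N =>
    S.bgrad (frameL n D i z.1, ctrlL m S.N i z.2) := hS.contDiff_bgrad.comp (hp.prodMk hc)
  unfold force
  fun_prop

theorem differentiable_gradL (D : Finset ℚ) :
    Differentiable ℝ (fun z : Traj n D × Controls m S.N => S.gradL L2 z.1 z.2) :=
  (hS.contDiff_gradL D).differentiable one_ne_zero

theorem hasFDerivAt_gradL_left {D : Finset ℚ} (θ : Traj n D) (u : Controls m S.N) :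
    HasFDerivAt (fun θ' => S.gradL L2 θ' u) (S.jacθ L2 θ u) θ :=
  (hasFDerivAt_partial_left (hS.differentiable_gradL D (θ, u))).differentiableAt.hasFDerivAt

theorem hasFDerivAt_gradL_right {D : Finset ℚ} (θ : Traj n D) (u : Controls m S.N) :
    HasFDerivAt (fun u' => S.gradL L2 θ u') (S.jacu L2 θ u) u :=
  (hasFDerivAt_partial_right (hS.differentiable_gradL D (θ, u))).differentiableAt.hasFDerivAt

theorem fderiv_gradL {D : Finset ℚ} (θ : Traj n D) (u : Controls m S.N) (v : Traj n D)
    (w : Controls m S.N) :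
    fderiv ℝ (fun z : Traj n D × Controls m S.N => S.gradL L2 z.1 z.2) (θ, u) (v, w) =
      S.jacθ L2 θ u v + S.jacu L2 θ u w :=
  fderiv_eq_partial_add (hS.differentiable_gradL D (θ, u)) v w

theorem differentiable_force (w : Control m) : Differentiable ℝ (S.force L2 w) := by
  have h1 := hS.smoothLip_Pg.2.1.differentiable one_ne_zero
  have h2 : Differentiable ℝ fun t => S.bgrad (t, w) :=
    (hS.contDiff_bgrad.differentiable one_ne_zero).comp
      (differentiable_id.prodMk (differentiable_const w))
  exact (h1.sub_const _).add h2

/-- One constant serves all controls in `X` and all grids; it later bounds how negative the force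
Jacobian can be. -/
theorem force_lipschitz : ∃ L : ℝ, 0 ≤ L ∧ ∀ w ∈ S.X, ∀ t t',
    ‖S.force L2 w t - S.force L2 w t'‖ ≤ L * ‖t - t'‖ := by
  obtain ⟨-, -, L, hL, h⟩ := hS.smoothLip_Pg
  obtain ⟨⟨Lb, hb⟩, -⟩ := hS.control
  refine ⟨L + max Lb 0, by positivity, fun w hw t t' => ?_⟩
  have h1 := h t t'
  have h2 : ‖S.bgrad (t, w) - S.bgrad (t', w)‖ ≤ max Lb 0 * ‖t - t'‖ :=
    ((hb w hw).2 t t').trans (mul_le_mul_of_nonneg_right (le_max_left _ _) (norm_nonneg _))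
  have e : S.force L2 w t - S.force L2 w t' = (gradient (S.Pg L2) t - gradient (S.Pg L2) t') +
      (S.bgrad (t, w) - S.bgrad (t', w)) := by unfold force; abel
  rw [e, add_mul]
  exact (norm_add_le _ _).trans (add_le_add h1 h2)

theorem diagBlock_eq {D : Finset ℚ} (θ : Traj n D) (u : Controls m S.N) (i : D) :
    S.diagBlock L2 θ u i =
      (1 / S.dt D i ^ 2) • S.mass + fderiv ℝ (S.force L2 (ctrl u i)) (θ i) := by
  unfold diagBlock
  have e : gradient (S.EbarAt L2 θ u i) = fun t => ((1 / S.dt D i ^ 2) • S.mass t +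
      (1 / S.dt D i ^ 2) • S.mass
        (-((1 + S.dt D i / S.dt D (pred D i)) • S.frame θ (pred D i)) +
        (S.dt D i / S.dt D (pred D i)) • S.frame θ (pred D (pred D i)))) +
      S.force L2 (ctrl u i) t := by
    funext t
    refine (hS.gradient_Ebar _ _ _ _ _ _).trans ?_
    simp only [force, map_add, map_sub, map_neg, map_smul, smul_add, smul_sub, smul_neg]
    module
  rw [e]
  have h1 : HasFDerivAt (fun t => (1 / S.dt D i ^ 2) • S.mass t) ((1 / S.dt D i ^ 2) • S.mass)
    (θ i) := S.mass.hasFDerivAt.fun_const_smul _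
  exact ((h1.add_const _).add (hS.differentiable_force _ _).hasFDerivAt).fderiv

/-- Block lower triangular structure: `inertiaL D i` involves only the two preceding indices. -/
theorem jacθ_apply {D : Finset ℚ} (θ : Traj n D) (u : Controls m S.N) (v : Traj n D) (i : D) :
    S.jacθ L2 θ u v i = S.diagBlock L2 θ u i (v i) + S.inertiaL D i v := by
  have h := apply_fderiv_of_affine_add_comp
    (hS.hasFDerivAt_gradL_left θ u).differentiableAt (frameL n D i)
    ((1 / S.dt D i ^ 2) • (S.mass ∘L frameL n D i) + S.inertiaL D i) _ (frameL n D i)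
    (hS.differentiable_force (ctrl u i) (frameL n D i θ))
    (fun θ' => by
      rw [frameL_coe, hS.gradL_apply', ← ctrl_eq_ctrlL, ← frameL_coe]; rfl) v
  rw [frameL_coe] at h
  refine h.trans ?_
  rw [hS.diagBlock_eq]
  simp only [add_apply, smul_apply, ContinuousLinearMap.coe_comp, Function.comp_apply, frameL_coe]
  abel

theorem jacu_apply {D : Finset ℚ} (θ : Traj n D) (u w : Controls m S.N) (i : D) :
    S.jacu L2 θ u w i = fderiv ℝ (fun v => S.bgrad (θ i, v)) (ctrl u i) (ctrl w i) := by
  have hb : Differentiable ℝ (fun v => S.bgrad (θ i, v)) :=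
    (hS.contDiff_bgrad.differentiable one_ne_zero).comp
      ((differentiable_const _).prodMk differentiable_id)
  have h := apply_fderiv_of_affine_add_comp
    (hS.hasFDerivAt_gradL_right θ u).differentiableAt (frameL n D i) 0 _ (ctrlL m S.N i)
    (hb (ctrlL m S.N i u))
    (fun u' => by
      rw [frameL_coe, hS.gradL_apply, ctrl_eq_ctrlL, zero_apply, zero_add]) w
  rw [frameL_coe, zero_apply, zero_add] at h
  rw [ctrl_eq_ctrlL, ctrl_eq_ctrlL]
  exact h

end Standing

end TOProblem

/-! ### Quadratic programs with an invertible equality constraint -/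

section QuadraticProgram

variable {E F : Type*} [NormedAddCommGroup E] [InnerProductSpace ℝ E] [FiniteDimensional ℝ E]
  [NormedAddCommGroup F] [InnerProductSpace ℝ F] [FiniteDimensional ℝ F]

theorem surjective_of_norm_le {A : E →L[ℝ] E} {C : ℝ} (hA : ∀ v, ‖v‖ ≤ C * ‖A v‖) :
    Function.Surjective A := by
  have hinj : Function.Injective (A : E →ₗ[ℝ] E) := by
    rw [← LinearMap.ker_eq_bot, LinearMap.ker_eq_bot']
    intro v hv
    have h := hA v
    have hv' : A v = 0 := hv
    rw [hv', norm_zero, mul_zero] at h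
    exact norm_le_zero_iff.1 h
  exact LinearMap.injective_iff_surjective.1 hinj

/-- With `μ = A v` one has `‖μ‖² = ⟪A* μ, v⟫ ≤ ‖A* μ‖ C ‖μ‖`. This is what bounds the multipliers.
-/
theorem norm_le_adjoint {A : E →L[ℝ] E} {C : ℝ} (hA : ∀ v, ‖v‖ ≤ C * ‖A v‖) (μ : E) :
    ‖μ‖ ≤ C * ‖ContinuousLinearMap.adjoint A μ‖ := by
  obtain ⟨v, hv⟩ := surjective_of_norm_le hA μ
  by_cases hμ : μ = 0
  · subst hμ; simp
  have hpos : 0 < ‖μ‖ := norm_pos_iff.2 hμ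
  have h1 : ‖μ‖ * ‖μ‖ ≤ ‖ContinuousLinearMap.adjoint A μ‖ * (C * ‖μ‖) := by
    calc ‖μ‖ * ‖μ‖ = inner ℝ μ μ := (real_inner_self_eq_norm_mul_norm μ).symm
      _ = inner ℝ μ (A v) := by rw [hv]
      _ = inner ℝ (ContinuousLinearMap.adjoint A μ) v :=
        (ContinuousLinearMap.adjoint_inner_left A v μ).symm
      _ ≤ _ := real_inner_le_norm _ _
      _ ≤ _ := by
        have := hA v
        rw [hv] at this
        gcongr
  have : ‖μ‖ * ‖μ‖ ≤ (C * ‖ContinuousLinearMap.adjoint A μ‖) * ‖μ‖ := by linarith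
  exact le_of_mul_le_mul_right this hpos

/-- Existence of a minimizer and of a multiplier for a strictly convex quadratic program. -/
theorem exists_quadratic_program_solution {A : E →L[ℝ] E} {C : ℝ} (hA : ∀ v, ‖v‖ ≤ C * ‖A v‖)
    (B : F →L[ℝ] E) (c a : E) (b : F) {K : Set F} (hK : IsCompact K) (hKc : Convex ℝ K)
    (hK0 : K.Nonempty) :
    ∃ (x : E) (w : F) (μ : E), w ∈ K ∧ c + A x + B w = 0 ∧
      (∀ x' w', w' ∈ K → c + A x' + B w' = 0 →
        inner ℝ x a + inner ℝ w b + 1 / 2 * inner ℝ x x + 1 / 2 * inner ℝ w w ≤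
        inner ℝ x' a + inner ℝ w' b + 1 / 2 * inner ℝ x' x' + 1 / 2 * inner ℝ w' w') ∧
      a + x + ContinuousLinearMap.adjoint A μ = 0 ∧
      ∀ w' ∈ K, inner ℝ (-(b + w + ContinuousLinearMap.adjoint B μ)) (w' - w) ≤ 0 := by
  have hsurj := surjective_of_norm_le hA
  have hinj : Function.Injective (A : E →ₗ[ℝ] E) := LinearMap.injective_iff_surjective.2 hsurj
  let e : E ≃ₗ[ℝ] E := LinearEquiv.ofBijective (A : E →ₗ[ℝ] E) ⟨hinj, hsurj⟩
  have he : ∀ y, A (e.symm y) = y := fun y => e.apply_symm_apply y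
  -- Invertibility of `A` eliminates `x = T w + t₀`, leaving a continuous function of `w` on the
  -- compact set `K`.
  let T : F →ₗ[ℝ] E := -(e.symm.toLinearMap ∘ₗ (B : F →ₗ[ℝ] E))
  let t₀ : E := -e.symm c
  have hT : ∀ w, A (T w) = -B w := fun w => by simp [T, he]
  have ht₀ : A t₀ = -c := by simp [t₀, he]
  have hTc : Continuous T := T.continuous_of_finiteDimensional
  have hfeas : ∀ x w, c + A x + B w = 0 ↔ x = T w + t₀ := by
    intro x w
    constructor
    · intro h
      apply hinj
      change A x = A (T w + t₀)
      rw [map_add, hT, ht₀, ← sub_eq_zero, ← h]; abel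
    · rintro rfl
      rw [map_add, hT, ht₀]; abel
  let J : E → F → ℝ := fun x w =>
    inner ℝ x a + inner ℝ w b + 1 / 2 * inner ℝ x x + 1 / 2 * inner ℝ w w
  have hJc : Continuous fun w => J (T w + t₀) w := by
    have : Continuous fun w => T w + t₀ := hTc.add continuous_const
    simp only [J]
    fun_prop
  obtain ⟨w, hw, hmin⟩ := hK.exists_isMinOn hK0 hJc.continuousOn
  set x := T w + t₀ with hx
  -- The multiplier is determined by stationarity in `x`, since the adjoint of `A` is surjective
  -- too.
  have hadj : ∃ μ, ContinuousLinearMap.adjoint A μ = -(a + x) :=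
    surjective_of_norm_le (A := ContinuousLinearMap.adjoint A) (C := C) (fun μ => by
      have h := norm_le_adjoint hA μ
      exact h) _
  obtain ⟨μ, hμ⟩ := hadj
  refine ⟨x, w, μ, hw, (hfeas x w).2 rfl, ?_, by rw [hμ]; abel, ?_⟩
  · intro x' w' hw' h
    rw [(hfeas x' w').1 h]
    exact hmin hw'
  · intro w' hw'
    set z := w' - w with hz
    -- Minimality along the segment from `w` to `w'`, divided by `s`: a slope plus `s` times a
    -- curvature.
    have hquad : ∀ s ∈ Set.Ioc (0 : ℝ) 1,
        0 ≤ (inner ℝ (T z) (a + x) + inner ℝ z (b + w)) +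
          s * (1 / 2 * (‖T z‖ ^ 2 + ‖z‖ ^ 2)) := by
      intro s hs
      have hmem : w + s • z ∈ K := by
        have := hKc hw hw' (a := 1 - s) (b := s) (by linarith [hs.2]) hs.1.le (by ring)
        convert this using 1
        rw [hz]; module
      have h1 : J x w ≤ J (T (w + s • z) + t₀) (w + s • z) := hmin hmem
      have e1 : T (w + s • z) + t₀ = x + s • T z := by rw [hx, map_add, map_smul]; abel
      rw [e1] at h1
      simp only [J, inner_add_left, inner_add_right, real_inner_smul_left,
        real_inner_smul_right] at h1
      rw [real_inner_comm (T z) x, real_inner_comm z w] at h1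
      have h2 : 0 ≤ s * ((inner ℝ (T z) (a + x) + inner ℝ z (b + w)) +
          s * (1 / 2 * (‖T z‖ ^ 2 + ‖z‖ ^ 2))) := by
        simp only [inner_add_right, ← real_inner_self_eq_norm_sq]
        nlinarith
      exact nonneg_of_mul_nonneg_right h2 hs.1
    have hlin : 0 ≤ inner ℝ (T z) (a + x) + inner ℝ z (b + w) := by
      by_contra hneg
      push Not at hneg
      set q := 1 / 2 * (‖T z‖ ^ 2 + ‖z‖ ^ 2)
      have hq : 0 ≤ q := by positivity
      set r := inner ℝ (T z) (a + x) + inner ℝ z (b + w) with hr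
      -- With this `s` the curvature term uses up at most half of the negative slope.
      have hs : min 1 (-r / (2 * (q + 1))) ∈ Set.Ioc (0 : ℝ) 1 :=
        ⟨lt_min one_pos (div_pos (by linarith) (by linarith)), min_le_left _ _⟩
      have h1 := hquad _ hs
      have h2 : min 1 (-r / (2 * (q + 1))) * q ≤ -r / (2 * (q + 1)) * q :=
        mul_le_mul_of_nonneg_right (min_le_right _ _) hq
      have h3 : -r / (2 * (q + 1)) * q ≤ -r / 2 := by
        rw [div_mul_eq_mul_div, div_le_div_iff₀ (by linarith) (by norm_num)]
        nlinarith
      linarith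
    -- Since `A ∘ T = -B`, the multiplier turns the part of the slope coming from `x` into the
    -- `B`-term of the variational inequality.
    have e2 : inner ℝ (T z) (a + x) = inner ℝ z (ContinuousLinearMap.adjoint B μ) := by
      have : a + x = -ContinuousLinearMap.adjoint A μ := by rw [hμ]; abel
      rw [this, inner_neg_right, ContinuousLinearMap.adjoint_inner_right, hT, inner_neg_left,
        neg_neg, ContinuousLinearMap.adjoint_inner_right]
    rw [inner_neg_left, neg_nonpos, real_inner_comm, inner_add_right, ← e2]
    linarith

end QuadraticProgram

namespace TOProblem

variable {n m nE nI nR : ℕ} {S : TOProblem n m nE nI nR}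

namespace Standing

variable {L2 : ℝ} (hS : Standing S L2)

include hS

theorem isCompact_X : IsCompact S.X := hS.cost.2.1
theorem convex_X : Convex ℝ S.X := hS.cost.2.2.1

/-! ### Bounds on a fixed grid -/

/-- Forward substitution in time: each block of `v` is recovered from the right-hand side and the
two preceding blocks by inverting a diagonal block. The constant depends on `D` and `L3`, not on `θ`
or `u`. -/
theorem exists_jacθ_bound {L3 : ℝ} (hL3 : 0 < L3) {D : Finset ℚ} (hD : IsGrid S.N D) :
    ∃ C : ℝ, 0 ≤ C ∧ ∀ θ u, (∀ i : D, L3 ≤ sigmaMin (S.diagBlock L2 θ u i)) →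
      ∀ v, ‖v‖ ≤ C * ‖S.jacθ L2 θ u v‖ := by
  have key : ∀ i ∈ insert 0 D, ∃ C : ℝ, 0 ≤ C ∧ ∀ θ u,
      (∀ i : D, L3 ≤ sigmaMin (S.diagBlock L2 θ u i)) →
      ∀ v, ‖frameL n D i v‖ ≤ C * ‖S.jacθ L2 θ u v‖ := by
    refine grid_induction ⟨0, le_rfl, fun θ u _ v => ?_⟩ fun i hi ih => ?_
    · rw [frameL_of_notMem fun h => lt_irrefl _ (hD 0 h).1]; simp
    -- The second predecessor may be `-1`, which the induction does not cover; `frameL` is zero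
    -- there.
    have ih' : ∀ j < i, ∃ C : ℝ, 0 ≤ C ∧ ∀ θ u,
      (∀ i : D, L3 ≤ sigmaMin (S.diagBlock L2 θ u i)) →
      ∀ v, ‖frameL n D j v‖ ≤ C * ‖S.jacθ L2 θ u v‖ := by
      intro j hj
      by_cases hjD : j ∈ insert 0 D
      · exact ih j hjD hj
      · refine ⟨0, le_rfl, fun θ u _ v => ?_⟩
        rw [frameL_of_notMem fun h => hjD (Finset.mem_insert_of_mem h)]; simp
    have hi0 := (hD i hi).1
    have hp : pred D i < i := pred_lt D (by linarith)
    have hpp : pred D (pred D i) < i :=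
      (pred_lt D (by linarith [pred_nonneg (D := D) hi0])).trans hp
    obtain ⟨C1, hC1, h1⟩ := ih' _ hp
    obtain ⟨C2, hC2, h2⟩ := ih' _ hpp
    set a := |1 / S.dt D i ^ 2| * ‖S.mass‖ with ha
    set b1 := |1 + S.dt D i / S.dt D (pred D i)| with hb1
    set b2 := |S.dt D i / S.dt D (pred D i)| with hb2
    refine ⟨(1 + a * (b1 * C1 + b2 * C2)) / L3, by positivity, fun θ u hns v => ?_⟩
    set J := S.jacθ L2 θ u v with hJ
    have hI : ‖S.inertiaL D i v‖ ≤ a * (b1 * C1 + b2 * C2) * ‖J‖ := by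
      unfold inertiaL
      simp only [smul_apply, ContinuousLinearMap.coe_comp, Function.comp_apply, add_apply,
        neg_apply, norm_smul, Real.norm_eq_abs]
      rw [ha, mul_assoc, mul_assoc]
      refine mul_le_mul_of_nonneg_left ?_ (abs_nonneg _)
      refine (S.mass.le_opNorm _).trans (mul_le_mul_of_nonneg_left ?_ (norm_nonneg _))
      refine (norm_add_le _ _).trans ?_
      rw [norm_neg, norm_smul, norm_smul, Real.norm_eq_abs, Real.norm_eq_abs, ← hb1, ← hb2]
      have g1 := mul_le_mul_of_nonneg_left (h1 θ u hns v) (abs_nonneg _ : 0 ≤ b1)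
      have g2 := mul_le_mul_of_nonneg_left (h2 θ u hns v) (abs_nonneg _ : 0 ≤ b2)
      rw [← hJ] at g1 g2
      linarith
    have hA := sigmaMin_mul_norm_le (S.diagBlock L2 θ u ⟨i, hi⟩) (v ⟨i, hi⟩)
    have e := hS.jacθ_apply θ u v ⟨i, hi⟩
    have hA2 : ‖S.diagBlock L2 θ u ⟨i, hi⟩ (v ⟨i, hi⟩)‖ ≤
        ‖J‖ + a * (b1 * C1 + b2 * C2) * ‖J‖ := by
      have : S.diagBlock L2 θ u ⟨i, hi⟩ (v ⟨i, hi⟩) = J ⟨i, hi⟩ - S.inertiaL D i v := by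
        rw [hJ, e]; simp
      rw [this]
      exact (norm_sub_le _ _).trans (add_le_add (PiLp.norm_apply_le J _) hI)
    have hs := mul_le_mul_of_nonneg_right (hns ⟨i, hi⟩) (norm_nonneg (v ⟨i, hi⟩))
    rw [frameL_of_mem hi, div_mul_eq_mul_div, le_div_iff₀ hL3]
    linarith
  choose! C hC0 hC using key
  refine ⟨∑ i : D, C i, Finset.sum_nonneg fun i _ => hC0 i (Finset.mem_insert_of_mem i.2),
    fun θ u hns v => ?_⟩
  refine (norm_le_sum_norm v).trans ?_
  rw [Finset.sum_mul]
  refine Finset.sum_le_sum fun i _ => ?_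
  rw [← frameL_coe]
  exact hC i (Finset.mem_insert_of_mem i.2) θ u hns v

theorem exists_jacu_bound {D : Finset ℚ} (hD : IsGrid S.N D) :
    ∃ B : ℝ, 0 ≤ B ∧ ∀ (θ : Traj n D) (u : Controls m S.N), (∀ i, u i ∈ S.X) →
      ∀ w, ‖S.jacu L2 θ u w‖ ≤ B * ‖w‖ := by
  obtain ⟨B, hB⟩ := hS.control.2.2.2.2
  refine ⟨D.card * max B 0, by positivity, fun θ u hu w => ?_⟩
  have h : ∀ i, ‖S.jacu L2 θ u w i‖ ≤ max B 0 * ‖w‖ := by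
    intro i
    rw [hS.jacu_apply]
    refine (ContinuousLinearMap.le_opNorm _ _).trans ?_
    refine mul_le_mul ((hB _ _ (hD.ctrl_mem hu i.2)).trans (le_max_left _ _)) ?_
      (norm_nonneg _) (le_max_right _ _)
    rw [ctrl_eq_ctrlL]
    exact norm_ctrlL_le w i
  have := norm_le_card_mul _ h
  rw [Fintype.card_coe] at this
  linarith

/-- Global in `θ`, but restricted to controls in `X`, whose convexity allows the mean value
inequality with the bounded mixed derivative. It limits the growth of the residual in a single SQP
step. -/
theorem exists_gradL_lipschitz {D : Finset ℚ} (hD : IsGrid S.N D) :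
    ∃ K : ℝ, 0 ≤ K ∧ ∀ (θ θ' : Traj n D) (u u' : Controls m S.N), (∀ i, u i ∈ S.X) →
      (∀ i, u' i ∈ S.X) → ‖S.gradL L2 θ' u' - S.gradL L2 θ u‖ ≤ K * (‖θ' - θ‖ + ‖u' - u‖) := by
  obtain ⟨B, hB⟩ := hS.control.2.2.2.2
  obtain ⟨L, hL, hF⟩ := hS.force_lipschitz
  have hbg : ∀ t, ∀ w ∈ S.X, ∀ w' ∈ S.X, ‖S.bgrad (t, w') - S.bgrad (t, w)‖ ≤
      max B 0 * ‖w' - w‖ := by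
    intro t w hw w' hw'
    refine hS.convex_X.norm_image_sub_le_of_norm_fderiv_le (𝕜 := ℝ)
      (f := fun v => S.bgrad (t, v)) (fun z _ => ?_)
      (fun z hz => (hB t z hz).trans (le_max_left _ _)) hw hw'
    exact ((hS.contDiff_bgrad.differentiable one_ne_zero).comp
      ((differentiable_const _).prodMk differentiable_id)) z
  have key : ∀ i : D, ∃ K : ℝ, 0 ≤ K ∧ ∀ (θ θ' : Traj n D) (u u' : Controls m S.N),
      (∀ i, u i ∈ S.X) → (∀ i, u' i ∈ S.X) →
      ‖S.gradL L2 θ' u' i - S.gradL L2 θ u i‖ ≤ K * (‖θ' - θ‖ + ‖u' - u‖) := by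
    intro i
    set Q : Traj n D →L[ℝ] Config n :=
      (1 / S.dt D i ^ 2) • (S.mass ∘L frameL n D i) + S.inertiaL D i with hQ
    refine ⟨‖Q‖ + L + max B 0, by positivity, fun θ θ' u u' hu hu' => ?_⟩
    have hc := hD.ctrl_mem hu i.2
    have hc' := hD.ctrl_mem hu' i.2
    have e : S.gradL L2 θ' u' i - S.gradL L2 θ u i = Q (θ' - θ) +
        (S.force L2 (ctrl u i) (θ' i) - S.force L2 (ctrl u i) (θ i)) +
        (S.bgrad (θ' i, ctrl u' i) - S.bgrad (θ' i, ctrl u i)) := by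
      rw [hS.gradL_apply', hS.gradL_apply', ← ctrl_eq_ctrlL, ← ctrl_eq_ctrlL, hQ, map_sub]
      simp only [force, add_apply, smul_apply, ContinuousLinearMap.coe_comp, Function.comp_apply,
        frameL_coe]
      abel
    rw [e]
    have g1 := Q.le_opNorm (θ' - θ)
    have g2 := hF _ hc (θ' i) (θ i)
    have g3 := hbg (θ' i) _ hc _ hc'
    have g4 : ‖θ' i - θ i‖ ≤ ‖θ' - θ‖ := PiLp.norm_apply_le (θ' - θ) i
    have g5 : ‖ctrl u' i - ctrl u i‖ ≤ ‖u' - u‖ := by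
      rw [ctrl_eq_ctrlL, ctrl_eq_ctrlL, ← map_sub]; exact norm_ctrlL_le _ _
    have g6 := (norm_add₃_le (a := Q (θ' - θ))
      (b := S.force L2 (ctrl u i) (θ' i) - S.force L2 (ctrl u i) (θ i))
      (c := S.bgrad (θ' i, ctrl u' i) - S.bgrad (θ' i, ctrl u i)))
    have g7 := mul_le_mul_of_nonneg_left g4 hL
    have g8 := mul_le_mul_of_nonneg_left g5 (le_max_right B 0)
    have g9 : 0 ≤ ‖Q‖ * ‖u' - u‖ := by positivity
    have g10 : 0 ≤ L * ‖u' - u‖ := by positivity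
    have g11 : 0 ≤ max B 0 * ‖θ' - θ‖ := by positivity
    nlinarith
  choose K hK0 hK using key
  refine ⟨∑ i, K i, Finset.sum_nonneg fun i _ => hK0 i, fun θ θ' u u' hu hu' => ?_⟩
  refine (norm_le_sum_norm _).trans ?_
  rw [Finset.sum_mul]
  exact Finset.sum_le_sum fun i _ => hK i θ θ' u u' hu hu'

end Standing
end TOProblem

namespace TOProblem

variable {n m nE nI nR : ℕ} {S : TOProblem n m nE nI nR}

theorem stepNorm_sq {D : Finset ℚ} {N : ℕ} (dθ : Traj n D) (du : Controls m N) :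
    stepNorm dθ du ^ 2 = ‖dθ‖ ^ 2 + ‖du‖ ^ 2 := Real.sq_sqrt (by positivity)

theorem norm_left_le_stepNorm {D : Finset ℚ} {N : ℕ} (dθ : Traj n D) (du : Controls m N) :
    ‖dθ‖ ≤ stepNorm dθ du := Real.le_sqrt_of_sq_le (by nlinarith [sq_nonneg ‖du‖])

theorem norm_right_le_stepNorm {D : Finset ℚ} {N : ℕ} (dθ : Traj n D) (du : Controls m N) :
    ‖du‖ ≤ stepNorm dθ du := Real.le_sqrt_of_sq_le (by nlinarith [sq_nonneg ‖dθ‖])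

theorem tol_pos {P : SolverParams} (hε : 0 < P.ε) : 0 < S.tol P := by
  unfold tol; split_ifs <;> positivity

theorem tol_le {P : SolverParams} (hε : 0 < P.ε) : S.tol P ≤ P.ε := by
  unfold tol
  split_ifs
  · have : (2 : ℝ) ^ (2 / 3 : ℝ) ≤ 2 ^ (1 : ℝ) :=
      Real.rpow_le_rpow_of_exponent_le (by norm_num) (by norm_num)
    rw [Real.rpow_one] at this
    rw [div_le_iff₀ (by norm_num)]
    nlinarith
  · exact le_rfl

namespace Standing

variable {L2 : ℝ} (hS : Standing S L2)

include hS

theorem differentiable_O (D : Finset ℚ) :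
    Differentiable ℝ (fun z : Traj n D × Controls m S.N => S.O D z.1 z.2) :=
  ((hS.cost.1 D).2.1).differentiable one_ne_zero

theorem fderiv_O {D : Finset ℚ} (θ : Traj n D) (u : Controls m S.N) (v : Traj n D)
    (w : Controls m S.N) :
    fderiv ℝ (fun z : Traj n D × Controls m S.N => S.O D z.1 z.2) (θ, u) (v, w) =
      inner ℝ v (gradient (fun θ' => S.O D θ' u) θ) +
        inner ℝ w (gradient (fun u' => S.O D θ u') u) := by
  rw [fderiv_eq_partial_add (hS.differentiable_O D (θ, u)) v w, real_inner_comm,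
    inner_gradient_eq_fderiv, real_inner_comm, inner_gradient_eq_fderiv]

/-! ### Solutions of the quadratic program -/

theorem exists_qpSolution {D : Finset ℚ} {θ : Traj n D} {u : Controls m S.N}
    (hu : ∀ i, u i ∈ S.X) {C : ℝ} (hC : ∀ v, ‖v‖ ≤ C * ‖S.jacθ L2 θ u v‖) :
    ∃ dθ du μ, S.QPSolution L2 θ u (ContinuousLinearMap.id ℝ _) (ContinuousLinearMap.id ℝ _)
      dθ du μ := by
  let K : Set (Controls m S.N) := {w | ∀ i, u i + w i ∈ S.X}
  have hKclosed : IsClosed K := by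
    have : K = ⋂ i, {w : Controls m S.N | u i + w i ∈ S.X} := by ext; simp [K]
    rw [this]
    refine isClosed_iInter fun i => hS.isCompact_X.isClosed.preimage ?_
    exact continuous_const.add (PiLp.continuous_apply 2 (fun _ => Control m) i)
  obtain ⟨r, hr⟩ := hS.isCompact_X.isBounded.exists_norm_le
  have hK : IsCompact K := by
    refine Metric.isCompact_of_isClosed_isBounded hKclosed ?_
    refine (Metric.isBounded_closedBall (x := (0 : Controls m S.N))
      (r := Fintype.card (Fin S.N) * (r + r))).subset fun w hw => ?_
    rw [mem_closedBall_zero_iff]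
    refine norm_le_card_mul w fun i => ?_
    have : w i = (u i + w i) - u i := by abel
    rw [this]
    exact (norm_sub_le _ _).trans (add_le_add (hr _ (hw i)) (hr _ (hu i)))
  have hKc : Convex ℝ K := by
    intro w hw w' hw' a b ha hb hab i
    have := hS.convex_X (hw i) (hw' i) ha hb hab
    have e : u i + (a • w + b • w') i = a • (u i + w i) + b • (u i + w' i) := by
      rw [show b = 1 - a by linarith]
      simp only [PiLp.add_apply, PiLp.smul_apply]
      module
    rwa [e]
  have hK0 : K.Nonempty := ⟨0, fun i => by simpa using hu i⟩
  obtain ⟨x, w, μ, hw, hfeas, hmin, hst, hn⟩ := exists_quadratic_program_solution hC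
    (S.jacu L2 θ u) (S.gradL L2 θ u) (gradient (fun θ' => S.O D θ' u) θ)
    (gradient (fun u' => S.O D θ u') u) hK hKc hK0
  refine ⟨x, w, μ, ⟨hw, hfeas⟩, fun eθ eu h => ?_, ?_⟩
  · exact hmin eθ eu h.1 h.2
  · refine ⟨_, hst, add_neg_cancel _, fun i y hy => ?_⟩
    -- Varying a single block of the control step splits the joint variational inequality into one
    -- normal-cone condition per frame.
    have hmem : WithLp.toLp 2 (Function.update w.ofLp i (y - u i)) ∈ K := by
      intro j
      by_cases hj : j = i
      · subst hj; simpa using hy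
      · simpa [hj] using hw j
    have h := hn _ hmem
    rw [PiLp.inner_apply, Finset.sum_eq_single i] at h
    · have e : (WithLp.toLp 2 (Function.update w.ofLp i (y - u i)) - w) i = y - (u i + w i) := by
        rw [PiLp.sub_apply]
        change Function.update w.ofLp i (y - u i) i - w i = _
        rw [Function.update_self, sub_sub]
      rwa [e] at h
    · intro j _ hj
      simp [hj]
    · simp

/-- The quadratic program yields a descent direction. -/
theorem qp_descent {L5 : ℝ} {D : Finset ℚ} {θ : Traj n D} {u : Controls m S.N}
    (hu : ∀ i, u i ∈ S.X) {Hθ : Traj n D →L[ℝ] Traj n D}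
    {Hu : Controls m S.N →L[ℝ] Controls m S.N} (hHθ : HessianBound L5 Hθ)
    (hHu : HessianBound L5 Hu) {dθ : Traj n D} {du : Controls m S.N} {μ : Traj n D}
    (h : S.QPSolution L2 θ u Hθ Hu dθ du μ) :
    fderiv ℝ (fun z : Traj n D × Controls m S.N => S.O D z.1 z.2) (θ, u) (dθ, du) ≤
      -(1 / L5) * stepNorm dθ du ^ 2 + (⨆ i : D, ‖μ i‖) * l1norm (S.gradL L2 θ u) := by
  obtain ⟨⟨-, hfeas⟩, -, μu, h1, h2, h3⟩ := h
  rw [hS.fderiv_O]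
  have e1 : gradient (fun θ' => S.O D θ' u) θ =
      -(Hθ dθ) - ContinuousLinearMap.adjoint (S.jacθ L2 θ u) μ := by
    rw [← sub_eq_zero, ← h1]; abel
  have e2 : gradient (fun u' => S.O D θ u') u =
      -(Hu du) - ContinuousLinearMap.adjoint (S.jacu L2 θ u) μ - μu := by
    rw [← sub_eq_zero, ← h2]; abel
  rw [e1, e2]
  simp only [inner_sub_right, inner_neg_right, ContinuousLinearMap.adjoint_inner_right]
  -- The linearized constraint replaces `A dθ + B du` by `-c`, which trades the multiplier terms for
  -- the residual.
  have e3 : inner ℝ (S.jacθ L2 θ u dθ) μ + inner ℝ (S.jacu L2 θ u du) μ =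
      -inner ℝ (S.gradL L2 θ u) μ := by
    have : S.jacθ L2 θ u dθ + S.jacu L2 θ u du = -S.gradL L2 θ u := by
      rw [← sub_eq_zero, ← hfeas]; abel
    rw [← inner_add_left, this, inner_neg_left]
  -- The normal cone at `u + du` is tested against the feasible point `u`.
  have e4 : -inner ℝ du μu ≤ 0 := by
    rw [PiLp.inner_apply, ← Finset.sum_neg_distrib]
    refine Finset.sum_nonpos fun i _ => ?_
    have := h3 i (u i) (hu i)
    rw [sub_add_cancel_left, inner_neg_right, real_inner_comm] at this
    exact this
  have e5 : inner ℝ (S.gradL L2 θ u) μ ≤ (⨆ i : D, ‖μ i‖) * l1norm (S.gradL L2 θ u) := by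
    rw [PiLp.inner_apply]
    calc ∑ i, inner ℝ (S.gradL L2 θ u i) (μ i)
        ≤ ∑ i, (⨆ i : D, ‖μ i‖) * ‖S.gradL L2 θ u i‖ := by
          refine Finset.sum_le_sum fun i _ => (real_inner_le_norm _ _).trans ?_
          rw [mul_comm]
          exact mul_le_mul_of_nonneg_right
            (le_ciSup (f := fun i : D => ‖μ i‖) (Set.finite_range _).bddAbove i) (norm_nonneg _)
      _ = (⨆ i : D, ‖μ i‖) * ∑ i, ‖S.gradL L2 θ u i‖ := by rw [Finset.mul_sum]
      _ ≤ _ := mul_le_mul_of_nonneg_left (sum_norm_le_l1norm _)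
          (Real.iSup_nonneg fun i => norm_nonneg _)
  have e6 := (hHθ.2 dθ).1
  have e7 := (hHu.2 du).1
  rw [stepNorm_sq]
  linarith

/-! ### Line searches succeed near limit points -/

/-- Since `A d = -c`, the new residual is `(1 - s) c` up to an error below `(1 - α) / 2 * s ‖c‖`, so
`Λ` shrinks by `(1 - (1 + α) / 2 * s)²`, which is below `1 - 2 α s` once `s < 1 - α`. Constant
sequences give existence of a step; the iterates of an infinite run give a contradiction. -/
theorem eventually_wolfeC {P : SolverParams} (hP2 : P.L2 = L2) (hα : P.α ∈ Set.Ioo (0 : ℝ) 1)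
    {D : Finset ℚ} {u : Controls m S.N} {x d : ℕ → Traj n D} {s : ℕ → ℝ} {x' : Traj n D} {C r : ℝ}
    (hx : Tendsto x atTop (𝓝 x')) (hd : ∀ k, ‖d k‖ ≤ C) (hs : Tendsto s atTop (𝓝 0))
    (hs0 : ∀ k, 0 < s k) (hr : 0 < r) (hc : ∀ k, r ≤ ‖S.gradL L2 (x k) u‖)
    (hA : ∀ k, S.jacθ L2 (x k) u (d k) = -S.gradL L2 (x k) u) :
    ∀ᶠ k in atTop, S.WolfeC P (x k) u (d k) (s k) := by
  have hf : ContDiff ℝ 1 fun θ => S.gradL L2 θ u :=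
    contDiff_partial_left (hS.contDiff_gradL D) u
  have hα1 : 0 < 1 - P.α := by linarith [hα.2]
  have h1 := eventually_norm_expansion_le hf hx hd hs (fun k => (hs0 k).le)
    (e := (1 - P.α) / 2 * r) (by positivity)
  have h2 : ∀ᶠ k in atTop, s k < 1 - P.α := hs.eventually (gt_mem_nhds hα1)
  filter_upwards [h1, h2] with k hk1 hk2
  have hL : ∀ θ : Traj n D, S.Lam L2 θ u = ‖S.gradL L2 θ u‖ ^ 2 / 2 := by
    intro θ
    rw [Lam, ← Finset.sum_div, PiLp.norm_sq_eq_of_L2]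
  unfold WolfeC
  rw [hP2, hL, hL]
  set c := S.gradL L2 (x k) u with hcd
  set c' := S.gradL L2 (x k + s k • d k) u with hcd'
  have e : fderiv ℝ (fun θ => S.gradL L2 θ u) (x k) (d k) = -c := hA k
  rw [e] at hk1
  have hsk := hs0 k
  have hs1 : s k < 1 := by linarith [hα.1]
  have h3 : ‖c'‖ ≤ (1 - (1 + P.α) / 2 * s k) * ‖c‖ := by
    have e2 : c' = (1 - s k) • c + (c' - c - s k • -c) := by module
    rw [e2]
    refine (norm_add_le _ _).trans ?_
    rw [norm_smul, Real.norm_of_nonneg (by linarith)]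
    have : (1 - P.α) / 2 * r * s k ≤ (1 - P.α) / 2 * ‖c‖ * s k := by
      have := hc k
      gcongr
    linarith
  have hcpos : 0 < ‖c‖ := hr.trans_le (hc k)
  have h4 : ‖c'‖ ^ 2 ≤ ((1 - (1 + P.α) / 2 * s k) * ‖c‖) ^ 2 := by gcongr
  have h5 : (1 - (1 + P.α) / 2 * s k) ^ 2 < 1 - 2 * P.α * s k := by
    have hb : ((1 + P.α) / 2) ^ 2 < 1 := by
      have := hα.1
      have := hα.2
      nlinarith
    have hb1 : ((1 + P.α) / 2) ^ 2 * s k < 1 - P.α := by nlinarith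
    have hb2 := mul_lt_mul_of_pos_right hb1 hsk
    linarith [hb2, show (1 - (1 + P.α) / 2 * s k) ^ 2 =
      1 - (1 + P.α) * s k + ((1 + P.α) / 2) ^ 2 * s k * s k by ring]
  have h6 := mul_lt_mul_of_pos_right h5 (by positivity : 0 < ‖c‖ ^ 2)
  rw [mul_pow] at h4
  linarith

/-- The linear model of the merit function decreases at rate at least `q`, of which the search
demands only the fraction `α`; the slack `(1 - α) q s` absorbs the expansion errors. Bounded `ρ`
keeps the error of the penalty term small. As in `eventually_wolfeC`, sequences serve both progress
and termination. -/
theorem eventually_lineSearch {P : SolverParams} (hP2 : P.L2 = L2)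
    (hα : P.α ∈ Set.Ioo (0 : ℝ) 1) (hL4 : 0 < P.L4) {D : Finset ℚ}
    {x d : ℕ → Traj n D × Controls m S.N} {s ρ : ℕ → ℝ}
    {x' : Traj n D × Controls m S.N} {C ρ' q : ℝ} (hx : Tendsto x atTop (𝓝 x'))
    (hd : ∀ k, ‖d k‖ ≤ C) (hs : Tendsto s atTop (𝓝 0)) (hs0 : ∀ k, 0 < s k)
    (hρ0 : ∀ k, 0 ≤ ρ k) (hρ : ∀ k, ρ k ≤ ρ') (hq : 0 < q)
    (hqk : ∀ k, q ≤ 1 / P.L5 * stepNorm (d k).1 (d k).2 ^ 2 +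
      P.L10 * l1norm (S.gradL L2 (x k).1 (x k).2))
    (hA : ∀ k, S.gradL L2 (x k).1 (x k).2 + S.jacθ L2 (x k).1 (x k).2 (d k).1 +
      S.jacu L2 (x k).1 (x k).2 (d k).2 = 0)
    (hO : ∀ k, fderiv ℝ (fun z : Traj n D × Controls m S.N => S.O D z.1 z.2) (x k) (d k) ≤
      -(1 / P.L5) * stepNorm (d k).1 (d k).2 ^ 2 +
        (ρ k - P.L10) * l1norm (S.gradL L2 (x k).1 (x k).2)) :
    ∀ᶠ k in atTop, S.LineSearch P (ρ k) (x k).1 (x k).2 (d k).1 (d k).2 (s k) := by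
  have hρ'0 : 0 ≤ ρ' := (hρ0 0).trans (hρ 0)
  set κ : ℝ := ((D.card * n : ℕ) : ℝ) with hκ
  have hκ0 : 0 ≤ κ := Nat.cast_nonneg _
  have hα1 : 0 < 1 - P.α := by linarith [hα.2]
  -- The cost and the penalty term each contribute an error `e1 * s`, together half of the slack.
  set e1 := (1 - P.α) * q / 4 with he1
  have he1pos : 0 < e1 := by positivity
  -- The first entry controls `ρ κ e2 ≤ e1`; the second gives `κ e2 ≤ L4`, so that above `L4` the
  -- loss `s ‖c‖₁` outweighs the error and the residual does not grow.
  set e2 := min (e1 / ((κ + 1) * (ρ' + 1))) (P.L4 / (κ + 1)) with he2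
  have he2pos : 0 < e2 := lt_min (by positivity) (by positivity)
  have h1 := eventually_norm_expansion_le ((hS.cost.1 D).2.1) hx hd hs (fun k => (hs0 k).le) he1pos
  have h2 := eventually_norm_expansion_le (hS.contDiff_gradL D) hx hd hs (fun k => (hs0 k).le)
    he2pos
  have h3 : ∀ᶠ k in atTop, s k < 1 := hs.eventually (gt_mem_nhds one_pos)
  filter_upwards [h1, h2, h3] with k hk1 hk2 hk3
  have hsk := hs0 k
  unfold LineSearch merit
  rw [hP2]
  set c := S.gradL L2 (x k).1 (x k).2 with hc
  set c' := S.gradL L2 ((x k).1 + s k • (d k).1) ((x k).2 + s k • (d k).2) with hc'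
  have hder : fderiv ℝ (fun z : Traj n D × Controls m S.N => S.gradL L2 z.1 z.2) (x k) (d k) =
      -c := by
    have := hS.fderiv_gradL (x k).1 (x k).2 (d k).1 (d k).2
    refine this.trans ?_
    rw [← sub_eq_zero, ← hA k, hc]; abel
  rw [hder] at hk2
  have hl : l1norm c' ≤ (1 - s k) * l1norm c + κ * (e2 * s k) := by
    have e : c' = (1 - s k) • c + (c' - c - s k • -c) := by module
    rw [e]
    refine (l1norm_add_le _ _).trans (add_le_add ?_ ?_)
    · rw [l1norm_smul, abs_of_nonneg (by linarith)]
    · exact (l1norm_le_mul_norm _).trans (mul_le_mul_of_nonneg_left hk2 hκ0)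
  have hOk := (abs_le.1 (Real.norm_eq_abs _ ▸ hk1)).2
  have hOk' : S.O D ((x k).1 + s k • (d k).1) ((x k).2 + s k • (d k).2) - S.O D (x k).1 (x k).2 -
      s k * fderiv ℝ (fun z : Traj n D × Controls m S.N => S.O D z.1 z.2) (x k) (d k) ≤ e1 * s k :=
    hOk
  constructor
  · have g1 : ρ k * l1norm c' ≤ ρ k * ((1 - s k) * l1norm c) + e1 * s k := by
      have : ρ k * (κ * (e2 * s k)) ≤ e1 * s k := by
        have a1 : ρ k * κ ≤ (κ + 1) * (ρ' + 1) := by nlinarith [hρ0 k, hρ k]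
        have a2 : ((κ + 1) * (ρ' + 1)) * e2 ≤ e1 := by
          have := min_le_left (e1 / ((κ + 1) * (ρ' + 1))) (P.L4 / (κ + 1))
          rw [← he2, le_div_iff₀ (by positivity)] at this
          linarith
        have a3 : ρ k * κ * e2 ≤ e1 := (mul_le_mul_of_nonneg_right a1 he2pos.le).trans a2
        nlinarith
      have := mul_le_mul_of_nonneg_left hl (hρ0 k)
      nlinarith
    have g2 := mul_le_mul_of_nonneg_left (hO k) hsk.le
    have g3 := mul_le_mul_of_nonneg_left (hqk k) (mul_pos hα1 hsk).le
    rw [← hc] at g2 g3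
    set Q := 1 / P.L5 * stepNorm (d k).1 (d k).2 ^ 2
    have g4 : P.α * s k * (-(1 / P.L5) * stepNorm (d k).1 (d k).2 ^ 2 - P.L10 * l1norm c) =
        -(P.α * s k * (Q + P.L10 * l1norm c)) := by ring
    have g5 : s k * (-(1 / P.L5) * stepNorm (d k).1 (d k).2 ^ 2 + (ρ k - P.L10) * l1norm c) =
        -(s k * (Q + P.L10 * l1norm c)) + s k * ρ k * l1norm c := by ring
    rw [g4]
    rw [g5] at g2
    have g6 : 0 < (1 - P.α) * s k * q := by positivity
    have g7 : e1 * s k = (1 - P.α) * s k * q / 4 := by rw [he1]; ring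
    nlinarith
  · intro hlt
    have : κ * e2 ≤ P.L4 := by
      have a := min_le_right (e1 / ((κ + 1) * (ρ' + 1))) (P.L4 / (κ + 1))
      rw [← he2, le_div_iff₀ (by positivity)] at a
      nlinarith
    nlinarith

end Standing
end TOProblem

/-! ### Backtracking -/

theorem exists_isLeast_backtracking {η : ℝ} {Q : ℝ → Prop}
    (h : ∀ᶠ l : ℕ in atTop, Q (η ^ l)) : ∃ j, IsLeast {l : ℕ | 1 ≤ l ∧ Q (η ^ l)} j := by
  classical
  obtain ⟨l, hl1, hl⟩ := ((eventually_ge_atTop 1).and h).exists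
  have hex : ∃ l : ℕ, 1 ≤ l ∧ Q (η ^ l) := ⟨l, hl1, hl⟩
  exact ⟨Nat.find hex, Nat.find_spec hex, fun k hk => Nat.find_min' hex hk⟩

/-- Once `η ^ j < η`, the exponent is at least `2`, so `η ^ j / η` is the previous trial, which was
admissible and had been rejected. -/
theorem false_of_backtracking_tendsto_zero {η : ℝ} (hη : η ∈ Set.Ioo (0 : ℝ) 1) {j : ℕ → ℕ}
    {Q : ℕ → ℝ → Prop} (hj : ∀ k, IsLeast {l : ℕ | 1 ≤ l ∧ Q k (η ^ l)} (j k))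
    (ht : Tendsto (fun k => η ^ j k) atTop (𝓝 0))
    (hQ : ∀ᶠ k in atTop, Q k (η ^ j k / η)) : False := by
  obtain ⟨k, hk1, hk2⟩ := (hQ.and (ht.eventually (gt_mem_nhds hη.1))).exists
  have h1 : 1 ≤ j k := (hj k).1.1
  have h2 : j k ≠ 1 := by
    intro h; rw [h, pow_one] at hk2; exact lt_irrefl _ hk2
  have e : η ^ j k / η = η ^ (j k - 1) := by
    rw [div_eq_iff hη.1.ne', ← pow_succ]; congr 1; omega
  rw [e] at hk1
  have : j k ≤ j k - 1 := (hj k).2 ⟨by omega, hk1⟩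
  omega

/-! ### The two inner loops on a fixed grid. -/

namespace TOProblem

variable {n m nE nI nR : ℕ} {S : TOProblem n m nE nI nR}

/-- Admissible solver parameters used by the inner loops. -/
structure LoopParams (P : SolverParams) : Prop where
  L3 : 0 < P.L3
  L4 : 0 < P.L4
  L5 : 1 ≤ P.L5
  L10 : 0 < P.L10
  ε : 0 < P.ε
  η : P.η ∈ Set.Ioo (0 : ℝ) 1
  α : P.α ∈ Set.Ioo (0 : ℝ) 1

/-- One iteration of `Constraint-Solve` on a fixed grid. -/
def NewtonRel (S : TOProblem n m nE nI nR) (P : SolverParams) {D : Finset ℚ} (u : Controls m S.N)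
    (θ θ' : Traj n D) : Prop :=
  ∃ (d : Traj n D) (j : ℕ), (∀ i, ¬ S.SingularAt P θ u i) ∧ P.L4 ≤ l1norm (S.gradL P.L2 θ u) ∧
    S.jacθ P.L2 θ u d = -S.gradL P.L2 θ u ∧
    IsLeast {l : ℕ | 1 ≤ l ∧ S.WolfeC P θ u d (P.η ^ l)} j ∧ θ' = θ + P.η ^ j • d

/-- One iteration of `SQP-Inner` on a fixed grid. -/
def InnerRel (S : TOProblem n m nE nI nR) (P : SolverParams) {D : Finset ℚ}
    (a b : (Traj n D × Controls m S.N) × ℝ) : Prop :=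
  ∃ (Hθ : Traj n D →L[ℝ] Traj n D) (Hu : Controls m S.N →L[ℝ] Controls m S.N)
    (d : Traj n D × Controls m S.N) (μ : Traj n D) (j : ℕ),
    (∀ i, ¬ S.SingularAt P a.1.1 a.1.2 i) ∧ HessianBound P.L5 Hθ ∧ HessianBound P.L5 Hu ∧
    S.QPSolution P.L2 a.1.1 a.1.2 Hθ Hu d.1 d.2 μ ∧
    ¬ S.Converged P (S.tol P) a.1.1 a.1.2 d.1 d.2 ∧
    b.2 = max a.2 ((⨆ i : D, ‖μ i‖) + P.L10) ∧
    IsLeast {l : ℕ | 1 ≤ l ∧ S.LineSearch P b.2 a.1.1 a.1.2 d.1 d.2 (P.η ^ l)} j ∧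
    b.1 = a.1 + P.η ^ j • d

theorem le_sigmaMin_of_not_singularAt {P : SolverParams} {D : Finset ℚ} {θ : Traj n D}
    {u : Controls m S.N} (h : ∀ i, ¬ S.SingularAt P θ u i) (i : D) :
    P.L3 ≤ sigmaMin (S.diagBlock P.L2 θ u i) := by
  by_contra hc
  exact h i ⟨i.2, not_le.1 hc⟩

theorem Lam_eq (L2 : ℝ) {D : Finset ℚ} (θ : Traj n D) (u : Controls m S.N) :
    S.Lam L2 θ u = ‖S.gradL L2 θ u‖ ^ 2 / 2 := by
  rw [Lam, ← Finset.sum_div, PiLp.norm_sq_eq_of_L2]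

/-- A failed convergence test keeps the predicted decrease away from zero by a margin that depends
on the parameters only. -/
theorem converged_gap {P : SolverParams} (hP : LoopParams P) : ∃ q : ℝ, 0 < q ∧
    ∀ {D : Finset ℚ} {θ : Traj n D} {u : Controls m S.N} {dθ : Traj n D} {du : Controls m S.N},
      ¬ S.Converged P (S.tol P) θ u dθ du →
      q ≤ 1 / P.L5 * stepNorm dθ du ^ 2 + P.L10 * l1norm (S.gradL P.L2 θ u) := by
  have ht : 0 < S.tol P := tol_pos hP.ε
  have h5 : 0 < P.L5 := by linarith [hP.L5]
  have h10 := hP.L10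
  refine ⟨min (1 / P.L5 * (S.tol P / P.L5) ^ 2) (P.L10 * S.tol P),
    lt_min (by positivity) (by positivity), ?_⟩
  intro D θ u dθ du h
  have hl := l1norm_nonneg (S.gradL P.L2 θ u)
  have hs : 0 ≤ 1 / P.L5 * stepNorm dθ du ^ 2 := by positivity
  by_cases h1 : stepNorm dθ du < S.tol P / P.L5
  · have h2 : S.tol P ≤ l1norm (S.gradL P.L2 θ u) := by
      by_contra h2; exact h ⟨h1, not_le.1 h2⟩
    refine (min_le_right _ _).trans ?_
    have := mul_le_mul_of_nonneg_left h2 h10.le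
    linarith
  · refine (min_le_left _ _).trans ?_
    have : 1 / P.L5 * (S.tol P / P.L5) ^ 2 ≤ 1 / P.L5 * stepNorm dθ du ^ 2 := by
      have := not_lt.1 h1
      gcongr
    have : 0 ≤ P.L10 * l1norm (S.gradL P.L2 θ u) := by positivity
    linarith

theorem exists_le_norm_of_le_l1norm {r : ℝ} (hr : 0 < r) (n : ℕ) (D : Finset ℚ) :
    ∃ r' > 0, ∀ c : Traj n D, r ≤ l1norm c → r' ≤ ‖c‖ := by
  refine ⟨r / ((D.card * n : ℕ) + 1), by positivity, fun c hc => ?_⟩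
  rw [div_le_iff₀ (by positivity)]
  have := l1norm_le_mul_norm c
  nlinarith [norm_nonneg c]

namespace Standing

variable {P : SolverParams} (hS : Standing S P.L2) (hP : LoopParams P)

include hS hP

/-! ### Progress -/

theorem exists_newton_step {D : Finset ℚ} (hD : IsGrid S.N D) {θ : Traj n D} {u : Controls m S.N}
    (hns : ∀ i, ¬ S.SingularAt P θ u i) (hl : P.L4 ≤ l1norm (S.gradL P.L2 θ u)) :
    ∃ (d : Traj n D) (j : ℕ), S.jacθ P.L2 θ u d = -S.gradL P.L2 θ u ∧
      IsLeast {l : ℕ | 1 ≤ l ∧ S.WolfeC P θ u d (P.η ^ l)} j := by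
  obtain ⟨C, -, hC⟩ := hS.exists_jacθ_bound hP.L3 hD
  have hC' := hC θ u (le_sigmaMin_of_not_singularAt hns)
  obtain ⟨d, hd⟩ := surjective_of_norm_le hC' (-S.gradL P.L2 θ u)
  obtain ⟨r, hr, hrc⟩ := exists_le_norm_of_le_l1norm hP.L4 n D
  obtain ⟨j, hj⟩ := exists_isLeast_backtracking (η := P.η) (Q := S.WolfeC P θ u d)
    (hS.eventually_wolfeC rfl hP.α (tendsto_const_nhds (x := θ)) (d := fun _ => d)
      (fun _ => le_rfl) (tendsto_pow_atTop_nhds_zero_of_lt_one hP.η.1.le hP.η.2)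
      (fun k => pow_pos hP.η.1 k) hr (fun _ => hrc _ hl) (fun _ => hd))
  exact ⟨d, j, hd, hj⟩

theorem exists_inner_step {D : Finset ℚ} {θ : Traj n D} {u : Controls m S.N}
    (hu : ∀ i, u i ∈ S.X) {Hθ : Traj n D →L[ℝ] Traj n D}
    {Hu : Controls m S.N →L[ℝ] Controls m S.N} (hHθ : HessianBound P.L5 Hθ)
    (hHu : HessianBound P.L5 Hu) {dθ : Traj n D} {du : Controls m S.N} {μ : Traj n D}
    (hQP : S.QPSolution P.L2 θ u Hθ Hu dθ du μ) (hc : ¬ S.Converged P (S.tol P) θ u dθ du)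
    (ρ : ℝ) :
    ∃ j, IsLeast {l : ℕ | 1 ≤ l ∧
      S.LineSearch P (max ρ ((⨆ i : D, ‖μ i‖) + P.L10)) θ u dθ du (P.η ^ l)} j := by
  obtain ⟨q, hq, hgap⟩ := converged_gap (S := S) hP
  have hsup : 0 ≤ ⨆ i : D, ‖μ i‖ := Real.iSup_nonneg fun i => norm_nonneg _
  have hρ : (⨆ i : D, ‖μ i‖) + P.L10 ≤ max ρ ((⨆ i : D, ‖μ i‖) + P.L10) := le_max_right _ _
  have hL10 := hP.L10
  refine exists_isLeast_backtracking (η := P.η) ?_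
  refine hS.eventually_lineSearch rfl hP.α hP.L4 (tendsto_const_nhds (x := (θ, u)))
    (d := fun _ => (dθ, du)) (ρ := fun _ => max ρ ((⨆ i : D, ‖μ i‖) + P.L10)) (fun _ => le_rfl)
    (tendsto_pow_atTop_nhds_zero_of_lt_one hP.η.1.le hP.η.2) (fun k => pow_pos hP.η.1 k)
    (fun _ => by linarith) (fun _ => le_rfl) hq (fun _ => hgap hc) (fun _ => hQP.1.2)
    (fun _ => ?_)
  refine (hS.qp_descent hu hHθ hHu hQP).trans ?_
  have := mul_le_mul_of_nonneg_right (le_sub_iff_add_le.2 hρ)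
    (l1norm_nonneg (S.gradL P.L2 θ u))
  linarith

/-! ### Termination on a fixed grid -/

/-- While the loop runs, `‖c‖ ≥ r`, so `Λ` drops by at least `α r² t`. Monotonicity of `Λ` bounds
the residual and hence the Newton directions; the iterates then converge with `t → 0`, contradicting
backtracking. -/
theorem newtonRel_acc {D : Finset ℚ} (hD : IsGrid S.N D) (u : Controls m S.N) (θ : Traj n D) :
    Acc (fun a b => S.NewtonRel P u b a) θ := by
  refine acc_of_not_exists_run ?_
  rintro ⟨x, -, hx⟩
  choose d j hns hl hd hj hstep using hx
  obtain ⟨C, hC0, hC⟩ := hS.exists_jacθ_bound hP.L3 hD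
  obtain ⟨r, hr, hrc⟩ := exists_le_norm_of_le_l1norm hP.L4 n D
  have hc : ∀ k, r ≤ ‖S.gradL P.L2 (x k) u‖ := fun k => hrc _ (hl k)
  have hη := hP.η.1
  have hα := hP.α.1
  have ht0 : ∀ k, 0 < P.η ^ j k := fun k => pow_pos hη _
  have hdec : ∀ k, S.Lam P.L2 (x (k + 1)) u ≤
      S.Lam P.L2 (x k) u - (P.α * r ^ 2) * P.η ^ j k := by
    intro k
    have h1 : S.WolfeC P (x k) u (d k) (P.η ^ j k) := (hj k).1.2
    unfold WolfeC at h1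
    rw [← hstep k] at h1
    have h2 : r ^ 2 / 2 ≤ S.Lam P.L2 (x k) u := by
      rw [Lam_eq]
      have := hc k
      gcongr
    have h3 := mul_le_mul_of_nonneg_left h2 (by have := ht0 k; positivity : 0 ≤ 2 * P.α * P.η ^ j k)
    linarith
  have hanti : Antitone fun k => S.Lam P.L2 (x k) u := by
    refine antitone_nat_of_succ_le fun k => (hdec k).trans ?_
    have := ht0 k
    have : 0 ≤ P.α * r ^ 2 * P.η ^ j k := by positivity
    linarith
  have hcle : ∀ k, ‖S.gradL P.L2 (x k) u‖ ≤ ‖S.gradL P.L2 (x 0) u‖ := by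
    intro k
    have := hanti (Nat.zero_le k)
    simp only [Lam_eq] at this
    exact le_of_sq_le_sq (by linarith) (norm_nonneg _)
  have hdle : ∀ k, ‖d k‖ ≤ C * ‖S.gradL P.L2 (x 0) u‖ := by
    intro k
    have := hC (x k) u (le_sigmaMin_of_not_singularAt (hns k)) (d k)
    rw [hd k, norm_neg] at this
    exact this.trans (mul_le_mul_of_nonneg_left (hcle k) hC0)
  obtain ⟨htend, x', hx'⟩ := tendsto_of_descent (x := x)
    (V := fun k => S.Lam P.L2 (x k) u) (m := P.α * r ^ 2) (v₀ := 0)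
    (C := C * ‖S.gradL P.L2 (x 0) u‖) (by positivity) (fun k => (ht0 k).le)
    (fun k => by rw [Lam_eq]; positivity) hdec
    (fun k => by
      rw [hstep k, add_sub_cancel_left, norm_smul, Real.norm_of_nonneg (ht0 k).le, mul_comm]
      exact mul_le_mul_of_nonneg_right (hdle k) (ht0 k).le)
  refine false_of_backtracking_tendsto_zero hP.η hj htend ?_
  exact hS.eventually_wolfeC rfl hP.α hx' hdle (by simpa using htend.div_const P.η)
    (fun k => div_pos (ht0 k) hη) hr hc hd

/-- Same scheme as for Newton, once residuals, steps and penalty coefficients are known to be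
bounded. Compactness of `X` bounds `du`, the linearized constraint then bounds `dθ` by the residual,
and stationarity bounds `μ`. -/
theorem innerRel_acc {D : Finset ℚ} (hD : IsGrid S.N D) (a : (Traj n D × Controls m S.N) × ℝ)
    (ha : ∀ i, a.1.2 i ∈ S.X) : Acc (fun a b => S.InnerRel P b a) a := by
  refine acc_of_not_exists_run ?_
  rintro ⟨run, h0, hrun⟩
  choose Hθ Hu d μ j hns hHθ hHu hQP hcv hρ hj hstep using hrun
  obtain ⟨C, hC0, hC⟩ := hS.exists_jacθ_bound hP.L3 hD
  obtain ⟨B, hB0, hB⟩ := hS.exists_jacu_bound hD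
  obtain ⟨K, hK0, hK⟩ := hS.exists_gradL_lipschitz hD
  obtain ⟨q, hq, hgap⟩ := converged_gap (S := S) hP
  obtain ⟨r, hr⟩ := hS.isCompact_X.isBounded.exists_norm_le
  obtain ⟨hO0, -, -, -, L1, hL1⟩ := hS.cost.1 D
  have hη := hP.η.1
  have hα := hP.α.1
  have hL5 : 0 < P.L5 := by linarith [hP.L5]
  have hL10 := hP.L10
  have hL4 := hP.L4
  have ht0 : ∀ k, 0 < P.η ^ j k := fun k => pow_pos hη _
  have ht1 : ∀ k, P.η ^ j k ≤ 1 := fun k => pow_le_one₀ hη.le hP.η.2.le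
  have hu : ∀ k i, (run k).1.2 i ∈ S.X := by
    intro k
    induction k with
    | zero => rw [h0]; exact ha
    | succ k ih =>
      intro i
      have h1 := (hQP k).1.1 i
      have h2 := hS.convex_X (ih i) h1 (a := 1 - P.η ^ j k) (b := P.η ^ j k)
        (by linarith [ht1 k]) (ht0 k).le (by ring)
      have e : (run (k + 1)).1.2 i = (run k).1.2 i + P.η ^ j k • (d k).2 i := by
        rw [hstep k]; rfl
      rw [e]
      convert h2 using 1
      module
  set c : ℕ → Traj n D := fun k => S.gradL P.L2 (run k).1.1 (run k).1.2 with hc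
  set R2 : ℝ := Fintype.card (Fin S.N) * (r + r) with hR2
  have hdu : ∀ k, ‖(d k).2‖ ≤ R2 := by
    intro k
    refine norm_le_card_mul _ fun i => ?_
    have : (d k).2 i = ((run k).1.2 i + (d k).2 i) - (run k).1.2 i := by abel
    rw [this]
    exact (norm_sub_le _ _).trans (add_le_add (hr _ ((hQP k).1.1 i)) (hr _ (hu k i)))
  have hR20 : 0 ≤ R2 := (norm_nonneg _).trans (hdu 0)
  have hdθ : ∀ k, ‖(d k).1‖ ≤ C * (l1norm (c k) + B * R2) := by
    intro k
    have h1 := hC _ _ (le_sigmaMin_of_not_singularAt (hns k)) (d k).1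
    refine h1.trans (mul_le_mul_of_nonneg_left ?_ hC0)
    have e : S.jacθ P.L2 (run k).1.1 (run k).1.2 (d k).1 =
        -(c k) - S.jacu P.L2 (run k).1.1 (run k).1.2 (d k).2 := by
      rw [← sub_eq_zero, ← (hQP k).1.2, hc]; abel
    rw [e]
    refine (norm_sub_le _ _).trans (add_le_add ?_ ?_)
    · rw [norm_neg]; exact norm_le_l1norm _
    · exact (hB _ _ (hu k) _).trans (mul_le_mul_of_nonneg_left (hdu k) hB0)
  set κ : ℝ := ((D.card * n : ℕ) : ℝ) with hκ
  have hκ0 : 0 ≤ κ := Nat.cast_nonneg _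
  -- Above `L4` the line search forbids an increase of the residual; from below `L4` one step can
  -- raise it by at most the second summand. Hence `Lm` bounds it throughout.
  set Lm : ℝ := max (l1norm (c 0)) (P.L4 + κ * (K * (C * (P.L4 + B * R2) + R2))) with hLm
  have hstepnorm : ∀ k, ‖(run (k + 1)).1.1 - (run k).1.1‖ = P.η ^ j k * ‖(d k).1‖ ∧
      ‖(run (k + 1)).1.2 - (run k).1.2‖ = P.η ^ j k * ‖(d k).2‖ := by
    intro k
    rw [hstep k]
    constructor
    · rw [Prod.fst_add, Prod.smul_fst, add_sub_cancel_left, norm_smul,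
        Real.norm_of_nonneg (ht0 k).le]
    · rw [Prod.snd_add, Prod.smul_snd, add_sub_cancel_left, norm_smul,
        Real.norm_of_nonneg (ht0 k).le]
  have hls : ∀ k, S.LineSearch P (run (k + 1)).2 (run k).1.1 (run k).1.2 (d k).1 (d k).2
      (P.η ^ j k) := fun k => (hj k).1.2
  have e1 : ∀ k, (run k).1.1 + P.η ^ j k • (d k).1 = (run (k + 1)).1.1 := fun k => by
    rw [hstep k]; rfl
  have e2 : ∀ k, (run k).1.2 + P.η ^ j k • (d k).2 = (run (k + 1)).1.2 := fun k => by
    rw [hstep k]; rfl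
  have hlm : ∀ k, l1norm (c k) ≤ Lm := by
    intro k
    induction k with
    | zero => exact le_max_left _ _
    | succ k ih =>
      by_cases hlt : P.L4 < l1norm (c k)
      · have := (hls k).2 hlt
        rw [e1, e2] at this
        exact this.trans ih
      · refine le_trans ?_ (le_max_right _ _)
        have hle := not_lt.1 hlt
        have g1 : ‖c (k + 1) - c k‖ ≤ K * (C * (P.L4 + B * R2) + R2) := by
          refine (hK _ _ _ _ (hu k) (hu (k + 1))).trans (mul_le_mul_of_nonneg_left ?_ hK0)
          rw [(hstepnorm k).1, (hstepnorm k).2]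
          refine add_le_add ?_ ?_
          · refine (mul_le_of_le_one_left (norm_nonneg _) (ht1 k)).trans ((hdθ k).trans ?_)
            gcongr
          · exact (mul_le_of_le_one_left (norm_nonneg _) (ht1 k)).trans (hdu k)
        have e : c (k + 1) = c k + (c (k + 1) - c k) := by abel
        rw [e]
        refine (l1norm_add_le _ _).trans (add_le_add hle ?_)
        exact (l1norm_le_mul_norm _).trans (mul_le_mul_of_nonneg_left g1 hκ0)
  have hLm0 : 0 ≤ Lm := (l1norm_nonneg _).trans (hlm 0)
  set R1 : ℝ := C * (Lm + B * R2) with hR1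
  have hdθ' : ∀ k, ‖(d k).1‖ ≤ R1 := fun k => (hdθ k).trans (by rw [hR1]; gcongr; exact hlm k)
  have hR10 : 0 ≤ R1 := (norm_nonneg _).trans (hdθ' 0)
  -- Stationarity in `θ` reads `A* μ = -(∂O + H dθ)`; invert the adjoint and use the bound `L1` on
  -- the gradient of the cost.
  have hμ : ∀ k, (⨆ i : D, ‖μ k i‖) ≤ C * (L1 + P.L5 * R1) := by
    intro k
    obtain ⟨μu, hst, -⟩ := (hQP k).2.2
    have g1 := norm_le_adjoint (hC _ _ (le_sigmaMin_of_not_singularAt (hns k))) (μ k)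
    have e : ContinuousLinearMap.adjoint (S.jacθ P.L2 (run k).1.1 (run k).1.2) (μ k) =
        -(gradient (fun θ' => S.O D θ' (run k).1.2) (run k).1.1 + Hθ k (d k).1) := by
      rw [← sub_eq_zero, ← hst]; abel
    rw [e, norm_neg] at g1
    have g2 : ‖gradient (fun θ' => S.O D θ' (run k).1.2) (run k).1.1 + Hθ k (d k).1‖ ≤
        L1 + P.L5 * R1 := by
      refine (norm_add_le _ _).trans (add_le_add ?_ ?_)
      · have := hL1 (run k).1.1 (run k).1.2 (hu k)
        linarith [norm_nonneg (gradient (fun u' => S.O D (run k).1.1 u') (run k).1.2)]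
      · exact ((hHθ k).norm_apply_le hL5 _).trans (mul_le_mul_of_nonneg_left (hdθ' k) hL5.le)
    have g3 := g1.trans (mul_le_mul_of_nonneg_left g2 hC0)
    refine Real.iSup_le (fun i => (PiLp.norm_apply_le (μ k) i).trans g3) ?_
    exact (norm_nonneg _).trans g3
  set ρm : ℝ := max (run 0).2 (C * (L1 + P.L5 * R1) + P.L10) with hρm
  have hρle : ∀ k, (run k).2 ≤ ρm := by
    intro k
    induction k with
    | zero => exact le_max_left _ _
    | succ k ih =>
      rw [hρ k]
      refine max_le ih (le_trans ?_ (le_max_right _ _))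
      linarith [hμ k]
  have hsup0 : ∀ k, 0 ≤ ⨆ i : D, ‖μ k i‖ := fun k => Real.iSup_nonneg fun i => norm_nonneg _
  have hρ1 : ∀ k, (⨆ i : D, ‖μ k i‖) + P.L10 ≤ (run (k + 1)).2 := fun k => by
    rw [hρ k]; exact le_max_right _ _
  have hρ2 : ∀ k, (run k).2 ≤ (run (k + 1)).2 := fun k => by
    rw [hρ k]; exact le_max_left _ _
  have hρm0 : 0 ≤ ρm := by linarith [hρle 1, hρ1 0, hsup0 0]
  have hqk : ∀ k, q ≤ 1 / P.L5 * stepNorm (d k).1 (d k).2 ^ 2 + P.L10 * l1norm (c k) :=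
    fun k => hgap (hcv k)
  -- The merit function is shifted by `-ρ * Lm`: the factor of `ρ` becomes nonpositive, so an
  -- increase of `ρ` can only lower the potential.
  obtain ⟨htend, x', hx'⟩ := tendsto_of_descent (x := fun k => (run k).1)
    (V := fun k => S.O D (run k).1.1 (run k).1.2 + (run k).2 * (l1norm (c k) - Lm))
    (t := fun k => P.η ^ j k) (m := P.α * q) (v₀ := -(ρm * Lm)) (C := R1 + R2) (by positivity)
    (fun k => (ht0 k).le)
    (fun k => by
      have a1 := hO0 (run k).1.1 (run k).1.2 (hu k)
      have a2 : ρm * (l1norm (c k) - Lm) ≤ (run k).2 * (l1norm (c k) - Lm) :=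
        mul_le_mul_of_nonpos_right (hρle k) (by linarith [hlm k])
      have a3 : 0 ≤ ρm * l1norm (c k) := mul_nonneg hρm0 (l1norm_nonneg _)
      linarith)
    (fun k => by
      have a1 := (hls k).1
      unfold merit at a1
      rw [e1, e2] at a1
      have a2 : (run (k + 1)).2 * (l1norm (c k) - Lm) ≤ (run k).2 * (l1norm (c k) - Lm) :=
        mul_le_mul_of_nonpos_right (hρ2 k) (by linarith [hlm k])
      have a3 := mul_le_mul_of_nonneg_left (hqk k) (mul_pos hα (ht0 k)).le
      simp only [hc] at a2 a3 ⊢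
      linarith)
    (fun k => by
      have a : (run (k + 1)).1 - (run k).1 = P.η ^ j k • d k := by
        rw [hstep k, add_sub_cancel_left]
      rw [a, norm_smul, Real.norm_of_nonneg (ht0 k).le, mul_comm]
      refine mul_le_mul_of_nonneg_right ?_ (ht0 k).le
      exact max_le (by linarith [hdθ' k]) (by linarith [hdu k]))
  refine false_of_backtracking_tendsto_zero hP.η hj htend ?_
  refine hS.eventually_lineSearch rfl hP.α hP.L4 hx' (C := R1 + R2)
    (fun k => max_le (by linarith [hdθ' k]) (by linarith [hdu k]))
    (by simpa using htend.div_const P.η) (fun k => div_pos (ht0 k) hη)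
    (fun k => by linarith [hρ1 k, hsup0 k]) (fun k => hρle (k + 1)) hq hqk
    (fun k => (hQP k).1.2) (fun k => ?_)
  refine (hS.qp_descent (hu k) (hHθ k) (hHu k) (hQP k)).trans ?_
  have := mul_le_mul_of_nonneg_right (le_sub_iff_add_le.2 (hρ1 k)) (l1norm_nonneg (c k))
  simp only [hc] at this ⊢
  linarith

end Standing
end TOProblem

/-! ### Lipschitz bounds of the control energies -/

/-- The two square differences agree, and the roots have the larger sum. -/
theorem abs_sqrt_sq_add_sub_le {a b e : ℝ} (ha : 0 ≤ a) (hb : 0 ≤ b) (he : 0 < e) :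
    |√(a ^ 2 + e) - √(b ^ 2 + e)| ≤ |a - b| := by
  have hx : a ≤ √(a ^ 2 + e) := Real.le_sqrt_of_sq_le (by linarith)
  have hy : b ≤ √(b ^ 2 + e) := Real.le_sqrt_of_sq_le (by linarith)
  have hx2 : √(a ^ 2 + e) ^ 2 = a ^ 2 + e := Real.sq_sqrt (by positivity)
  have hy2 : √(b ^ 2 + e) ^ 2 = b ^ 2 + e := Real.sq_sqrt (by positivity)
  have hxp : 0 < √(a ^ 2 + e) := Real.sqrt_pos.2 (by positivity)
  have hyp : 0 < √(b ^ 2 + e) := Real.sqrt_pos.2 (by positivity)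
  set x := √(a ^ 2 + e)
  set y := √(b ^ 2 + e)
  have h1 : |x - y| * (x + y) = |a - b| * (a + b) := by
    rw [← abs_of_pos (by linarith : 0 < x + y), ← abs_of_nonneg (by linarith : 0 ≤ a + b),
      ← abs_mul, ← abs_mul]
    congr 1
    nlinarith
  have h2 : |x - y| * (x + y) ≤ |a - b| * (x + y) := by
    rw [h1]; gcongr
  exact le_of_mul_le_mul_right h2 (by linarith)

section Normalize

variable {E : Type*} [NormedAddCommGroup E] [NormedSpace ℝ E]

/-- Regularized normalization. -/
def regNormalize (e : ℝ) (x : E) : E := (√(‖x‖ ^ 2 + e))⁻¹ • x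

theorem norm_regNormalize_le {e : ℝ} (he : 0 < e) (x : E) : ‖regNormalize e x‖ ≤ 1 := by
  have hp : 0 < √(‖x‖ ^ 2 + e) := Real.sqrt_pos.2 (by positivity)
  rw [regNormalize, norm_smul, norm_inv, Real.norm_of_nonneg hp.le, inv_mul_le_iff₀ hp, mul_one]
  exact Real.le_sqrt_of_sq_le (by linarith)

/-- The difference splits into `p⁻¹ (x - y)` and the change of the normalizing factor, each at most
`‖x - y‖ / √e`. The two arguments of the PD pairing then account for `4 / √e`. -/
theorem norm_regNormalize_sub_le {e : ℝ} (he : 0 < e) (x y : E) :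
    ‖regNormalize e x - regNormalize e y‖ ≤ 2 / √e * ‖x - y‖ := by
  have hp : 0 < √(‖x‖ ^ 2 + e) := Real.sqrt_pos.2 (by positivity)
  have hq : 0 < √(‖y‖ ^ 2 + e) := Real.sqrt_pos.2 (by positivity)
  have hse : 0 < √e := Real.sqrt_pos.2 he
  have hpe : √e ≤ √(‖x‖ ^ 2 + e) := Real.sqrt_le_sqrt (by nlinarith [sq_nonneg ‖x‖])
  have hlip := abs_sqrt_sq_add_sub_le (norm_nonneg x) (norm_nonneg y) he
  have hyn := norm_regNormalize_le he y
  unfold regNormalize at hyn ⊢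
  set p := √(‖x‖ ^ 2 + e)
  set q := √(‖y‖ ^ 2 + e)
  have e1 : p⁻¹ • x - q⁻¹ • y = p⁻¹ • (x - y) + (p⁻¹ * (q - p)) • (q⁻¹ • y) := by
    rw [smul_smul, show p⁻¹ * (q - p) * q⁻¹ = p⁻¹ - q⁻¹ by field_simp]
    module
  rw [e1]
  refine (norm_add_le _ _).trans ?_
  rw [norm_smul, norm_smul, norm_inv, norm_mul, norm_inv, Real.norm_of_nonneg hp.le,
    Real.norm_eq_abs]
  have h1 : |q - p| ≤ ‖x - y‖ := by
    rw [abs_sub_comm]; exact hlip.trans (abs_norm_sub_norm_le x y)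
  have h2 : p⁻¹ ≤ (√e)⁻¹ := inv_anti₀ hse hpe
  calc p⁻¹ * ‖x - y‖ + p⁻¹ * |q - p| * ‖q⁻¹ • y‖
      ≤ (√e)⁻¹ * ‖x - y‖ + (√e)⁻¹ * ‖x - y‖ * 1 := by gcongr
    _ = 2 / √e * ‖x - y‖ := by ring

end Normalize

/-- The nine coordinates of a matrix stored in a configuration. -/
def subVec {n : ℕ} (e : Fin 3 × Fin 3 ↪ Fin n) (θ : Config n) :
    EuclideanSpace ℝ (Fin 3 × Fin 3) := WithLp.toLp 2 fun p => θ (e p)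

theorem norm_subVec_sub_le {n : ℕ} (e : Fin 3 × Fin 3 ↪ Fin n) (θ θ' : Config n) :
    ‖subVec e θ - subVec e θ'‖ ≤ ‖θ - θ'‖ := by
  rw [EuclideanSpace.norm_eq, EuclideanSpace.norm_eq]
  refine Real.sqrt_le_sqrt ?_
  have := Finset.sum_map Finset.univ e fun a => ‖(θ - θ') a‖ ^ 2
  calc ∑ p, ‖(subVec e θ - subVec e θ') p‖ ^ 2
      = ∑ a ∈ Finset.univ.map e, ‖(θ - θ') a‖ ^ 2 := this.symm
    _ ≤ ∑ a, ‖(θ - θ') a‖ ^ 2 :=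
        Finset.sum_le_sum_of_subset_of_nonneg (Finset.subset_univ _) fun _ _ _ => by positivity

theorem frob_subMatrix {n : ℕ} (e : Fin 3 × Fin 3 ↪ Fin n) (θ : Config n) :
    frob (subMatrix e θ) = ‖subVec e θ‖ := by
  rw [EuclideanSpace.norm_eq, frob, Fintype.sum_prod_type]
  simp [subVec, subMatrix]

/-- Right multiplication by the transpose of a rotation about the X-axis. -/
def mulRotX (t : ℝ) : EuclideanSpace ℝ (Fin 3 × Fin 3) →ₗ[ℝ] EuclideanSpace ℝ (Fin 3 × Fin 3) where
  toFun x := WithLp.toLp 2 fun p => ∑ k, x (p.1, k) * rotX t p.2 k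
  map_add' x y := by ext p; simp [add_mul, Finset.sum_add_distrib]
  map_smul' r x := by ext p; simp [Finset.mul_sum, mul_assoc]

theorem norm_mulRotX (t : ℝ) (x : EuclideanSpace ℝ (Fin 3 × Fin 3)) : ‖mulRotX t x‖ = ‖x‖ := by
  rw [EuclideanSpace.norm_eq, EuclideanSpace.norm_eq]
  congr 1
  simp only [Fintype.sum_prod_type, mulRotX, LinearMap.coe_mk, AddHom.coe_mk, Real.norm_eq_abs,
    sq_abs]
  refine Finset.sum_congr rfl fun a _ => ?_
  simp only [Fin.sum_univ_three, rotX]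
  simp
  have := Real.sin_sq_add_cos_sq t
  linear_combination (x (a, 1) ^ 2 + x (a, 2) ^ 2) * this

theorem trace_eq_inner_mulRotX {n : ℕ} (ea eb : Fin 3 × Fin 3 ↪ Fin n) (θ : Config n) (t : ℝ) :
    ((subMatrix ea θ).transpose * subMatrix eb θ * (rotX t).transpose).trace =
      inner ℝ (subVec ea θ) (mulRotX t (subVec eb θ)) := by
  rw [Matrix.mul_assoc, Matrix.trace, PiLp.inner_apply, Fintype.sum_prod_type, Finset.sum_comm]
  refine Finset.sum_congr rfl fun b _ => ?_
  simp only [Matrix.diag_apply, Matrix.mul_apply (M := (subMatrix ea θ).transpose),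
    Matrix.transpose_apply]
  refine Finset.sum_congr rfl fun a _ => ?_
  simp only [Matrix.mul_apply, Matrix.transpose_apply, mulRotX, subVec, subMatrix, Matrix.of_apply,
    LinearMap.coe_mk, AddHom.coe_mk]
  simp [mul_comm]

/-- This makes `k` a bound on the control force for all controls in `X`. PD energies pair two
vectors of norm at most one through an isometry, each `2 / √er`-Lipschitz in `θ`. A point of `X` is
needed to know `L15 ≥ 0`. -/
theorem ControlConstant.lipschitz {n m : ℕ} {X : Set (Control m)} (hX : X.Nonempty)
    {b : Config n → Control m → ℝ} {k : ℝ} (h : ControlConstant X b k) :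
    0 ≤ k ∧ ∀ u ∈ X, ∀ θ θ', |b θ u - b θ' u| ≤ k * ‖θ - θ'‖ := by
  obtain ⟨u₀, hu₀⟩ := hX
  induction h with
  | force J L15 hL =>
    have h0 : 0 ≤ L15 := (norm_nonneg _).trans (hL u₀ hu₀)
    refine ⟨by positivity, fun u hu θ θ' => ?_⟩
    have e : -inner ℝ θ (J u) - -inner ℝ θ' (J u) = -inner ℝ (θ - θ') (J u) := by
      rw [inner_sub_left]; ring
    rw [e, abs_neg]
    refine (abs_real_inner_le_norm _ _).trans ?_
    rw [mul_comm]
    refine mul_le_mul_of_nonneg_right ?_ (norm_nonneg _)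
    exact (J.le_opNorm u).trans (mul_le_mul_of_nonneg_left (hL u hu) (norm_nonneg _))
  | cable Xa Xb ta tb er her c hc L15 hL =>
    have h0 : 0 ≤ L15 := (abs_nonneg _).trans (hL u₀ hu₀)
    refine ⟨by positivity, fun u hu θ θ' => ?_⟩
    rw [← mul_sub, abs_mul]
    have h1 := abs_sqrt_sq_add_sub_le (norm_nonneg ((Xa θ + ta) - (Xb θ + tb)))
      (norm_nonneg ((Xa θ' + ta) - (Xb θ' + tb))) her
    have h2 : |‖(Xa θ + ta) - (Xb θ + tb)‖ - ‖(Xa θ' + ta) - (Xb θ' + tb)‖| ≤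
        ‖Xa - Xb‖ * ‖θ - θ'‖ := by
      refine (abs_norm_sub_norm_le _ _).trans ?_
      have e : (Xa θ + ta) - (Xb θ + tb) - ((Xa θ' + ta) - (Xb θ' + tb)) =
          (Xa - Xb) (θ - θ') := by
        simp only [sub_apply, map_sub]; abel
      rw [e]
      exact (Xa - Xb).le_opNorm _
    calc |u c| * _ ≤ L15 * (‖Xa - Xb‖ * ‖θ - θ'‖) := by
          gcongr
          · exact hL u hu
          · exact h1.trans h2
      _ = _ := by ring
  | pd ea eb er her c =>
    refine ⟨by positivity, fun u hu θ θ' => ?_⟩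
    have e : ∀ θ : Config n,
        -(((subMatrix ea θ).transpose * subMatrix eb θ * (rotX (u c)).transpose).trace /
            (√(frob (subMatrix ea θ) ^ 2 + er) * √(frob (subMatrix eb θ) ^ 2 + er))) =
        -inner ℝ (regNormalize er (subVec ea θ))
          (mulRotX (u c) (regNormalize er (subVec eb θ))) := by
      intro θ
      rw [trace_eq_inner_mulRotX, frob_subMatrix, frob_subMatrix, regNormalize, regNormalize,
        map_smul, real_inner_smul_left, real_inner_smul_right]
      field_simp
    beta_reduce
    rw [e, e]
    set a := regNormalize er (subVec ea θ)
    set a' := regNormalize er (subVec ea θ')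
    set v := regNormalize er (subVec eb θ)
    set v' := regNormalize er (subVec eb θ')
    have e2 : -inner ℝ a (mulRotX (u c) v) - -inner ℝ a' (mulRotX (u c) v') =
        -(inner ℝ (a - a') (mulRotX (u c) v) + inner ℝ a' (mulRotX (u c) (v - v'))) := by
      rw [map_sub, inner_sub_left, inner_sub_right]; ring
    rw [e2, abs_neg]
    have hse : 0 < √er := Real.sqrt_pos.2 her
    have g1 : |inner ℝ (a - a') (mulRotX (u c) v)| ≤ 2 / √er * ‖θ - θ'‖ := by
      refine (abs_real_inner_le_norm _ _).trans ?_
      rw [norm_mulRotX]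
      calc ‖a - a'‖ * ‖v‖ ≤ ‖a - a'‖ * 1 := by
            gcongr; exact norm_regNormalize_le her _
        _ ≤ 2 / √er * ‖subVec ea θ - subVec ea θ'‖ := by
            rw [mul_one]; exact norm_regNormalize_sub_le her _ _
        _ ≤ _ := by gcongr; exact norm_subVec_sub_le ea θ θ'
    have g2 : |inner ℝ a' (mulRotX (u c) (v - v'))| ≤ 2 / √er * ‖θ - θ'‖ := by
      refine (abs_real_inner_le_norm _ _).trans ?_
      rw [norm_mulRotX]
      calc ‖a'‖ * ‖v - v'‖ ≤ 1 * ‖v - v'‖ := by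
            gcongr; exact norm_regNormalize_le her _
        _ ≤ 2 / √er * ‖subVec eb θ - subVec eb θ'‖ := by
            rw [one_mul]; exact norm_regNormalize_sub_le her _ _
        _ ≤ _ := by gcongr; exact norm_subVec_sub_le eb θ θ'
    refine (abs_add_le _ _).trans ((add_le_add g1 g2).trans (le_of_eq ?_))
    ring
  | add b₁ b₂ k₁ k₂ _ _ ih₁ ih₂ =>
    refine ⟨add_nonneg ih₁.1 ih₂.1, fun u hu θ θ' => ?_⟩
    have e : b₁ θ u + b₂ θ u - (b₁ θ' u + b₂ θ' u) =
      (b₁ θ u - b₁ θ' u) + (b₂ θ u - b₂ θ' u) := by ring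
    rw [e, add_mul]
    exact (abs_add_le _ _).trans (add_le_add (ih₁.2 u hu θ θ') (ih₂.2 u hu θ θ'))

/-! ### Determinants of nearly orthogonal matrices -/

/-- Here `x` stands for the eigenvalues of `RᵀR - 1` and `f` for its Frobenius norm. With `y = |x|`,
AM-GM bounds `Q = ∏ (1 + y)`, giving the upper bound. For the lower one, `∏ (1 - y) * Q = ∏ (1 - y²)
≥ 1 - f²` while `(1 - f) Q ≤ 1 + f`. -/
theorem prod_one_add_bounds {x : Fin 3 → ℝ} {f : ℝ} (hf0 : 0 ≤ f) (hf1 : f < 1)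
    (h : ∑ k, x k ^ 2 = f ^ 2) :
    (1 - f) ^ 2 ≤ ∏ k, (1 + x k) ∧ ∏ k, (1 + x k) ≤ (1 + f) ^ 2 := by
  have hx : ∀ k, |x k| ≤ f := fun k => by
    refine abs_le_of_sq_le_sq ?_ hf0
    rw [← h]
    exact Finset.single_le_sum (f := fun k => x k ^ 2) (fun _ _ => sq_nonneg _) (Finset.mem_univ k)
  set y : Fin 3 → ℝ := fun k => |x k| with hy
  have hy0 : ∀ k, 0 ≤ y k := fun k => abs_nonneg _
  have hyf : ∀ k, y k ≤ f := hx
  have hsum : y 0 ^ 2 + y 1 ^ 2 + y 2 ^ 2 = f ^ 2 := by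
    rw [Fin.sum_univ_three] at h
    simp only [hy, sq_abs]; exact h
  set p := (y 0 + y 1 + y 2) / 3 with hp
  have hp0 : 0 ≤ p := by have := hy0 0; have := hy0 1; have := hy0 2; positivity
  have hp2 : 3 * p ^ 2 ≤ f ^ 2 := by
    rw [← hsum, hp]
    nlinarith [sq_nonneg (y 0 - y 1), sq_nonneg (y 1 - y 2), sq_nonneg (y 0 - y 2)]
  -- A rational bound for `1 / √3`; the later constants `1.734` and `0.2` derive from it.
  have hpf : p ≤ 0.578 * f := by
    refine le_of_sq_le_sq ?_ (by positivity)
    nlinarith [sq_nonneg f]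
  have hamgm : (1 + y 0) * (1 + y 1) * (1 + y 2) ≤ (1 + p) ^ 3 := by
    have h0 := hy0 0
    have h1 := hy0 1
    have h2 := hy0 2
    have e : 1 + p = ((1 + y 0) + (1 + y 1) + (1 + y 2)) / 3 := by rw [hp]; ring
    rw [e]
    nlinarith [mul_nonneg (by linarith : 0 ≤ 1 + y 0) (sq_nonneg (y 1 - y 2)),
      mul_nonneg (by linarith : 0 ≤ 1 + y 1) (sq_nonneg (y 0 - y 2)),
      mul_nonneg (by linarith : 0 ≤ 1 + y 2) (sq_nonneg (y 0 - y 1)),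
      mul_nonneg (by linarith : 0 ≤ (1 + y 0) + (1 + y 1) + (1 + y 2)) (sq_nonneg (y 1 - y 2)),
      mul_nonneg (by linarith : 0 ≤ (1 + y 0) + (1 + y 1) + (1 + y 2)) (sq_nonneg (y 0 - y 2)),
      mul_nonneg (by linarith : 0 ≤ (1 + y 0) + (1 + y 1) + (1 + y 2)) (sq_nonneg (y 0 - y 1))]
  have hcube : (1 + p) ^ 3 ≤ 1 + 1.734 * f + f ^ 2 + 0.2 * f ^ 3 := by
    have : p ^ 3 ≤ 0.2 * f ^ 3 := by
      have : p ^ 2 * p ≤ (f ^ 2 / 3) * (0.578 * f) :=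
        mul_le_mul (by linarith) hpf hp0 (by positivity)
      have h3 : 0 ≤ f ^ 3 := by positivity
      nlinarith
    nlinarith
  have hf3 : f ^ 3 ≤ f ^ 2 := by nlinarith [sq_nonneg f]
  have hf2 : f ^ 2 ≤ f := by nlinarith
  constructor
  · have h1 : (1 - y 0) * (1 - y 1) * (1 - y 2) ≤ ∏ k, (1 + x k) := by
      rw [Fin.prod_univ_three]
      have g : ∀ k, 1 - y k ≤ 1 + x k := fun k => by
        have := neg_abs_le (x k); simp only [hy]; linarith
      have g0 : ∀ k, 0 ≤ 1 - y k := fun k => by linarith [hyf k]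
      have g1 : ∀ k, 0 ≤ 1 + x k := fun k => (g0 k).trans (g k)
      exact mul_le_mul (mul_le_mul (g 0) (g 1) (g0 1) (g1 0)) (g 2) (g0 2)
        (mul_nonneg (g1 0) (g1 1))
    refine le_trans ?_ h1
    set Q := (1 + y 0) * (1 + y 1) * (1 + y 2) with hQ
    have hQ1 : 0 < Q := by have := hy0 0; have := hy0 1; have := hy0 2; positivity
    have h2 : 1 - f ^ 2 ≤ (1 - y 0) * (1 - y 1) * (1 - y 2) * Q := by
      have e : (1 - y 0) * (1 - y 1) * (1 - y 2) * Q =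
        (1 - y 0 ^ 2) * (1 - y 1 ^ 2) * (1 - y 2 ^ 2) := by rw [hQ]; ring
      rw [e, ← hsum]
      have a0 : y 0 ^ 2 ≤ 1 := by nlinarith [hy0 0, hyf 0]
      have a1 : y 1 ^ 2 ≤ 1 := by nlinarith [hy0 1, hyf 1]
      have a2 : y 2 ^ 2 ≤ 1 := by nlinarith [hy0 2, hyf 2]
      have b0 := sq_nonneg (y 0)
      have b1 := sq_nonneg (y 1)
      have b2 := sq_nonneg (y 2)
      have c1 := mul_nonneg b0 b1
      have c2 := mul_nonneg (add_nonneg b0 b1) b2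
      have c3 : y 0 ^ 2 * y 1 ^ 2 * y 2 ^ 2 ≤ y 0 ^ 2 * y 1 ^ 2 :=
        mul_le_of_le_one_right c1 a2
      nlinarith
    have h3 : (1 - f) * Q ≤ 1 + f := by
      have : (1 - f) * Q ≤ (1 - f) * (1 + 1.734 * f + f ^ 2 + 0.2 * f ^ 3) :=
        mul_le_mul_of_nonneg_left (hamgm.trans hcube) (by linarith)
      have h4 : 0 ≤ f ^ 4 := by positivity
      have h3' : 0 ≤ f ^ 3 := by positivity
      nlinarith
    have h4 : (1 - f) ^ 2 * Q ≤ (1 - y 0) * (1 - y 1) * (1 - y 2) * Q := by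
      have := mul_le_mul_of_nonneg_left h3 (by linarith : 0 ≤ 1 - f)
      nlinarith
    exact le_of_mul_le_mul_right h4 hQ1
  · have h1 : ∏ k, (1 + x k) ≤ (1 + y 0) * (1 + y 1) * (1 + y 2) := by
      rw [Fin.prod_univ_three]
      have g : ∀ k, 1 + x k ≤ 1 + y k := fun k => by
        have := le_abs_self (x k); simp only [hy]; linarith
      have g0 : ∀ k, 0 ≤ 1 + x k := fun k => by
        have := neg_abs_le (x k); have := hx k; linarith
      have := g 0; have := g 1; have := g 2
      have := g0 0; have := g0 1; have := g0 2
      have := hy0 0; have := hy0 1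
      gcongr
    nlinarith

theorem frob_sq (A : Matrix (Fin 3) (Fin 3) ℝ) : frob A ^ 2 = (A.transpose * A).trace := by
  rw [frob, Real.sq_sqrt (by positivity), Matrix.trace, Finset.sum_comm]
  simp [Matrix.mul_apply, sq]

theorem frob_nonneg (A : Matrix (Fin 3) (Fin 3) ℝ) : 0 ≤ frob A := Real.sqrt_nonneg _

/-- Diagonalizing `RᵀR - 1` turns `det R ^ 2` into `∏ (1 + λ)` and the squared Frobenius norm into
`∑ λ²`. -/
theorem det_sq_bounds {R : Matrix (Fin 3) (Fin 3) ℝ} (h : frob (R.transpose * R - 1) < 1) :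
    (1 - frob (R.transpose * R - 1)) ^ 2 ≤ R.det ^ 2 ∧
      R.det ^ 2 ≤ (1 + frob (R.transpose * R - 1)) ^ 2 := by
  set A := R.transpose * R - 1 with hA
  have hAt : A.transpose = A := by simp [hA]
  have hH : A.IsHermitian := by
    rw [Matrix.IsHermitian, Matrix.conjTranspose_eq_transpose_of_trivial]; exact hAt
  set U := hH.eigenvectorUnitary
  set Λ : Matrix (Fin 3) (Fin 3) ℝ := Matrix.diagonal hH.eigenvalues
  have hspec : A = (U : Matrix (Fin 3) (Fin 3) ℝ) * Λ * star (U : Matrix (Fin 3) (Fin 3) ℝ) := by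
    have := hH.spectral_theorem
    rw [Unitary.conjStarAlgAut_apply] at this
    exact this
  have hU1 : star (U : Matrix (Fin 3) (Fin 3) ℝ) * U = 1 := Unitary.coe_star_mul_self U
  have hU2 : (U : Matrix (Fin 3) (Fin 3) ℝ) * star (U : Matrix (Fin 3) (Fin 3) ℝ) = 1 :=
    Unitary.coe_mul_star_self U
  have hsum : ∑ k, hH.eigenvalues k ^ 2 = frob A ^ 2 := by
    rw [frob_sq, hAt]
    have e : A * A = (U : Matrix (Fin 3) (Fin 3) ℝ) * ((Λ * Λ) *
        star (U : Matrix (Fin 3) (Fin 3) ℝ)) := by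
      conv_lhs => rw [hspec]
      calc (U : Matrix (Fin 3) (Fin 3) ℝ) * Λ * star (U : Matrix (Fin 3) (Fin 3) ℝ) *
            ((U : Matrix (Fin 3) (Fin 3) ℝ) * Λ * star (U : Matrix (Fin 3) (Fin 3) ℝ))
          = (U : Matrix (Fin 3) (Fin 3) ℝ) * Λ * (star (U : Matrix (Fin 3) (Fin 3) ℝ) *
            (U : Matrix (Fin 3) (Fin 3) ℝ)) * Λ * star (U : Matrix (Fin 3) (Fin 3) ℝ) := by
              simp only [Matrix.mul_assoc]
        _ = _ := by rw [hU1]; simp only [Matrix.mul_assoc, Matrix.mul_one]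
    rw [e, Matrix.trace_mul_comm, Matrix.mul_assoc, hU1, Matrix.mul_one]
    simp [Λ, Matrix.diagonal_mul_diagonal, Matrix.trace, sq]
  have hdet : R.det ^ 2 = ∏ k, (1 + hH.eigenvalues k) := by
    have e1 : R.det ^ 2 = (1 + A).det := by
      have : 1 + A = R.transpose * R := by rw [hA]; abel
      rw [this, Matrix.det_mul, Matrix.det_transpose, sq]
    have e2 : 1 + A = (U : Matrix (Fin 3) (Fin 3) ℝ) * (1 + Λ) *
        star (U : Matrix (Fin 3) (Fin 3) ℝ) := by
      rw [Matrix.mul_add, Matrix.add_mul, Matrix.mul_one, hU2, ← hspec]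
    rw [e1, e2, Matrix.det_mul_comm, ← Matrix.mul_assoc, hU1, Matrix.one_mul]
    have e3 : (1 + Λ) = Matrix.diagonal fun k => 1 + hH.eigenvalues k := by
      rw [← Matrix.diagonal_one, Matrix.diagonal_add]
    rw [e3, Matrix.det_diagonal]
  rw [hdet]
  exact prod_one_add_bounds (frob_nonneg _) h hsum

theorem abs_det_sub_one_lt {R : Matrix (Fin 3) (Fin 3) ℝ} {ε : ℝ} (hε : ε < 1)
    (h : frob (R.transpose * R - 1) < ε) (hdet : 0 < R.det) : |R.det - 1| < ε := by
  obtain ⟨h1, h2⟩ := det_sq_bounds (h.trans hε)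
  have h0 := frob_nonneg (R.transpose * R - 1)
  set f := frob (R.transpose * R - 1)
  have g1 : 1 - f ≤ R.det := le_of_sq_le_sq h1 hdet.le
  have g2 : R.det ≤ 1 + f := le_of_sq_le_sq h2 (by linarith)
  rw [abs_lt]
  constructor <;> linarith

theorem abs_apply_le_of_frob_lt {R : Matrix (Fin 3) (Fin 3) ℝ}
    (h : frob (R.transpose * R - 1) < 1) (a b : Fin 3) : |R a b| ≤ 2 := by
  have h1 : |(R.transpose * R - 1) b b| ≤ frob (R.transpose * R - 1) := by
    refine Real.abs_le_sqrt ?_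
    refine le_trans ?_ (Finset.single_le_sum (f := fun a => ∑ c, (R.transpose * R - 1) a c ^ 2)
      (fun _ _ => by positivity) (Finset.mem_univ b))
    exact Finset.single_le_sum (f := fun c => (R.transpose * R - 1) b c ^ 2)
      (fun _ _ => by positivity) (Finset.mem_univ b)
  have h2 : R a b ^ 2 ≤ (R.transpose * R) b b := by
    rw [Matrix.mul_apply]
    refine le_trans (le_of_eq ?_) (Finset.single_le_sum
      (f := fun j => R.transpose b j * R j b) (fun j _ => ?_) (Finset.mem_univ a))
    · simp [sq]
    · simpa using mul_self_nonneg (R j b)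
  have h3 := (abs_le.1 (h1.trans h.le)).2
  rw [Matrix.sub_apply, Matrix.one_apply_eq] at h3
  refine abs_le_of_sq_le_sq ?_ (by norm_num)
  linarith

/-- Nearly orthogonal matrices have bounded entries, so `det` is uniformly continuous on them, and
`|det| > 1 - ε`; a change of sign would be a jump larger than `1 - ε`. -/
theorem exists_sign_det_eq {ε : ℝ} (hε : ε < 1) : ∃ r > 0, ∀ A B : Matrix (Fin 3) (Fin 3) ℝ,
    frob (A.transpose * A - 1) < ε → frob (B.transpose * B - 1) < ε →
    (∀ a b, |A a b - B a b| ≤ r) → SignType.sign A.det = SignType.sign B.det := by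
  have hcont : Continuous fun A : Fin 3 → Fin 3 → ℝ => (Matrix.of A).det :=
    Continuous.matrix_det (continuous_id (X := Fin 3 → Fin 3 → ℝ))
  have huc := (isCompact_closedBall (0 : Fin 3 → Fin 3 → ℝ) 2).uniformContinuousOn_of_continuous
    hcont.continuousOn
  rw [Metric.uniformContinuousOn_iff] at huc
  obtain ⟨r, hr, h⟩ := huc (1 - ε) (by linarith)
  refine ⟨r / 2, by positivity, fun A B hA hB hAB => ?_⟩
  have hmem : ∀ A : Matrix (Fin 3) (Fin 3) ℝ, frob (A.transpose * A - 1) < ε →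
      (fun a b => A a b : Fin 3 → Fin 3 → ℝ) ∈ Metric.closedBall (0 : Fin 3 → Fin 3 → ℝ) 2 := by
    intro A hA
    rw [mem_closedBall_zero_iff, pi_norm_le_iff_of_nonneg (by norm_num)]
    intro a
    rw [pi_norm_le_iff_of_nonneg (by norm_num)]
    intro b
    exact abs_apply_le_of_frob_lt (hA.trans hε) a b
  have hd : dist (fun a b => A a b : Fin 3 → Fin 3 → ℝ) (fun a b => B a b) < r := by
    refine lt_of_le_of_lt ?_ (half_lt_self hr)
    refine (dist_pi_le_iff (by positivity)).2 fun a => (dist_pi_le_iff (by positivity)).2 fun b => ?_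
    rw [Real.dist_eq]; exact hAB a b
  have h1 := h _ (hmem A hA) _ (hmem B hB) hd
  rw [Real.dist_eq] at h1
  change |A.det - B.det| < 1 - ε at h1
  have hlow : ∀ A : Matrix (Fin 3) (Fin 3) ℝ, frob (A.transpose * A - 1) < ε →
      1 - ε < |A.det| := by
    intro A hA
    have := sq_le_sq.1 (det_sq_bounds (hA.trans hε)).1
    rw [abs_of_nonneg (by linarith)] at this
    linarith
  have hA' := hlow A hA
  have hB' := hlow B hB
  obtain ⟨h1a, h1b⟩ := abs_lt.1 h1
  rcases lt_trichotomy A.det 0 with hA0 | hA0 | hA0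
  · rw [abs_of_neg hA0] at hA'
    rw [sign_neg hA0, sign_neg (by linarith)]
  · rw [hA0, abs_zero] at hA'; linarith
  · rw [abs_of_pos hA0] at hA'
    rw [sign_pos hA0, sign_pos (by linarith)]

namespace TOProblem

variable {n m nE nI nR : ℕ} {S : TOProblem n m nE nI nR}

theorem ValidParams.loopParams {P : SolverParams} (hP : S.ValidParams P) : LoopParams P :=
  ⟨hP.1, hP.2.1, hP.2.2.1, hP.2.2.2.1, hP.2.2.2.2.1, hP.2.2.2.2.2.2.1, hP.2.2.2.2.2.2.2.1⟩

theorem ValidParams.one_div_lt {P : SolverParams} (hP : S.ValidParams P) : 1 / P.ε < P.L2 :=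
  hP.2.2.2.2.2.2.2.2.2.2.2.1

theorem ValidParams.L2_pos {P : SolverParams} (hP : S.ValidParams P) : 0 < P.L2 :=
  (one_div_pos.2 hP.loopParams.ε).trans hP.one_div_lt

theorem ValidParams.one_div_L2_lt {P : SolverParams} (hP : S.ValidParams P) :
    1 / P.L2 < P.ε := by
  have := hP.one_div_lt
  rw [div_lt_iff₀ hP.loopParams.ε] at this
  rw [div_lt_iff₀ hP.L2_pos]
  linarith

namespace Standing

variable {L2 : ℝ} (hS : Standing S L2)

include hS

/-! ### Relaxed potential and penalties -/

theorem pbar_nonneg (θ : Config n) : 0 ≤ S.pbar θ L2 := by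
  obtain ⟨-, -, h0, h⟩ := hS.relax.1
  by_cases hle : S.pbar θ L2 ≤ L2
  · rw [h L2 hS.pos θ (Or.inl hle)]; exact h0 θ
  · exact hS.pos.le.trans (not_le.1 hle).le

theorem hebar_nonneg (j : Fin nE ⊕ Fin nR) (x : ℝ) : 0 ≤ S.hebar j x L2 :=
  ((hS.relax.2.1.2 j).2 L2 hS.pos).2.2.2.1.2 ⟨x, rfl⟩

theorem hibar_nonneg (j : Fin nI) (x : ℝ) : 0 ≤ S.hibar j x L2 :=
  ((hS.relax.2.2.2 j).2 L2 hS.pos).2.2.2.1.2 ⟨x, rfl⟩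

theorem hebar_zero (j : Fin nE ⊕ Fin nR) : S.hebar j 0 L2 = 0 := by
  obtain ⟨-, -, hmono, ⟨⟨x, hx⟩, -⟩, -⟩ := (hS.relax.2.1.2 j).2 L2 hS.pos
  refine le_antisymm ?_ (hS.hebar_nonneg j 0)
  exact (hmono 0 x (by simp)).trans hx.le

theorem hibar_eq_zero (j : Fin nI) {x : ℝ} (h : 1 / L2 ≤ x) : S.hibar j x L2 = 0 := by
  obtain ⟨-, -, hmono, ⟨⟨y, hy⟩, -⟩, -⟩ := (hS.relax.2.2.2 j).2 L2 hS.pos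
  refine le_antisymm ?_ (hS.hibar_nonneg j x)
  rw [← hy]
  refine hmono x y ?_
  rw [max_eq_right (by linarith)]
  exact le_max_right _ _

theorem hibar_antitone (j : Fin nI) : Antitone fun x => S.hibar j x L2 := by
  obtain ⟨-, -, hmono, -⟩ := (hS.relax.2.2.2 j).2 L2 hS.pos
  intro x y hxy
  exact hmono y x (max_le_max (by linarith) le_rfl)

theorem abs_lt_of_hebar_lt {j : Fin nE ⊕ Fin nR} {x : ℝ} (h : S.hebar j x L2 < L2) :
    |x| < 1 / L2 := by
  obtain ⟨-, -, hmono, -, heq⟩ := (hS.relax.2.1.2 j).2 L2 hS.pos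
  by_contra hc
  have hp : |1 / L2| = 1 / L2 := abs_of_pos (one_div_pos.2 hS.pos)
  have h1 := hmono (1 / L2) x (by rw [hp]; exact not_lt.1 hc)
  rw [heq _ hp] at h1
  linarith

theorem pos_of_hibar_lt {j : Fin nI} {x : ℝ} (h : S.hibar j x L2 < L2) : 0 < x := by
  by_contra hc
  have h1 := hS.hibar_antitone j (not_lt.1 hc)
  have h2 : S.hibar j 0 L2 = L2 := ((hS.relax.2.2.2 j).2 L2 hS.pos).2.2.2.2
  simp only [h2] at h1
  linarith

theorem Pg_nonneg (θ : Config n) : 0 ≤ S.Pg L2 θ := by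
  unfold Pg
  have h1 := hS.pbar_nonneg θ
  have h2 : 0 ≤ ∑ j, S.hebar j (S.eqc j θ) L2 := Finset.sum_nonneg fun j _ => hS.hebar_nonneg j _
  have h3 : 0 ≤ ∑ j, S.hibar j (S.hi j θ) L2 := Finset.sum_nonneg fun j _ => hS.hibar_nonneg j _
  linarith

/-- All summands are nonnegative, so each stays below `L2`, the value that the penalties attain at
`|x| = 1 / L2` and at `x = 0` respectively: they act as barriers. -/
theorem of_Pg_lt {θ : Config n} (h : S.Pg L2 θ < L2) :
    S.pbar θ L2 < L2 ∧ (∀ j, |S.eqc j θ| < 1 / L2) ∧ ∀ j, 0 < S.hi j θ := by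
  unfold Pg at h
  have h1 := hS.pbar_nonneg θ
  have h2 : 0 ≤ ∑ j, S.hebar j (S.eqc j θ) L2 := Finset.sum_nonneg fun j _ => hS.hebar_nonneg j _
  have h3 : 0 ≤ ∑ j, S.hibar j (S.hi j θ) L2 := Finset.sum_nonneg fun j _ => hS.hibar_nonneg j _
  refine ⟨by linarith, fun j => hS.abs_lt_of_hebar_lt (j := j) ?_,
    fun j => hS.pos_of_hibar_lt (j := j) ?_⟩
  · have := Finset.single_le_sum (f := fun j => S.hebar j (S.eqc j θ) L2)
      (fun j _ => hS.hebar_nonneg j _) (Finset.mem_univ j)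
    linarith
  · have := Finset.single_le_sum (f := fun j => S.hibar j (S.hi j θ) L2)
      (fun j _ => hS.hibar_nonneg j _) (Finset.mem_univ j)
    linarith

/-- Slater's condition together with `1 / h < L2` and `p < L2` makes the relaxation exact at the
initial frame. -/
theorem Pg_initial (hslater : S.SlaterAssumption) (hp : S.p S.θ0 < L2)
    (hi : ∀ j, 1 / S.hi j S.θ0 < L2) : S.Pg L2 S.θ0 = S.p S.θ0 := by
  have h1 : S.pbar S.θ0 L2 = S.p S.θ0 := hS.relax.1.2.2.2 L2 hS.pos _ (Or.inr hp.le)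
  have h2 : ∑ j, S.hebar j (S.eqc j S.θ0) L2 = 0 :=
    Finset.sum_eq_zero fun j _ => by rw [hslater.1 j, hS.hebar_zero]
  have h3 : ∑ j, S.hibar j (S.hi j S.θ0) L2 = 0 :=
    Finset.sum_eq_zero fun j _ => by
      refine hS.hibar_eq_zero j ?_
      have hpos := hslater.2.2 j
      have := hi j
      rw [div_lt_iff₀ hpos] at this
      rw [div_le_iff₀ hS.pos]
      linarith
  rw [Pg, h1, h2, h3]; ring

theorem Pg_lt_of_energy_lt {D : Finset ℚ} {θ : Traj n D} {i : ℚ} (h : S.Hg L2 θ i < L2) :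
    S.Pg L2 (S.frame θ i) < L2 := by
  have := hS.normMSq_nonneg (S.vel θ i)
  rw [Hg] at h
  linarith

/-! ### Discrete dynamics in terms of velocities -/

theorem dt_pos {D : Finset ℚ} {i : ℚ} (hi : -1 < i) : 0 < S.dt D i := by
  have h := pred_lt D hi
  unfold dt
  refine mul_pos hS.step ?_
  exact_mod_cast sub_pos.2 h

theorem dt_smul_vel {D : Finset ℚ} (θ : Traj n D) {i : ℚ} (hi : -1 < i) :
    S.dt D i • S.vel θ i = S.frame θ i - S.frame θ (pred D i) := by
  rw [vel, smul_smul, mul_inv_cancel₀ (hS.dt_pos hi).ne', one_smul]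

theorem gradL_eq_acc {D : Finset ℚ} (hD : IsGrid S.N D) (θ : Traj n D) (u : Controls m S.N)
    (i : D) : S.gradL L2 θ u i =
      S.mass (S.acc θ i) + gradient (S.Pg L2) (θ i) - S.g + S.bgrad (θ i, ctrl u i) := by
  rw [hS.gradL_apply]
  have hi := (hD i i.2).1
  have hd : S.dt D i ≠ 0 := (hS.dt_pos (by linarith)).ne'
  have hd' : S.dt D (pred D i) ≠ 0 :=
    (hS.dt_pos (by linarith [pred_nonneg (D := D) hi])).ne'
  have e : S.acc θ i = (1 / S.dt D i ^ 2) • (θ i -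
      (1 + S.dt D i / S.dt D (pred D i)) • S.frame θ (pred D i) +
      (S.dt D i / S.dt D (pred D i)) • S.frame θ (pred D (pred D i))) := by
    unfold acc vel
    rw [frame_of_mem]
    match_scalars
    all_goals field_simp
    ring
  rw [e, map_smul]

end Standing

theorem dt_zero {D : Finset ℚ} (hD : IsGrid S.N D) : S.dt D 0 = S.δ := by
  rw [dt, hD.pred_zero]; simp

theorem Hg_zero (L2 : ℝ) {D : Finset ℚ} (hD : IsGrid S.N D) (θ : Traj n D) :
    S.Hg L2 θ 0 = 1 / 2 * S.normMSq (S.δ⁻¹ • (S.θ0 - S.θm1)) + S.Pg L2 S.θ0 := by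
  have h0 : (0 : ℚ) ∉ D := fun h => lt_irrefl _ (hD 0 h).1
  have h1 : (-1 : ℚ) ∉ D := fun h => by have := (hD _ h).1; norm_num at this
  have e0 : S.frame θ 0 = S.θ0 := by simp [frame, h0]
  have e1 : S.frame θ (-1) = S.θm1 := by simp [frame, h1]
  rw [Hg, vel, dt_zero hD, hD.pred_zero, e0, e1]

namespace Standing

variable {P : SolverParams} (hS : Standing S P.L2) (hP : S.ValidParams P)

include hS hP

theorem norm_bgrad_le {w : Control m} (hw : w ∈ S.X) (t : Config n) : ‖S.bgrad (t, w)‖ ≤ P.k := by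
  obtain ⟨hk, h⟩ := hP.2.2.2.2.2.2.2.2.1.lipschitz hS.cost.2.2.2
  exact norm_gradient_le_of_lipschitz hk (fun x y => h w hw x y) t

/-! ### Energy estimates -/

/-- The energy test holds for small time steps. -/
theorem exists_energy_step : ∃ h > 0, ∀ (D : Finset ℚ), IsGrid S.N D → ∀ (θ : Traj n D)
    (u : Controls m S.N), (∀ i, u i ∈ S.X) → ∀ i : D, ‖S.gradL P.L2 θ u i‖ ≤ P.ε →
      S.dt D i ≤ h → S.Hg P.L2 θ i ≤ Real.exp (6 * S.dt D i / sigmaMin S.mass) *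
        (S.Hg P.L2 θ (pred D i) + ((‖S.g‖ + P.k) ^ 2 + P.ε ^ 2) * S.dt D i) := by
  obtain ⟨hdiff, -, L, hL, hlip⟩ := hS.smoothLip_Pg
  set σ := sigmaMin S.mass with hσ
  have hσ0 : 0 < σ := hS.sigma_pos
  -- The first bound absorbs the quadratic error of the relaxed potential; the second ensures `x = 2
  -- h / σ ≤ 1 / 2` below.
  refine ⟨min (1 / (2 * (L + 1))) (σ / 4), lt_min (by positivity) (by positivity), ?_⟩
  intro D hD θ u hu i hc hdt
  have hi := (hD i i.2).1
  have hh : 0 < S.dt D i := hS.dt_pos (by linarith)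
  have hstep := hS.dt_smul_vel θ (by linarith : -1 < (i : ℚ))
  have hc' := hS.gradL_eq_acc hD θ u i
  have hb := hS.norm_bgrad_le hP (hD.ctrl_mem hu i.2) (θ i)
  have hacc : S.dt D i • S.acc θ i = S.vel θ i - S.vel θ (pred D i) := by
    rw [acc, smul_smul, mul_inv_cancel₀ hh.ne', one_smul]
  rw [frame_of_mem] at hstep
  have hPg := sub_le_of_gradient_lipschitz hL hdiff hlip (θ i) (S.frame θ (pred D i))
  rw [← hstep] at hPg
  have hHi : S.Hg P.L2 θ i = 1 / 2 * S.normMSq (S.vel θ i) + S.Pg P.L2 (θ i) := by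
    rw [Hg, frame_of_mem]
  have hHj : S.Hg P.L2 θ (pred D i) = 1 / 2 * S.normMSq (S.vel θ (pred D i)) +
      S.Pg P.L2 (S.frame θ (pred D i)) := rfl
  have hPgi := hS.Pg_nonneg (θ i)
  set h := S.dt D i with hhdef
  set v := S.vel θ i with hv
  set w := S.vel θ (pred D i) with hw
  set c := S.gradL P.L2 θ u i with hcdef
  set bg := S.bgrad (θ i, ctrl u i) with hbg
  have hLh : h * L ≤ 1 / 2 := by
    have h1 : h ≤ 1 / (2 * (L + 1)) := hdt.trans (min_le_left _ _)
    rw [le_div_iff₀ (by positivity)] at h1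
    nlinarith
  have hσh : h ≤ σ / 4 := hdt.trans (min_le_right _ _)
  -- the kinetic energy balance
  have hkin : h * inner ℝ v (S.mass (S.acc θ i)) =
      1 / 2 * S.normMSq v - 1 / 2 * S.normMSq w + 1 / 2 * S.normMSq (v - w) := by
    have e : h * inner ℝ v (S.mass (S.acc θ i)) = inner ℝ v (S.mass (v - w)) := by
      rw [← hacc, map_smul, real_inner_smul_right]
    rw [e]
    unfold normMSq
    simp only [map_sub, inner_sub_left, inner_sub_right]
    have e1 : inner ℝ w (S.mass v) = inner ℝ v (S.mass w) := by
      rw [← hS.mass_symm, real_inner_comm]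
    rw [e1]
    ring
  -- The equation of motion with residual `c` eliminates the potential force, so the energy change
  -- involves only `c`, `g` and the control.
  have hforce : inner ℝ v (gradient (S.Pg P.L2) (θ i)) =
      inner ℝ v (c + S.g - bg) - inner ℝ v (S.mass (S.acc θ i)) := by
    rw [← inner_sub_right]
    congr 1
    rw [hc']; abel
  have hMw := hS.normMSq_nonneg (v - w)
  rw [real_inner_smul_right, real_inner_comm, hforce, norm_smul, Real.norm_of_nonneg hh.le,
    mul_sub, hkin] at hPg
  have hcs : inner ℝ v (c + S.g - bg) ≤ ‖v‖ * (P.ε + ‖S.g‖ + P.k) := by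
    refine (real_inner_le_norm _ _).trans (mul_le_mul_of_nonneg_left ?_ (norm_nonneg _))
    exact (norm_sub_le _ _).trans (add_le_add ((norm_add_le _ _).trans (add_le_add hc le_rfl)) hb)
  set K := (‖S.g‖ + P.k) ^ 2 + P.ε ^ 2 with hK
  have hK0 : 0 ≤ K := by positivity
  -- Young's inequality and `(ε + ‖g‖ + k)² ≤ 2 K`: this is the origin of `K`.
  have hcs2 : inner ℝ v (c + S.g - bg) ≤ K + ‖v‖ ^ 2 / 2 := by
    refine hcs.trans ?_
    rw [hK]
    nlinarith [sq_nonneg (‖v‖ - (P.ε + ‖S.g‖ + P.k)), sq_nonneg (‖S.g‖ + P.k - P.ε)]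
  have h1 : S.Hg P.L2 θ i ≤ S.Hg P.L2 θ (pred D i) + K * h + h * ‖v‖ ^ 2 := by
    rw [hHi, hHj]
    have g1 := mul_le_mul_of_nonneg_left hcs2 hh.le
    have g2 : L * (h * ‖v‖) ^ 2 ≤ 1 / 2 * (h * ‖v‖ ^ 2) := by
      have : L * (h * ‖v‖) ^ 2 = (h * L) * (h * ‖v‖ ^ 2) := by ring
      rw [this]
      gcongr
    linarith
  have h2 : h * ‖v‖ ^ 2 ≤ 2 * h / σ * S.Hg P.L2 θ i := by
    have g1 := hS.sigma_mul_sq_le v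
    have g2 : σ * ‖v‖ ^ 2 ≤ 2 * S.Hg P.L2 θ i := by rw [hHi]; linarith
    have : ‖v‖ ^ 2 ≤ 2 * S.Hg P.L2 θ i / σ := by rw [le_div_iff₀ hσ0]; linarith
    calc h * ‖v‖ ^ 2 ≤ h * (2 * S.Hg P.L2 θ i / σ) := by gcongr
      _ = _ := by ring
  have hH0 : 0 ≤ S.Hg P.L2 θ i := by
    rw [hHi]; have := hS.normMSq_nonneg v; linarith
  set x := 2 * h / σ with hx
  have hx0 : 0 ≤ x := by positivity
  have hx1 : x ≤ 1 / 2 := by rw [hx, div_le_iff₀ hσ0]; linarith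
  -- `(1 + 3 x) (1 - x) ≥ 1` for `x ≤ 2 / 3`, which explains the `6` in the energy test: `6 h / σ =
  -- 3 x`.
  have hexp : 1 ≤ Real.exp (6 * h / σ) * (1 - x) := by
    have e : 6 * h / σ = 3 * x := by rw [hx]; ring
    rw [e]
    have := Real.add_one_le_exp (3 * x)
    nlinarith
  have h3 : (1 - x) * S.Hg P.L2 θ i ≤ S.Hg P.L2 θ (pred D i) + K * h := by linarith
  calc S.Hg P.L2 θ i ≤ Real.exp (6 * h / σ) * (1 - x) * S.Hg P.L2 θ i :=
        le_mul_of_one_le_left hH0 hexp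
    _ = Real.exp (6 * h / σ) * ((1 - x) * S.Hg P.L2 θ i) := by ring
    _ ≤ _ := by gcongr

/-- If all energy tests up to `i` are passed, then the energy at `i` is below `L₂`. -/
theorem energy_lt (hslater : S.SlaterAssumption) {D : Finset ℚ} (hD : IsGrid S.N D)
    (θ : Traj n D) {i : ℚ} (hi : i ∈ insert 0 D)
    (htest : ∀ j ∈ D, j ≤ i → S.Hg P.L2 θ j ≤ Real.exp (6 * S.dt D j / sigmaMin S.mass) *
      (S.Hg P.L2 θ (pred D j) + ((‖S.g‖ + P.k) ^ 2 + P.ε ^ 2) * S.dt D j)) :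
    S.Hg P.L2 θ i < P.L2 := by
  obtain ⟨-, -, -, -, -, -, -, -, -, hhi, hp, -, hL14⟩ := hP
  set σ := sigmaMin S.mass with hσ
  have hσ0 : 0 < σ := hS.sigma_pos
  set K := (‖S.g‖ + P.k) ^ 2 + P.ε ^ 2 with hK
  have hK0 : 0 ≤ K := by positivity
  have hδ := hS.step
  have hH0 := Hg_zero P.L2 hD θ
  rw [hS.Pg_initial hslater hp hhi] at hH0
  have hH0n : 0 ≤ S.Hg P.L2 θ 0 := by
    rw [hH0]
    have := hS.normMSq_nonneg (S.δ⁻¹ • (S.θ0 - S.θm1))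
    have := hS.relax.1.2.2.1 S.θ0
    linarith
  -- Discrete Gronwall in the elapsed time `δ i`: exponentials multiply, and the source term may be
  -- enlarged by a factor at least one. At `i = N` the right side is `L14`.
  have key : ∀ i ∈ insert 0 D, (∀ j ∈ D, j ≤ i →
      S.Hg P.L2 θ j ≤ Real.exp (6 * S.dt D j / σ) * (S.Hg P.L2 θ (pred D j) + K * S.dt D j)) →
      S.Hg P.L2 θ i ≤ Real.exp (6 * (S.δ * (i : ℝ)) / σ) *
        (S.Hg P.L2 θ 0 + K * (S.δ * (i : ℝ))) := by
    refine grid_induction (fun _ => by simp) fun i hi ih ht => ?_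
    have hi0 := (hD i hi).1
    have hlt : pred D i < i := pred_lt D (by linarith)
    have h1 := ih (pred D i) (pred_mem hi0) hlt fun j hj hji => ht j hj (hji.trans hlt.le)
    have h2 := ht i hi le_rfl
    have hdt : 0 ≤ S.dt D i := (hS.dt_pos (by linarith)).le
    have e : S.δ * (i : ℝ) = S.δ * ((pred D i : ℚ) : ℝ) + S.dt D i := by
      rw [dt]; push_cast; ring
    have hp0 : (0 : ℝ) ≤ S.δ * ((pred D i : ℚ) : ℝ) :=
      mul_nonneg hδ.le (by exact_mod_cast pred_nonneg (D := D) hi0)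
    set s := S.δ * ((pred D i : ℚ) : ℝ) with hs
    set h := S.dt D i with hh
    rw [e]
    have hexp : Real.exp (6 * (s + h) / σ) = Real.exp (6 * h / σ) * Real.exp (6 * s / σ) := by
      rw [← Real.exp_add]; congr 1; ring
    have hexp1 : 1 ≤ Real.exp (6 * s / σ) := Real.one_le_exp (by positivity)
    rw [hexp, mul_assoc]
    refine h2.trans (mul_le_mul_of_nonneg_left ?_ (Real.exp_pos _).le)
    have h3 : K * h ≤ Real.exp (6 * s / σ) * (K * h) :=
      le_mul_of_one_le_left (by positivity) hexp1
    linarith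
  refine lt_of_le_of_lt (key i hi htest) (lt_of_le_of_lt ?_ hL14)
  have hiN : (i : ℝ) ≤ S.N := by
    rcases Finset.mem_insert.1 hi with h | h
    · subst h; simp
    · exact_mod_cast (hD i h).2
  have hi0 : (0 : ℝ) ≤ i := by
    rcases Finset.mem_insert.1 hi with h | h
    · subst h; simp
    · exact_mod_cast (hD i h).1.le
  have hle : S.δ * (i : ℝ) ≤ S.N * S.δ := by nlinarith
  have hnn : 0 ≤ S.δ * (i : ℝ) := by positivity
  rw [L14, ← hσ, ← hK, ← hH0]
  gcongr

/-! ### Subdivision happens only for long time steps -/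

/-- The diagonal block is `M / δ_i²` plus a force Jacobian of norm at most `L`, so its quadratic
form is at least `σ / δ_i² - L`, which is at least `L3` for short steps. -/
theorem exists_singular_step : ∃ h > 0, ∀ (D : Finset ℚ), IsGrid S.N D → ∀ (θ : Traj n D)
    (u : Controls m S.N), (∀ i, u i ∈ S.X) → ∀ i, S.SingularAt P θ u i → h < S.dt D i := by
  obtain ⟨L, hL, hlip⟩ := hS.force_lipschitz
  have hσ0 : 0 < sigmaMin S.mass := hS.sigma_pos
  have hL3 := hP.1
  refine ⟨√(sigmaMin S.mass / (L + P.L3)), Real.sqrt_pos.2 (by positivity), ?_⟩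
  rintro D hD θ u hu i ⟨hi, hs⟩
  have hi0 := (hD i hi).1
  have hh : 0 < S.dt D i := hS.dt_pos (by linarith)
  by_contra hc
  have hle : S.dt D i ^ 2 ≤ sigmaMin S.mass / (L + P.L3) := by
    rw [← Real.sq_sqrt (by positivity : 0 ≤ sigmaMin S.mass / (L + P.L3))]
    have := not_lt.1 hc
    gcongr
  refine absurd hs (not_lt.2 (le_sigmaMin hS.dim fun v => ?_))
  rw [hS.diagBlock_eq, add_apply, smul_apply, inner_add_right, real_inner_smul_right]
  have h1 := hS.sigma_mul_sq_le v
  have hcl := hD.ctrl_mem hu hi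
  have h2 : -(L * ‖v‖ ^ 2) ≤ inner ℝ v (fderiv ℝ (S.force P.L2 (ctrl u i)) (θ ⟨i, hi⟩) v) := by
    have a1 := norm_fderiv_le_of_lipschitz_bound hL (hlip _ hcl) (θ ⟨i, hi⟩)
    have a2 := abs_real_inner_le_norm v (fderiv ℝ (S.force P.L2 (ctrl u i)) (θ ⟨i, hi⟩) v)
    have a3 := (ContinuousLinearMap.le_opNorm
      (fderiv ℝ (S.force P.L2 (ctrl u i)) (θ ⟨i, hi⟩)) v).trans
      (mul_le_mul_of_nonneg_right a1 (norm_nonneg v))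
    have a4 := mul_le_mul_of_nonneg_left a3 (norm_nonneg v)
    have a5 := (abs_le.1 (a2.trans a4)).1
    linarith [show ‖v‖ * (L * ‖v‖) = L * ‖v‖ ^ 2 by ring]
  have h3 : (L + P.L3) * ‖v‖ ^ 2 ≤ 1 / S.dt D i ^ 2 * inner ℝ v (S.mass v) := by
    rw [one_div, ← div_eq_inv_mul, le_div_iff₀ (by positivity)]
    rw [le_div_iff₀ (by positivity)] at hle
    calc (L + P.L3) * ‖v‖ ^ 2 * S.dt D i ^ 2 = (S.dt D i ^ 2 * (L + P.L3)) * ‖v‖ ^ 2 := by ring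
      _ ≤ sigmaMin S.mass * ‖v‖ ^ 2 := by gcongr
      _ ≤ _ := h1
  linarith

/-- At a short step the energy test holds, so only the determinant test can fail. As `i` is the
first failure, all earlier energy tests hold, and the energies at `i` and its predecessor are below
`L2`. Hence the velocity is at most `V`, both matrices are nearly orthogonal, and they are too close
for a change of sign. Minimality of `i` is essential. -/
theorem exists_check_step (hslater : S.SlaterAssumption) :
    ∃ h > 0, ∀ (D : Finset ℚ), IsGrid S.N D → ∀ (θ : Traj n D)
    (u : Controls m S.N), (∀ i, u i ∈ S.X) → l1norm (S.gradL P.L2 θ u) < S.tol P →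
      ∀ i, IsLeast {j | S.CheckFails P θ j} i → h < S.dt D i := by
  obtain ⟨h₁, hh₁, henergy⟩ := hS.exists_energy_step hP
  have hσ0 : 0 < sigmaMin S.mass := hS.sigma_pos
  have hL2 := hS.pos
  -- Without rotations `ε < 1` is not available, but then nothing is claimed and any `r` will do.
  obtain ⟨r, hr, hdet⟩ : ∃ r > 0, 0 < nR → ∀ A B : Matrix (Fin 3) (Fin 3) ℝ,
      frob (A.transpose * A - 1) < P.ε → frob (B.transpose * B - 1) < P.ε →
      (∀ a b, |A a b - B a b| ≤ r) → SignType.sign A.det = SignType.sign B.det := by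
    by_cases hR : 0 < nR
    · obtain ⟨r, hr, h⟩ := exists_sign_det_eq (hP.2.2.2.2.2.1 hR)
      exact ⟨r, hr, fun _ => h⟩
    · exact ⟨1, one_pos, fun h => absurd h hR⟩
  set V := √(2 * P.L2 / sigmaMin S.mass) with hV
  have hV0 : 0 ≤ V := Real.sqrt_nonneg _
  refine ⟨min h₁ (r / (V + 1)), lt_min hh₁ (by positivity), ?_⟩
  intro D hD θ u hu hl i hi
  obtain ⟨⟨hiD, hfail⟩, hmin⟩ := hi
  by_contra hc
  have hdt := not_lt.1 hc
  have hi0 := (hD i hiD).1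
  have hh : 0 < S.dt D i := hS.dt_pos (by linarith)
  have hlt : pred D i < i := pred_lt D (by linarith)
  have hci : ‖S.gradL P.L2 θ u ⟨i, hiD⟩‖ ≤ P.ε :=
    (norm_apply_le_l1norm _ _).trans (hl.le.trans (tol_le hP.loopParams.ε))
  have hEi := henergy D hD θ u hu ⟨i, hiD⟩ hci (hdt.trans (min_le_left _ _))
  have htest : ∀ j ∈ D, j ≤ i → S.Hg P.L2 θ j ≤ Real.exp (6 * S.dt D j / sigmaMin S.mass) *
      (S.Hg P.L2 θ (pred D j) + ((‖S.g‖ + P.k) ^ 2 + P.ε ^ 2) * S.dt D j) := by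
    intro j hj hji
    rcases hji.eq_or_lt with rfl | hji
    · exact hEi
    · by_contra hcj
      exact absurd (hmin ⟨hj, Or.inl (not_le.1 hcj)⟩) (not_le.2 hji)
  rcases hfail with hfail | ⟨k, hk⟩
  · exact absurd hEi (not_le.2 hfail)
  have hi1 := hS.energy_lt hP hslater hD θ (Finset.mem_insert_of_mem hiD) htest
  have hi2 := hS.energy_lt hP hslater hD θ (pred_mem hi0)
    fun j hj hji => htest j hj (hji.trans hlt.le)
  have hf : ∀ l, S.Hg P.L2 θ l < P.L2 →
      frob ((S.R k (S.frame θ l)).transpose * S.R k (S.frame θ l) - 1) < P.ε := by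
    intro l hl
    have := (hS.of_Pg_lt (hS.Pg_lt_of_energy_lt hl)).2.1 (Sum.inr k)
    exact (le_abs_self _).trans_lt (this.trans hP.one_div_L2_lt)
  refine hk (hdet k.pos _ _ (hf _ hi1) (hf _ hi2) fun a b => ?_)
  have hv : ‖S.vel θ i‖ ≤ V := by
    refine Real.le_sqrt_of_sq_le ?_
    rw [le_div_iff₀ hσ0]
    have g1 := hS.sigma_mul_sq_le (S.vel θ i)
    have g2 := hS.Pg_nonneg (S.frame θ i)
    rw [Hg] at hi1
    linarith
  have hdist : ‖S.frame θ i - S.frame θ (pred D i)‖ ≤ r := by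
    rw [← hS.dt_smul_vel θ (by linarith : -1 < i), norm_smul, Real.norm_of_nonneg hh.le]
    have g1 : S.dt D i ≤ r / (V + 1) := hdt.trans (min_le_right _ _)
    calc S.dt D i * ‖S.vel θ i‖ ≤ r / (V + 1) * V := by gcongr
      _ ≤ r / (V + 1) * (V + 1) := by gcongr; linarith
      _ = r := by field_simp
  exact (PiLp.norm_apply_le (S.frame θ i - S.frame θ (pred D i)) (S.rot k (a, b))).trans hdist

end Standing
end TOProblem

/-! ### The Lagrangian and the perturbed KKT conditions. -/

theorem hasGradientAt_add_inner_comp {E G : Type*} [NormedAddCommGroup E] [InnerProductSpace ℝ E]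
    [CompleteSpace E] [NormedAddCommGroup G] [InnerProductSpace ℝ G] [CompleteSpace G]
    {o r : E → ℝ} {c : E → G} {x g k : E} {c' : E →L[ℝ] G} (ho : HasGradientAt o g x)
    (hc : HasFDerivAt c c' x) (hr : HasGradientAt r k x) (μ : G) :
    HasGradientAt (fun y => o y + inner ℝ μ (c y) + r y)
      (g + ContinuousLinearMap.adjoint c' μ + k) x := by
  rw [hasGradientAt_iff_hasFDerivAt] at ho hr ⊢
  have h1 : HasFDerivAt (fun y => inner ℝ μ (c y)) ((InnerProductSpace.toDual ℝ G μ) ∘L c') x :=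
    HasFDerivAt.comp (g := InnerProductSpace.toDual ℝ G μ) x
      (InnerProductSpace.toDual ℝ G μ).hasFDerivAt hc
  refine ((ho.fun_add h1).fun_add hr).congr_fderiv ?_
  ext v
  simp [ContinuousLinearMap.adjoint_inner_left]

namespace TOProblem

variable {n m nE nI nR : ℕ} {S : TOProblem n m nE nI nR}

/-- A norm composed with a polynomial map, hence locally Lipschitz even where the norm has a kink.
-/
theorem locallyLipschitz_frob_orthogonality (S : TOProblem n m nE nI nR) (r : Fin nR) :
    LocallyLipschitz fun θ => frob ((S.R r θ).transpose * S.R r θ - 1) := by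
  let F : Config n → EuclideanSpace ℝ (Fin 3 × Fin 3) := fun θ =>
    WithLp.toLp 2 fun p => ((S.R r θ).transpose * S.R r θ - 1) p.1 p.2
  have hF : ContDiff ℝ 1 F := by
    rw [contDiff_piLp]
    rintro ⟨a, b⟩
    simp only [F, Matrix.sub_apply, Matrix.mul_apply, Matrix.transpose_apply, R, subMatrix,
      Matrix.of_apply]
    fun_prop
  have e : (fun θ => frob ((S.R r θ).transpose * S.R r θ - 1)) = fun θ => ‖F θ‖ := by
    funext θ
    rw [EuclideanSpace.norm_eq, frob, Fintype.sum_prod_type]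
    simp [F]
  rw [e]
  exact lipschitzWith_one_norm.locallyLipschitz.comp hF.locallyLipschitz

namespace Standing

section Relaxation

variable {L2 : ℝ} (hS : Standing S L2)

include hS

theorem locallyLipschitz_eqc (j : Fin nE ⊕ Fin nR) : LocallyLipschitz (S.eqc j) := by
  cases j with
  | inl j => exact hS.relax.2.1.1 j
  | inr r => exact S.locallyLipschitz_frob_orthogonality r

theorem continuous_pbar : Continuous fun t => S.pbar t L2 :=
  (hS.relax.1.2.1 L2 hS.pos).1.continuous

/-- The condition `pbar < L2` is open, so `p` inherits differentiability from `pbar` and not just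
its value. -/
theorem p_eventuallyEq {t : Config n} (ht : S.pbar t L2 < L2) :
    S.p =ᶠ[𝓝 t] fun t => S.pbar t L2 := by
  filter_upwards [hS.continuous_pbar.continuousAt.eventually (gt_mem_nhds ht)] with s hs
  exact (hS.relax.1.2.2.2 L2 hS.pos s (Or.inl (le_of_lt hs))).symm

theorem differentiableAt_p {t : Config n} (ht : S.pbar t L2 < L2) : DifferentiableAt ℝ S.p t :=
  ((hS.relax.1.2.1 L2 hS.pos).1 t).congr_of_eventuallyEq (hS.p_eventuallyEq ht)

theorem gradient_Pg {t : Config n} (ht : S.pbar t L2 < L2) :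
    gradient (S.Pg L2) t = gradient S.p t + ∑ j, S.multE L2 j t • gradient (S.eqc j) t +
      ∑ j, S.multI L2 j t • gradient (S.hi j) t := by
  have hp := (hS.relax.1.2.1 L2 hS.pos).1 t
  have he : ∀ j, DifferentiableAt ℝ (fun θ => S.hebar j (S.eqc j θ) L2) t := fun j =>
    ((hS.relax.2.1.2 j).2 L2 hS.pos).1.1 t
  have hi : ∀ j, DifferentiableAt ℝ (fun θ => S.hibar j (S.hi j θ) L2) t := fun j =>
    ((hS.relax.2.2.2 j).2 L2 hS.pos).1.1 t
  have e1 : gradient S.p t = gradient (fun t => S.pbar t L2) t := by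
    unfold gradient; rw [(hS.p_eventuallyEq ht).fderiv_eq]
  have e : gradient (S.Pg L2) t = gradient (fun t => S.pbar t L2) t +
      ∑ j, gradient (fun θ => S.hebar j (S.eqc j θ) L2) t +
      ∑ j, gradient (fun θ => S.hibar j (S.hi j θ) L2) t := by
    unfold Pg
    rw [gradient_add' (hp.fun_add (DifferentiableAt.fun_sum fun j _ => he j))
      (DifferentiableAt.fun_sum fun j _ => hi j),
      gradient_add' hp (DifferentiableAt.fun_sum fun j _ => he j),
      gradient_fun_sum _ fun j _ => he j, gradient_fun_sum _ fun j _ => hi j]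
  rw [e, e1]
  congr 1
  · congr 1
    refine Finset.sum_congr rfl fun j _ => ?_
    exact gradient_penalty (φ := fun x => S.hebar j x L2)
      ((hS.relax.2.1.2 j).2 L2 hS.pos).2.1 (hS.locallyLipschitz_eqc j) (he j)
  · refine Finset.sum_congr rfl fun j _ => ?_
    exact gradient_penalty (φ := fun x => S.hibar j x L2)
      ((hS.relax.2.2.2 j).2 L2 hS.pos).2.1 (hS.relax.2.2.1 j) (hi j)

theorem eom_eq_gradL {D : Finset ℚ} (hD : IsGrid S.N D) {θ : Traj n D} (u : Controls m S.N)
    (i : D) (hθ : S.pbar (θ i) L2 < L2) :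
    S.eom (S.multE L2) (S.multI L2) θ u i = S.gradL L2 θ u i := by
  rw [hS.gradL_eq_acc hD, eom, frame_of_mem, hS.gradient_Pg hθ, bgrad]
  abel

theorem lagrangian_eq {D : Finset ℚ} (hD : IsGrid S.N D) (μθ : Traj n D) (μu : Controls m S.N)
    {θ : Traj n D} (u : Controls m S.N) (hθ : ∀ i, S.pbar (θ i) L2 < L2) :
    S.lagrangian (S.multE L2) (S.multI L2) μθ μu θ u =
      S.O D θ u + inner ℝ μθ (S.gradL L2 θ u) + inner ℝ μu u := by
  rw [lagrangian, PiLp.inner_apply, PiLp.inner_apply]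
  congr 2
  exact Finset.sum_congr rfl fun i _ => by rw [hS.eom_eq_gradL hD u i (hθ i)]

theorem hasGradientAt_lagrangian_left {D : Finset ℚ} (hD : IsGrid S.N D) (μθ : Traj n D)
    (μu : Controls m S.N) {θ : Traj n D} (u : Controls m S.N)
    (hθ : ∀ i, S.pbar (θ i) L2 < L2) :
    HasGradientAt (fun θ' => S.lagrangian (S.multE L2) (S.multI L2) μθ μu θ' u)
      (gradient (fun θ' => S.O D θ' u) θ +
        ContinuousLinearMap.adjoint (S.jacθ L2 θ u) μθ) θ := by
  have hO : HasGradientAt (fun θ' => S.O D θ' u) (gradient (fun θ' => S.O D θ' u) θ) θ :=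
    (hasFDerivAt_partial_left (hS.differentiable_O D (θ, u))).differentiableAt.hasGradientAt
  have h := hasGradientAt_add_inner_comp hO (hS.hasFDerivAt_gradL_left θ u)
    (hasGradientAt_const θ (inner ℝ μu u)) μθ
  rw [add_zero] at h
  refine h.congr_of_eventuallyEq ?_
  -- The Lagrangian agrees with the smooth expression on a neighbourhood of `θ`, as differentiation
  -- requires.
  have hopen : ∀ᶠ θ' : Traj n D in 𝓝 θ, ∀ i, S.pbar (θ' i) L2 < L2 := by
    rw [eventually_all]
    intro i
    have hc : Continuous fun θ' : Traj n D => S.pbar (θ' i) L2 :=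
      hS.continuous_pbar.comp (PiLp.continuous_apply 2 (fun _ : D => Config n) i)
    exact hc.continuousAt.eventually (gt_mem_nhds (hθ i))
  filter_upwards [hopen] with θ' hθ'
  exact hS.lagrangian_eq hD μθ μu u hθ'

theorem hasGradientAt_lagrangian_right {D : Finset ℚ} (hD : IsGrid S.N D) (μθ : Traj n D)
    (μu : Controls m S.N) {θ : Traj n D} (u : Controls m S.N)
    (hθ : ∀ i, S.pbar (θ i) L2 < L2) :
    HasGradientAt (fun u' => S.lagrangian (S.multE L2) (S.multI L2) μθ μu θ u')
      (gradient (fun u' => S.O D θ u') u +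
        ContinuousLinearMap.adjoint (S.jacu L2 θ u) μθ + μu) u := by
  have hO : HasGradientAt (fun u' => S.O D θ u') (gradient (fun u' => S.O D θ u') u) u :=
    (hasFDerivAt_partial_right (hS.differentiable_O D (θ, u))).differentiableAt.hasGradientAt
  have hr : HasGradientAt (fun u' : Controls m S.N => inner ℝ μu u') μu u := by
    rw [hasGradientAt_iff_hasFDerivAt]
    exact (InnerProductSpace.toDual ℝ (Controls m S.N) μu).hasFDerivAt
  have h := hasGradientAt_add_inner_comp hO (hS.hasFDerivAt_gradL_right θ u) hr μθ
  refine h.congr_of_eventuallyEq (Eventually.of_forall fun u' => ?_)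
  exact hS.lagrangian_eq hD μθ μu u' hθ

theorem multI_nonpos (j : Fin nI) (t : Config n) : S.multI L2 j t ≤ 0 :=
  (hS.hibar_antitone j).deriv_nonpos

/-- The strict inequality makes the penalty vanish on a neighbourhood, so its derivative is zero
too. -/
theorem multI_eq_zero (j : Fin nI) {t : Config n} (h : 1 / L2 < S.hi j t) :
    S.multI L2 j t = 0 := by
  have : (fun x => S.hibar j x L2) =ᶠ[𝓝 (S.hi j t)] fun _ => 0 := by
    filter_upwards [lt_mem_nhds h] with x hx
    exact hS.hibar_eq_zero j (le_of_lt hx)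
  rw [multI, this.deriv_eq, deriv_const]

end Relaxation

variable {P : SolverParams} (hS : Standing S P.L2) (hP : S.ValidParams P)

include hS hP

/-- The perturbed KKT condition at a point accepted by all tests. -/
theorem kktto_of_converged (hslater : S.SlaterAssumption) {D : Finset ℚ} (hD : IsGrid S.N D)
    {θ : Traj n D} {u : Controls m S.N} (hu : ∀ i, u i ∈ S.X) {Hθ : Traj n D →L[ℝ] Traj n D}
    {Hu : Controls m S.N →L[ℝ] Controls m S.N} (hHθ : HessianBound P.L5 Hθ)
    (hHu : HessianBound P.L5 Hu) {dθ : Traj n D} {du : Controls m S.N} {μ : Traj n D}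
    (hQP : S.QPSolution P.L2 θ u Hθ Hu dθ du μ) (hc : S.Converged P (S.tol P) θ u dθ du)
    (hcheck : ∀ i, ¬ S.CheckFails P θ i) :
    S.KKTTO P.ε (S.multE P.L2) (S.multI P.L2) θ u := by
  have hL5 : 0 < P.L5 := by linarith [hP.loopParams.L5]
  have htol : S.tol P ≤ P.ε := tol_le hP.loopParams.ε
  have htest : ∀ j ∈ D, S.Hg P.L2 θ j ≤ Real.exp (6 * S.dt D j / sigmaMin S.mass) *
      (S.Hg P.L2 θ (pred D j) + ((‖S.g‖ + P.k) ^ 2 + P.ε ^ 2) * S.dt D j) := by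
    intro j hj
    by_contra h
    exact hcheck j ⟨hj, Or.inl (not_le.1 h)⟩
  have hPg : ∀ i ∈ D, S.Pg P.L2 (S.frame θ i) < P.L2 := fun i hi =>
    hS.Pg_lt_of_energy_lt
      (hS.energy_lt hP hslater hD θ (Finset.mem_insert_of_mem hi) fun j hj _ => htest j hj)
  have hpbar : ∀ i : D, S.pbar (θ i) P.L2 < P.L2 := fun i => by
    have := (hS.of_Pg_lt (hPg i i.2)).1
    rwa [frame_of_mem] at this
  -- The determinant tests link each index to its predecessor, back to determinant `1` at the
  -- initial frame.
  have hsign : ∀ r, ∀ i ∈ insert 0 D, SignType.sign (S.R r (S.frame θ i)).det = 1 := by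
    intro r
    refine grid_induction ?_ fun i hi ih => ?_
    · have h0 : (0 : ℚ) ∉ D := fun h => lt_irrefl _ (hD 0 h).1
      have e0 : S.frame θ 0 = S.θ0 := by simp [frame, h0]
      rw [e0, hslater.2.1 r, sign_one]
    · have hi0 := (hD i hi).1
      rw [← ih (pred D i) (pred_mem hi0) (pred_lt D (by linarith))]
      by_contra h
      exact hcheck i ⟨hi, Or.inr ⟨r, h⟩⟩
  obtain ⟨⟨hmem, hfeas⟩, hmin, μu, h1, h2, h3⟩ := hQP
  have hdθ : ‖dθ‖ ≤ S.tol P / P.L5 := (norm_left_le_stepNorm dθ du).trans hc.1.le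
  have hdu : ‖du‖ ≤ S.tol P / P.L5 := (norm_right_le_stepNorm dθ du).trans hc.1.le
  have hscale : P.L5 * (S.tol P / P.L5) = S.tol P := by field_simp
  -- Multipliers are those of the last quadratic program, and `u'` is the control after its full
  -- step, where the normal-cone condition holds. The two gradients reduce to `-Hθ dθ` and `-Hu du`,
  -- for which the step tolerance is divided by `L5`.
  refine ⟨⟨μ, μu, u + du, ⟨_, hS.hasGradientAt_lagrangian_left hD μ μu u hpbar, ?_⟩,
    ⟨_, hS.hasGradientAt_lagrangian_right hD μ μu u hpbar, ?_⟩, fun i => ⟨hu i, hmem i, ?_, h3 i⟩⟩,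
    fun i hi => ?_⟩
  · have e : gradient (fun θ' => S.O D θ' u) θ +
        ContinuousLinearMap.adjoint (S.jacθ P.L2 θ u) μ = -Hθ dθ := by
      rw [← sub_eq_zero, ← h1]; abel
    rw [e, norm_neg]
    calc ‖Hθ dθ‖ ≤ P.L5 * ‖dθ‖ := hHθ.norm_apply_le hL5 _
      _ ≤ P.L5 * (S.tol P / P.L5) := by gcongr
      _ ≤ P.ε := by rw [hscale]; exact htol
  · have e : gradient (fun u' => S.O D θ u') u +
        ContinuousLinearMap.adjoint (S.jacu P.L2 θ u) μ + μu = -Hu du := by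
      rw [← sub_eq_zero, ← h2]; abel
    rw [e, norm_neg]
    calc ‖Hu du‖ ≤ P.L5 * ‖du‖ := hHu.norm_apply_le hL5 _
      _ ≤ P.L5 * (S.tol P / P.L5) := by gcongr
      _ ≤ P.ε := by rw [hscale]; exact htol
  · have e : u i - (u + du) i = -du i := by rw [PiLp.add_apply]; abel
    rw [e, norm_neg]
    refine (PiLp.norm_apply_le du i).trans (hdu.trans (le_trans ?_ htol))
    exact div_le_self (tol_pos hP.loopParams.ε).le hP.loopParams.L5
  · obtain ⟨hp, heq, hin⟩ := hS.of_Pg_lt (hPg i hi)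
    have hinv := hP.one_div_L2_lt
    refine ⟨hS.differentiableAt_p hp, fun j hj => ?_, fun j hj => ?_, ?_,
      fun j => ((heq j).trans hinv).le, fun r => ?_, fun j => (hin j).le,
      fun j => hS.multI_nonpos j _, fun j => ?_⟩
    · exact differentiableAt_of_comp_of_deriv_ne_zero (φ := fun x => S.hebar j x P.L2)
        ((hS.relax.2.1.2 j).2 P.L2 hS.pos).2.1 (hS.locallyLipschitz_eqc j).continuous.continuousAt
        (((hS.relax.2.1.2 j).2 P.L2 hS.pos).1.1 _) hj
    · exact differentiableAt_of_comp_of_deriv_ne_zero (φ := fun x => S.hibar j x P.L2)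
        ((hS.relax.2.2.2 j).2 P.L2 hS.pos).2.1 (hS.relax.2.2.1 j).continuous.continuousAt
        (((hS.relax.2.2.2 j).2 P.L2 hS.pos).1.1 _) hj
    · have e := hS.eom_eq_gradL hD u ⟨i, hi⟩ (hpbar ⟨i, hi⟩)
      rw [e]
      exact (norm_apply_le_l1norm _ _).trans (hc.2.le.trans htol)
    · refine abs_det_sub_one_lt (hP.2.2.2.2.2.1 r.pos) ?_
        (sign_eq_one_iff.1 (hsign r i (Finset.mem_insert_of_mem hi)))
      exact (le_abs_self _).trans_lt ((heq (Sum.inr r)).trans hinv)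
    -- A constraint value above `ε > 1 / L2` lies where the penalty is inactive, so the multiplier
    -- is zero.
    · by_cases hle : S.hi j (S.frame θ i) ≤ P.ε
      · rw [max_eq_right (by linarith), mul_zero]
      · rw [hS.multI_eq_zero j (hinv.trans (not_le.1 hle)), zero_mul]

end Standing
end TOProblem

/-! ### Separated grids -/

/-- The indices, together with `0`, have pairwise distance at least `q`. -/
def IsSeparated (q : ℝ) (D : Finset ℚ) : Prop :=
  ∀ a ∈ insert 0 D, ∀ b ∈ insert 0 D, a < b → q ≤ (b : ℝ) - a

/-- The map `i ↦ ⌊i / q⌋` is strictly increasing on the grid and takes values up to `⌊N / q⌋`. -/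
theorem IsSeparated.card_le {N : ℕ} {q : ℝ} (hq : 0 < q) {D : Finset ℚ} (hD : IsGrid N D)
    (h : IsSeparated q D) : D.card ≤ ⌊(N : ℝ) / q⌋₊ + 1 := by
  have hmaps : ∀ i ∈ D, ⌊(i : ℝ) / q⌋₊ ∈ Finset.range (⌊(N : ℝ) / q⌋₊ + 1) := by
    intro i hi
    rw [Finset.mem_range, Nat.lt_succ_iff]
    refine Nat.floor_le_floor ?_
    have : (i : ℝ) ≤ N := by exact_mod_cast (hD i hi).2
    gcongr
  have hlt : ∀ a ∈ D, ∀ b ∈ D, a < b → ⌊(a : ℝ) / q⌋₊ < ⌊(b : ℝ) / q⌋₊ := by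
    intro a ha b hb hab
    have h1 := h a (Finset.mem_insert_of_mem ha) b (Finset.mem_insert_of_mem hb) hab
    have ha0 : (0 : ℝ) ≤ a := by exact_mod_cast (hD a ha).1.le
    have h2 : (a : ℝ) / q + 1 ≤ (b : ℝ) / q := by
      rw [div_add_one hq.ne']
      gcongr
      linarith
    have h3 := Nat.floor_le_floor h2
    rw [Nat.floor_add_one (by positivity)] at h3
    omega
  have := Finset.card_le_card_of_injOn (fun i : ℚ => ⌊(i : ℝ) / q⌋₊) hmaps fun a ha b hb hab => by
    rcases lt_trichotomy a b with hlt' | heq | hlt'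
    · exact absurd hab (hlt a ha b hb hlt').ne
    · exact heq
    · exact absurd hab (hlt b hb a ha hlt').ne'
  simpa using this

theorem IsGrid.insert_midpoint {N : ℕ} {D : Finset ℚ} (hD : IsGrid N D) {i : ℚ} (hi : i ∈ D) :
    IsGrid N (insert ((i + pred D i) / 2) D) := by
  obtain ⟨h0, hN⟩ := hD i hi
  have h1 := pred_nonneg (D := D) h0
  have h2 := pred_lt D (by linarith : -1 < i)
  intro j hj
  rcases Finset.mem_insert.1 hj with rfl | hj
  · constructor <;> linarith
  · exact hD j hj

theorem IsGrid.midpoint_notMem {N : ℕ} {D : Finset ℚ} (hD : IsGrid N D) {i : ℚ} (hi : i ∈ D) :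
    (i + pred D i) / 2 ∉ D := by
  intro hm
  have h0 := (hD i hi).1
  have h2 := pred_lt D (by linarith : -1 < i)
  have := le_pred (by linarith : -1 < i) (Finset.mem_insert_of_mem hm) (by linarith)
  linarith

/-- No index lies strictly between `pred D i` and `i`, so half of a gap of length at least `2 q`
separates the midpoint from everything else. -/
theorem IsSeparated.insert_midpoint {N : ℕ} {q : ℝ} {D : Finset ℚ} (hD : IsGrid N D)
    (h : IsSeparated q D) {i : ℚ} (hi : i ∈ D) (hlen : 2 * q ≤ (i : ℝ) - pred D i) :
    IsSeparated q (insert ((i + pred D i) / 2) D) := by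
  have h0 := (hD i hi).1
  have h2 := pred_lt D (by linarith : -1 < i)
  rw [IsSeparated, Finset.insert_comm]
  have hmid : (((i + pred D i) / 2 : ℚ) : ℝ) = ((i : ℝ) + pred D i) / 2 := by push_cast; ring
  intro a ha b hb hab
  rcases Finset.mem_insert.1 ha with rfl | ha <;> rcases Finset.mem_insert.1 hb with rfl | hb
  · exact absurd hab (lt_irrefl _)
  · have hib : i ≤ b := by
      by_contra hc
      have := le_pred (by linarith : -1 < i) hb (not_le.1 hc)
      linarith
    have hib' : (i : ℝ) ≤ b := by exact_mod_cast hib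
    rw [hmid]; linarith
  · have hap : a ≤ pred D i := le_pred (by linarith : -1 < i) ha (by linarith)
    have hap' : (a : ℝ) ≤ (pred D i : ℚ) := by exact_mod_cast hap
    rw [hmid]; linarith
  · exact h a ha b hb hab

/-! ### Invariant, progress and termination of the whole solver. -/

namespace TOProblem

variable {n m nE nI nR : ℕ} {S : TOProblem n m nE nI nR}

theorem isGrid_grid0 (S : TOProblem n m nE nI nR) : IsGrid S.N S.grid0 := by
  intro i hi
  obtain ⟨k, hk, rfl⟩ := Finset.mem_image.1 hi
  obtain ⟨h1, h2⟩ := Finset.mem_Icc.1 hk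
  exact ⟨by exact_mod_cast h1, by exact_mod_cast h2⟩

theorem isSeparated_grid0 (S : TOProblem n m nE nI nR) {q : ℝ} (hq : q ≤ 1) :
    IsSeparated q S.grid0 := by
  have hnat : ∀ a ∈ insert 0 S.grid0, ∃ k : ℕ, a = k := by
    intro a ha
    rcases Finset.mem_insert.1 ha with rfl | ha
    · exact ⟨0, by simp⟩
    · obtain ⟨k, -, rfl⟩ := Finset.mem_image.1 ha
      exact ⟨k, rfl⟩
  intro a ha b hb hab
  obtain ⟨k, rfl⟩ := hnat a ha
  obtain ⟨l, rfl⟩ := hnat b hb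
  have hkl : k < l := by exact_mod_cast hab
  have : (k : ℝ) + 1 ≤ l := by exact_mod_cast hkl
  push_cast
  linarith

/-- What holds in every reachable state of the solver. -/
structure Invariant (S : TOProblem n m nE nI nR) (P : SolverParams) (q : ℝ) (s : S.State) :
    Prop where
  grid : IsGrid S.N s.D
  separated : IsSeparated q s.D
  control : ∀ i, s.u i ∈ S.X
  converged : s.loc = Loc.check ∨ s.loc = Loc.done →
    ∃ (Hθ : Traj n s.D →L[ℝ] Traj n s.D) (Hu : Controls m S.N →L[ℝ] Controls m S.N)
      (dθ : Traj n s.D) (du : Controls m S.N) (μ : Traj n s.D),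
      HessianBound P.L5 Hθ ∧ HessianBound P.L5 Hu ∧ S.QPSolution P.L2 s.θ s.u Hθ Hu dθ du μ ∧
      S.Converged P (S.tol P) s.θ s.u dθ du
  checked : s.loc = Loc.done → ∀ i, ¬ S.CheckFails P s.θ i

theorem exists_isLeast_of_subset {D : Finset ℚ} {p : ℚ → Prop} (hp : ∀ i, p i → i ∈ D)
    (hex : ∃ i, p i) : ∃ i, IsLeast {j | p j} i := by
  have hfin : {j | p j}.Finite := D.finite_toSet.subset hp
  obtain ⟨i, hi, hmin⟩ := Set.exists_min_image _ id hfin hex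
  exact ⟨i, hi, hmin⟩

namespace Standing

variable {P : SolverParams} (hS : Standing S P.L2) (hP : S.ValidParams P)

include hS hP

theorem exists_step {q : ℝ} {s : S.State} (hs : S.Invariant P q s) (hloc : s.loc ≠ Loc.done) :
    ∃ s', S.Step P s s' := by
  obtain ⟨loc, D, θ, u, ρ⟩ := s
  have hD : IsGrid S.N D := hs.grid
  have hu : ∀ i, u i ∈ S.X := hs.control
  cases loc with
  | sqp =>
    rcases le_or_gt P.L4 (l1norm (S.gradL P.L2 θ u)) with h | h
    · exact ⟨_, Step.callConstraint D θ u ρ h⟩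
    · exact ⟨_, Step.callInner D θ u ρ h⟩
  | constraint =>
    by_cases hsing : ∃ i, S.SingularAt P θ u i
    · obtain ⟨i, hi⟩ := exists_isLeast_of_subset (fun i (h : S.SingularAt P θ u i) => h.1) hsing
      exact ⟨_, Step.constraintSubdivide D θ u ρ i hi⟩
    · have hns : ∀ i, ¬ S.SingularAt P θ u i := not_exists.1 hsing
      rcases le_or_gt P.L4 (l1norm (S.gradL P.L2 θ u)) with h | h
      · obtain ⟨d, j, hd, hj⟩ := hS.exists_newton_step hP.loopParams hD hns h
        exact ⟨_, Step.constraintNewton D θ u ρ d j hns h hd hj⟩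
      · exact ⟨_, Step.constraintReturn D θ u ρ hns h⟩
  | inner =>
    by_cases hsing : ∃ i, S.SingularAt P θ u i
    · obtain ⟨i, hi⟩ := exists_isLeast_of_subset (fun i (h : S.SingularAt P θ u i) => h.1) hsing
      exact ⟨_, Step.innerSubdivide D θ u ρ i hi⟩
    · have hns : ∀ i, ¬ S.SingularAt P θ u i := not_exists.1 hsing
      obtain ⟨C, -, hC⟩ := hS.exists_jacθ_bound hP.loopParams.L3 hD
      obtain ⟨dθ, du, μ, hQP⟩ :=
        hS.exists_qpSolution hu (hC θ u (le_sigmaMin_of_not_singularAt hns))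
      have hHθ := hessianBound_id (E := Traj n D) hP.loopParams.L5
      have hHu := hessianBound_id (E := Controls m S.N) hP.loopParams.L5
      by_cases hc : S.Converged P (S.tol P) θ u dθ du
      · exact ⟨_, Step.innerReturn D θ u ρ _ _ dθ du μ hns hHθ hHu hQP hc⟩
      · obtain ⟨j, hj⟩ := hS.exists_inner_step hP.loopParams hu hHθ hHu hQP hc ρ
        exact ⟨_, Step.innerStep D θ u ρ _ _ _ dθ du μ j hns hHθ hHu hQP hc rfl hj⟩
  | check =>
    by_cases hfail : ∃ i, S.CheckFails P θ i
    · obtain ⟨i, hi⟩ := exists_isLeast_of_subset (fun i (h : S.CheckFails P θ i) => h.1) hfail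
      exact ⟨_, Step.checkSubdivide D θ u ρ i hi⟩
    · exact ⟨_, Step.checkReturn D θ u ρ (not_exists.1 hfail)⟩
  | done => exact absurd rfl hloc

/-- The minimal distance of time indices that subdivision preserves. -/
theorem exists_separation (hslater : S.SlaterAssumption) : ∃ q : ℝ, 0 < q ∧ q ≤ 1 ∧
    (∀ (D : Finset ℚ), IsGrid S.N D → ∀ (θ : Traj n D) (u : Controls m S.N),
      (∀ i, u i ∈ S.X) → ∀ i, S.SingularAt P θ u i → 2 * q ≤ (i : ℝ) - pred D i) ∧
    ∀ (D : Finset ℚ), IsGrid S.N D → ∀ (θ : Traj n D) (u : Controls m S.N),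
      (∀ i, u i ∈ S.X) → l1norm (S.gradL P.L2 θ u) < S.tol P →
      ∀ i, IsLeast {j | S.CheckFails P θ j} i → 2 * q ≤ (i : ℝ) - pred D i := by
  obtain ⟨h₁, hh₁, H₁⟩ := hS.exists_singular_step hP
  obtain ⟨h₂, hh₂, H₂⟩ := hS.exists_check_step hP hslater
  have hδ := hS.step
  have hmin : 0 < min h₁ h₂ := lt_min hh₁ hh₂
  -- A step size is `δ` times an index gap, hence the division by `2 δ`; the cap `1` accommodates
  -- the unit spacing of `grid0`.
  have key : ∀ (D : Finset ℚ) (i : ℚ), min h₁ h₂ ≤ S.dt D i →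
      2 * min 1 (min h₁ h₂ / (2 * S.δ)) ≤ (i : ℝ) - pred D i := by
    intro D i h
    have h1 := min_le_right 1 (min h₁ h₂ / (2 * S.δ))
    rw [dt] at h
    push_cast at h
    have h2 : min h₁ h₂ / (2 * S.δ) ≤ ((i : ℝ) - pred D i) / 2 := by
      rw [div_le_div_iff₀ (by positivity) (by norm_num)]
      linarith
    linarith
  refine ⟨min 1 (min h₁ h₂ / (2 * S.δ)), lt_min one_pos (by positivity), min_le_left _ _, ?_, ?_⟩
  · exact fun D hD θ u hu i hi => key D i ((min_le_left _ _).trans (H₁ D hD θ u hu i hi).le)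
  · exact fun D hD θ u hu hl i hi =>
      key D i ((min_le_right _ _).trans (H₂ D hD θ u hu hl i hi).le)

/-- The delicate cases are subdivisions, where the gap must be at least `2 q`, and the SQP step,
where convexity of `X` keeps the controls feasible. -/
theorem invariant_step {q : ℝ}
    (hsing : ∀ (D : Finset ℚ), IsGrid S.N D → ∀ (θ : Traj n D) (u : Controls m S.N),
      (∀ i, u i ∈ S.X) → ∀ i, S.SingularAt P θ u i → 2 * q ≤ (i : ℝ) - pred D i)
    (hcheck : ∀ (D : Finset ℚ), IsGrid S.N D → ∀ (θ : Traj n D) (u : Controls m S.N),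
      (∀ i, u i ∈ S.X) → l1norm (S.gradL P.L2 θ u) < S.tol P →
      ∀ i, IsLeast {j | S.CheckFails P θ j} i → 2 * q ≤ (i : ℝ) - pred D i)
    {s s' : S.State} (hs : S.Invariant P q s) (h : S.Step P s s') : S.Invariant P q s' := by
  obtain ⟨hD, hsep, hu, hconv, hchk⟩ := hs
  cases h with
  | callConstraint D θ u ρ h => exact ⟨hD, hsep, hu, by simp, by simp⟩
  | callInner D θ u ρ h => exact ⟨hD, hsep, hu, by simp, by simp⟩
  | constraintSubdivide D θ u ρ i h =>
    have hi := h.1.1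
    exact ⟨hD.insert_midpoint hi, hsep.insert_midpoint hD hi (hsing D hD θ u hu i h.1), hu,
      by simp, by simp⟩
  | constraintReturn D θ u ρ h h' => exact ⟨hD, hsep, hu, by simp, by simp⟩
  | constraintNewton D θ u ρ d j h h' hd hj => exact ⟨hD, hsep, hu, by simp, by simp⟩
  | innerSubdivide D θ u ρ i h =>
    have hi := h.1.1
    exact ⟨hD.insert_midpoint hi, hsep.insert_midpoint hD hi (hsing D hD θ u hu i h.1), hu,
      by simp, by simp⟩
  | innerReturn D θ u ρ Hθ Hu dθ du μ h hHθ hHu hQP hc =>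
    exact ⟨hD, hsep, hu, fun _ => ⟨Hθ, Hu, dθ, du, μ, hHθ, hHu, hQP, hc⟩, by simp⟩
  | innerStep D θ u ρ ρ' Hθ Hu dθ du μ j h hHθ hHu hQP hc hρ hj =>
    refine ⟨hD, hsep, fun i => ?_, by simp, by simp⟩
    have hη := hP.loopParams.η
    have h0 : 0 ≤ P.η ^ j := (pow_pos hη.1 j).le
    have h1 : P.η ^ j ≤ 1 := pow_le_one₀ hη.1.le hη.2.le
    have h2 := hS.convex_X (hu i) (hQP.1.1 i) (a := 1 - P.η ^ j) (b := P.η ^ j)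
      (by linarith) h0 (by ring)
    have e : (u + P.η ^ j • du) i = (1 - P.η ^ j) • u i + P.η ^ j • (u i + du i) := by
      rw [PiLp.add_apply, PiLp.smul_apply]; module
    exact e ▸ h2
  | checkSubdivide D θ u ρ i h =>
    have hi := h.1.1
    -- The convergence record kept since `SQP` returned supplies the small residual that the
    -- step-size bound for failed tests requires.
    obtain ⟨Hθ, Hu, dθ, du, μ, -, -, -, hc⟩ := hconv (Or.inl rfl)
    exact ⟨hD.insert_midpoint hi, hsep.insert_midpoint hD hi (hcheck D hD θ u hu hc.2 i h), hu,
      by simp, by simp⟩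
  | checkReturn D θ u ρ h => exact ⟨hD, hsep, hu, fun _ => hconv (Or.inl rfl), fun _ => h⟩

/-- Nested well-founded induction: outside, the number of indices that may still be inserted;
inside, for a fixed grid, the accessibility of the two loops and an otherwise acyclic control flow.
-/
theorem step_acc {q : ℝ} (hq : 0 < q)
    (hinv : ∀ {s s' : S.State}, S.Invariant P q s → S.Step P s s' → S.Invariant P q s')
    (s : S.State) (hs : S.Invariant P q s) : Acc (fun a b => S.Step P b a) s := by
  induction hk : ⌊(S.N : ℝ) / q⌋₊ + 1 - s.D.card using Nat.strong_induction_on generalizing s with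
  | _ k ihk =>
  obtain ⟨loc₀, D, θ₀, u₀, ρ₀⟩ := s
  have hD : IsGrid S.N D := hs.grid
  have hsub : ∀ s' : S.State, S.Invariant P q s' → D.card < s'.D.card →
      Acc (fun a b => S.Step P b a) s' := by
    intro s' hs' hlt
    have hcard := hs'.separated.card_le hq hs'.grid
    refine ihk _ ?_ s' hs' rfl
    simp only at hk
    omega
  have hcardlt : ∀ i ∈ D, D.card < (insert ((i + pred D i) / 2) D).card := fun i hi => by
    rw [Finset.card_insert_of_notMem (hD.midpoint_notMem hi)]; exact Nat.lt_succ_self _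
  have hdone : ∀ θ u ρ, Acc (fun a b => S.Step P b a) (⟨Loc.done, D, θ, u, ρ⟩ : S.State) :=
    fun θ u ρ => Acc.intro _ fun s' h => by cases h
  have hchk : ∀ θ u ρ, S.Invariant P q ⟨Loc.check, D, θ, u, ρ⟩ →
      Acc (fun a b => S.Step P b a) (⟨Loc.check, D, θ, u, ρ⟩ : S.State) := by
    intro θ u ρ hI
    refine Acc.intro _ fun s' h => ?_
    have hI' := hinv hI h
    cases h with
    | checkSubdivide _ _ _ _ i h => exact hsub _ hI' (hcardlt i h.1.1)
    | checkReturn => exact hdone _ _ _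
  have hinner : ∀ a : (Traj n D × Controls m S.N) × ℝ,
      S.Invariant P q ⟨Loc.inner, D, a.1.1, a.1.2, a.2⟩ →
      Acc (fun a b => S.Step P b a) (⟨Loc.inner, D, a.1.1, a.1.2, a.2⟩ : S.State) := by
    intro a hI
    have hacc := hS.innerRel_acc hP.loopParams hD a hI.control
    induction hacc with
    | intro a _ iha =>
      refine Acc.intro _ fun s' h => ?_
      have hI' := hinv hI h
      cases h with
      | innerSubdivide _ _ _ _ i h => exact hsub _ hI' (hcardlt i h.1.1)
      | innerReturn => exact hchk _ _ _ hI'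
      | innerStep _ _ _ _ ρ' Hθ Hu dθ du μ j h hHθ hHu hQP hc hρ hj =>
        exact iha (a.1 + P.η ^ j • (dθ, du), ρ')
          ⟨Hθ, Hu, (dθ, du), μ, j, h, hHθ, hHu, hQP, hc, hρ, hj, rfl⟩ hI'
  -- `Constraint-Solve` returns only with residual below `L4`, after which `SQP` must enter
  -- `SQP-Inner`; this excludes a cycle between the two on a fixed grid.
  have hsqp' : ∀ θ u ρ, l1norm (S.gradL P.L2 θ u) < P.L4 →
      S.Invariant P q ⟨Loc.sqp, D, θ, u, ρ⟩ →
      Acc (fun a b => S.Step P b a) (⟨Loc.sqp, D, θ, u, ρ⟩ : S.State) := by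
    intro θ u ρ hl hI
    refine Acc.intro _ fun s' h => ?_
    have hI' := hinv hI h
    cases h with
    | callConstraint _ _ _ _ h => exact absurd h (not_le.2 hl)
    | callInner => exact hinner ((θ, u), ρ) hI'
  have hcon : ∀ u ρ θ, S.Invariant P q ⟨Loc.constraint, D, θ, u, ρ⟩ →
      Acc (fun a b => S.Step P b a) (⟨Loc.constraint, D, θ, u, ρ⟩ : S.State) := by
    intro u ρ θ hI
    have hacc := hS.newtonRel_acc hP.loopParams hD u θ
    induction hacc with
    | intro θ _ ihθ =>
      refine Acc.intro _ fun s' h => ?_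
      have hI' := hinv hI h
      cases h with
      | constraintSubdivide _ _ _ _ i h => exact hsub _ hI' (hcardlt i h.1.1)
      | constraintReturn _ _ _ _ h h' => exact hsqp' _ _ _ h' hI'
      | constraintNewton _ _ _ _ d j h h' hd hj =>
        exact ihθ _ ⟨d, j, h, h', hd, hj, rfl⟩ hI'
  cases loc₀ with
  | sqp =>
    refine Acc.intro _ fun s' h => ?_
    have hI' := hinv hs h
    cases h with
    | callConstraint => exact hcon _ _ _ hI'
    | callInner => exact hinner ((θ₀, u₀), ρ₀) hI'
  | constraint => exact hcon _ _ _ hs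
  | inner => exact hinner ((θ₀, u₀), ρ₀) hs
  | check => exact hchk _ _ _ hs
  | done => exact hdone _ _ _

end Standing
end TOProblem

end TrajOpt

end

/-- Total correctness of the white-box TO solver: no run is infinite, no run gets stuck before it
returns, and whatever it returns satisfies the perturbed KKT condition of the original problem. -/
theorem mainTheorem1 {n m nE nI nR : ℕ} (hn : 0 < n) (S : TrajOpt.TOProblem n m nE nI nR)
    (hM : S.M.PosDef) (hδ : 0 < S.δ)
    (hO : S.CostAssumption) (hR : S.RelaxationAssumption) (hB : S.ControlBoundAssumption)
    (hS : S.SlaterAssumption)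
    (P : TrajOpt.SolverParams) (hP : S.ValidParams P)
    (θ : TrajOpt.Traj n S.grid0) (u : TrajOpt.Controls m S.N) (hu : ∀ i, u i ∈ S.X) :
    (¬ ∃ run : ℕ → S.State, run 0 = S.start θ u ∧ ∀ k, S.Step P (run k) (run (k + 1))) ∧
    (∀ s, Relation.ReflTransGen (S.Step P) (S.start θ u) s →
      s.loc ≠ TrajOpt.TOProblem.Loc.done → ∃ s', S.Step P s s') ∧
    (∀ s, Relation.ReflTransGen (S.Step P) (S.start θ u) s →
      s.loc = TrajOpt.TOProblem.Loc.done →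
        S.KKTTO P.ε (S.multE P.L2) (S.multI P.L2) s.θ s.u) := by
  have hstand : S.Standing P.L2 := ⟨hn, hM, hδ, hO, hR, hB, hP.L2_pos⟩
  obtain ⟨q, hq, hq1, hsing, hcheck⟩ := hstand.exists_separation hP hS
  have hinv : ∀ {s s' : S.State}, S.Invariant P q s → S.Step P s s' → S.Invariant P q s' :=
    fun hs h => hstand.invariant_step hP hsing hcheck hs h
  have hstart : S.Invariant P q (S.start θ u) :=
    ⟨S.isGrid_grid0, S.isSeparated_grid0 hq1, hu, by simp [TrajOpt.TOProblem.start],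
      by simp [TrajOpt.TOProblem.start]⟩
  have hreach : ∀ s, Relation.ReflTransGen (S.Step P) (S.start θ u) s → S.Invariant P q s := by
    intro s hs
    induction hs with
    | refl => exact hstart
    | tail _ h ih => exact hinv ih h
  refine ⟨TrajOpt.not_exists_run_of_acc (hstand.step_acc hP hq hinv _ hstart),
    fun s hs hloc => hstand.exists_step hP (hreach s hs) hloc, fun s hs hloc => ?_⟩
  have hI := hreach s hs
  obtain ⟨Hθ, Hu, dθ, du, μ, hHθ, hHu, hQP, hc⟩ := hI.converged (Or.inr hloc)
  exact hstand.kktto_of_converged hP hS hI.grid hI.control hHθ hHu hQP hc (hI.checked hloc)
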